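/- For $r>1$ let $A(r)=\{z\in\mathbb C:1<|z|<r\}$ and $\overline{A}(r)=\{z\in\mathbb C:1\le|z|\le r\}$. For $K\ge 1$, a homeomorphism $\psi$ between open subsets of $\mathbb C$ is $K$-quasiconformal ($K$-q.c.) if it has distributional first partial derivatives in $L^2_{loc}$ and $|\psi_{\bar z}|\le\frac{K-1}{K+1}|\psi_z|$ almost everywhere. If $\gamma:[a,b]\to\mathbb C\setminus\{0\}$ is a curve written in polar coordinates as $\gamma(t)=\rho(t)e^{i\theta(t)}$ with $\rho>0$ and $\theta$ continuous, its wrapping number is $\theta(b)-\theta(a)$. Let $K\ge 1$ and $r>1$. Then there is a constant $N$, depending only on $K$ and $r$, such that for every $r'>1$ and every $K$-q.c. homeomorphism $\psi$ of $A(r)$ onto $A(r')$ the following holds: $\psi$ extends continuously to $\overline{A}(r)$, and the curve $t\mapsto\psi(t)$, $t\in[1,r]$ (with $\psi(1)$ and $\psi(r)$ given by this extension), has wrapping number in $[-N,N]$. -/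

import Mathlib

open MeasureTheory Set
open scoped ContDiff

/-- The open round annulus `{1 < |z| < r}`. -/
def roundAnnulus (r : ℝ) : Set ℂ := {z | 1 < ‖z‖ ∧ ‖z‖ < r}

/-- The closed round annulus `{1 ≤ |z| ≤ r}`. -/
def closedRoundAnnulus (r : ℝ) : Set ℂ := {z | 1 ≤ ‖z‖ ∧ ‖z‖ ≤ r}

/-- On the open set `U`, the function `g` is the weak (distributional) derivative of `f`
in the direction `v`: `∫ (∂φ/∂v) f = - ∫ φ g` for all test functions `φ ∈ C_c^∞(U)`. -/
def IsWeakDerivOn (U : Set ℂ) (f g : ℂ → ℂ) (v : ℂ) : Prop :=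
  ∀ φ : ℂ → ℝ, ContDiff ℝ ∞ φ → HasCompactSupport φ → tsupport φ ⊆ U →
    ∫ z, (fderiv ℝ φ z v) • f z = - ∫ z, φ z • g z

/-- `g` is in `L²_loc(U)`, with respect to the Lebesgue measure. -/
def IsL2Loc (U : Set ℂ) (g : ℂ → ℂ) : Prop :=
  ∀ C : Set ℂ, IsCompact C → C ⊆ U → MemLp g 2 (volume.restrict C)

/-- The homeomorphism `ψ` from the open set `ψ.source` onto the open set `ψ.target` is `K`-q.c.
(analytic definition): it has weak partial derivatives `fx`, `fy` in `L²_loc`, and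
`|ψ_{z̄}| ≤ ((K - 1) / (K + 1)) |ψ_z|` almost everywhere, where `ψ_z = (fx - i fy) / 2` and
`ψ_{z̄} = (fx + i fy) / 2`.  The last inequality makes the Jacobian `|ψ_z|² - |ψ_{z̄}|²`
nonnegative, so that such a `ψ` preserves the orientation. -/
def IsQuasiconformal (K : ℝ) (ψ : OpenPartialHomeomorph ℂ ℂ) : Prop :=
  1 ≤ K ∧ ∃ fx fy : ℂ → ℂ,
    IsL2Loc ψ.source fx ∧ IsL2Loc ψ.source fy ∧
    IsWeakDerivOn ψ.source ψ fx 1 ∧ IsWeakDerivOn ψ.source ψ fy Complex.I ∧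
    ∀ᵐ z ∂(volume.restrict ψ.source),
      ‖(fx z + Complex.I * fy z) / 2‖ ≤ (K - 1) / (K + 1) * ‖(fx z - Complex.I * fy z) / 2‖

/-- The curve `γ : [a, b] → ℂ \ {0}` has wrapping number `w`: in polar coordinates
`γ t = ρ t * exp (i θ t)` with `ρ > 0` and `θ` continuous, and `w = θ b - θ a`. -/
def HasWrappingNumber (γ : ℝ → ℂ) (a b w : ℝ) : Prop :=
  ∃ ρ θ : ℝ → ℝ, ContinuousOn ρ (Icc a b) ∧ ContinuousOn θ (Icc a b) ∧
    (∀ t ∈ Icc a b, 0 < ρ t ∧ γ t = (ρ t : ℂ) * Complex.exp ((θ t : ℂ) * Complex.I)) ∧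
    w = θ b - θ a

open Filter Topology ENNReal Convolution

/-! Write `R = log r` and `R' = log r'`. Taking logarithms turns `ψ` into a homeomorphism `F` from
the strip `0 < Re z < R` onto `0 < Re w < R'` with `F (z + 2πi) = F z ± 2πi`. The argument of `ψ t`
is `Im F (log t)`, so the claim is that `F` has limits at the boundary lines and that `Im F` changes
by a bounded amount between `0` and `R`. Replacing `F` by `R' - F` if necessary, `F` sends the left
end to the left end and the right end to the right end.

Energy. Quasiconformality gives `|F_x|² + |F_y|² ≤ 2K Jac F`, and `Jac F` integrates over a period
to at most the area `2πR'` of a period of the target. The latter is proved by Green's formula for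
smooth periodic approximants of `F`, with a cut-off in `Re F`, followed by a passage to the limit
(`IsStripSobolev.integral_comp_re_mul_jac`, `energy_le`). Almost every horizontal line has an image
of length at least `R'`, so Cauchy-Schwarz gives `2πR'² ≤ R · 4πKR'`, that is `R' ≤ 2KR`
(`two_pi_mul_sq_le`). Hence the energy per period is at most `8πK²R`, which does not involve `r'`.

Length and area. Around a boundary point `iy₀` consider the boxes of width `Rs` and half-height
`πs`, `σ < s < 1`. The three sides of such a box that lie in the strip form a crosscut, and the
energy bound makes the image of one of these crosscuts short once `log (1/σ)` is large compared with
the energy (`exists_small_crosscut`). A connected subset of the target that reaches the right end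
and misses the image of the crosscut also misses the image of the box (`avoid_of_crosscut`). Applied
to the half-strips above and below the image of the crosscut, this bounds the oscillation of `Im F`
on the box (`exists_small_im_oscillation`).

Letting `σ` tend to `0` gives boundary limits, since `Re F` is controlled by the behaviour at the
ends. With `σ = 1/2` the box at `0` contains the midpoint `R/2`, which bounds `Im F (R/2) - Im F 0`;
a half-turn of both strips handles the other endpoint. -/

/-! ### Square integrals of extended nonnegative functions -/

theorem sq_lintegral_le {α : Type*} [MeasurableSpace α] (μ : Measure α) {f : α → ℝ≥0∞}
    (hf : AEMeasurable f μ) : (∫⁻ x, f x ∂μ) ^ 2 ≤ μ univ * ∫⁻ x, f x ^ 2 ∂μ := by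
  have h := ENNReal.lintegral_mul_le_Lp_mul_Lq μ (p := 2) (q := 2)
    (by rw [Real.holderConjugate_iff]; norm_num) (aemeasurable_const (b := (1 : ℝ≥0∞))) hf
  simp only [Pi.mul_apply, one_mul, one_rpow, lintegral_const] at h
  calc (∫⁻ x, f x ∂μ) ^ 2 ≤ (μ univ ^ (1 / 2 : ℝ) * (∫⁻ x, f x ^ (2 : ℝ) ∂μ) ^ (1 / 2 : ℝ)) ^ 2 := by
        gcongr
    _ = μ univ * ∫⁻ x, f x ^ 2 ∂μ := by
        rw [mul_pow, ← ENNReal.rpow_natCast, ← ENNReal.rpow_natCast, ← ENNReal.rpow_mul,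
          ← ENNReal.rpow_mul]
        norm_num

theorem sq_lintegral_mul_le {α : Type*} [MeasurableSpace α] (μ : Measure α) {f g : α → ℝ≥0∞}
    (hf : AEMeasurable f μ) (hg : AEMeasurable g μ) :
    (∫⁻ x, f x * g x ∂μ) ^ 2 ≤ (∫⁻ x, f x ^ 2 ∂μ) * ∫⁻ x, g x ^ 2 ∂μ := by
  have h := ENNReal.lintegral_mul_le_Lp_mul_Lq μ (p := 2) (q := 2)
    (by rw [Real.holderConjugate_iff]; norm_num) hf hg
  simp only [Pi.mul_apply] at h
  calc (∫⁻ x, f x * g x ∂μ) ^ 2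
      ≤ ((∫⁻ x, f x ^ (2 : ℝ) ∂μ) ^ (1 / 2 : ℝ) * (∫⁻ x, g x ^ (2 : ℝ) ∂μ) ^ (1 / 2 : ℝ)) ^ 2 := by
        gcongr
    _ = _ := by
        rw [mul_pow, ← ENNReal.rpow_natCast, ← ENNReal.rpow_natCast, ← ENNReal.rpow_mul,
          ← ENNReal.rpow_mul]
        norm_num

theorem ENNReal.add_sq_le (a b : ℝ≥0∞) : (a + b) ^ 2 ≤ 2 * (a ^ 2 + b ^ 2) := by
  have := ENNReal.rpow_add_le_mul_rpow_add_rpow a b (p := 2) (by norm_num)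
  norm_num at this
  exact_mod_cast this

theorem tendsto_zero_of_sq_tendsto_zero {ι : Type*} {l : Filter ι} {u : ι → ℝ≥0∞}
    (h : Tendsto (fun n => u n ^ 2) l (𝓝 0)) : Tendsto u l (𝓝 0) := by
  have := (ENNReal.continuous_rpow_const (y := (1 / 2 : ℝ))).tendsto 0 |>.comp h
  refine (this.congr fun n => ?_).trans (by simp)
  simp only [Function.comp]
  rw [← ENNReal.rpow_natCast, ← ENNReal.rpow_mul]; norm_num

/-! ### Mollification and smooth approximation of Sobolev maps -/

/-- The normalized bump is a probability density, so Cauchy-Schwarz bounds the squared convolution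
pointwise by the convolution of the square. Tonelli and translation invariance finish. -/
theorem lintegral_sq_normed_convolution_le (φ : ContDiffBump (0 : ℂ)) {h : ℂ → ℂ}
    (hh : AEStronglyMeasurable h volume) :
    ∫⁻ z, ‖(φ.normed volume ⋆[ContinuousLinearMap.lsmul ℝ ℝ, volume] h) z‖ₑ ^ 2
      ≤ ∫⁻ z, ‖h z‖ₑ ^ 2 := by
  set ρ : ℂ → ℝ≥0∞ := fun t => ‖φ.normed volume t‖ₑ with hρ
  have hρm : Measurable ρ := (φ.continuous_normed).enorm.measurable
  have hρ1 : ∫⁻ t, ρ t = 1 := by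
    have h0 := ofReal_integral_eq_lintegral_ofReal (φ.integrable_normed (μ := volume))
      (Eventually.of_forall fun x => φ.nonneg_normed x)
    rw [φ.integral_normed] at h0
    simp only [ENNReal.ofReal_one] at h0
    rw [h0]
    refine lintegral_congr fun t => ?_
    simp only [hρ]
    rw [Real.enorm_eq_ofReal (φ.nonneg_normed t)]
  set μ := volume.withDensity ρ with hμ
  have hμac : μ ≪ volume := withDensity_absolutelyContinuous _ _
  have hμ1 : μ univ = 1 := by rw [hμ, withDensity_apply _ MeasurableSet.univ]; simpa using hρ1
  have hsub : ∀ z : ℂ, Measure.QuasiMeasurePreserving (fun t => z - t) volume volume :=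
    fun z => quasiMeasurePreserving_sub_left volume z
  have hpt : ∀ z, ‖(φ.normed volume ⋆[ContinuousLinearMap.lsmul ℝ ℝ, volume] h) z‖ₑ ^ 2
      ≤ ∫⁻ t, ρ t * ‖h (z - t)‖ₑ ^ 2 := by
    intro z
    have hm : AEMeasurable (fun t => ‖h (z - t)‖ₑ) volume :=
      (hh.comp_quasiMeasurePreserving (hsub z)).enorm
    calc ‖(φ.normed volume ⋆[ContinuousLinearMap.lsmul ℝ ℝ, volume] h) z‖ₑ ^ 2
        ≤ (∫⁻ t, ρ t * ‖h (z - t)‖ₑ) ^ 2 := by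
          gcongr
          rw [convolution_def]
          refine (enorm_integral_le_lintegral_enorm _).trans (lintegral_mono fun t => ?_)
          simp only [ContinuousLinearMap.lsmul_apply, enorm_smul, hρ]; rfl
      _ = (∫⁻ t, ‖h (z - t)‖ₑ ∂μ) ^ 2 := by
          rw [hμ, lintegral_withDensity_eq_lintegral_mul₀ hρm.aemeasurable hm]; rfl
      _ ≤ μ univ * ∫⁻ t, ‖h (z - t)‖ₑ ^ 2 ∂μ := sq_lintegral_le _ (hm.mono_ac hμac)
      _ = ∫⁻ t, ρ t * ‖h (z - t)‖ₑ ^ 2 := by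
          rw [hμ1, one_mul, hμ,
            lintegral_withDensity_eq_lintegral_mul₀ hρm.aemeasurable (hm.pow_const 2)]; rfl
  calc _ ≤ ∫⁻ z, ∫⁻ t, ρ t * ‖h (z - t)‖ₑ ^ 2 := lintegral_mono hpt
    _ = ∫⁻ t, ∫⁻ z, ρ t * ‖h (z - t)‖ₑ ^ 2 := by
        refine lintegral_lintegral_swap ?_
        refine (hρm.comp measurable_snd).aemeasurable.mul ?_
        have : AEStronglyMeasurable (fun p : ℂ × ℂ => h (p.1 - p.2)) (volume.prod volume) :=
          hh.comp_quasiMeasurePreserving (quasiMeasurePreserving_sub volume volume)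
        exact this.enorm.pow_const 2
    _ = ∫⁻ t, ρ t * ∫⁻ z, ‖h z‖ₑ ^ 2 := by
        refine lintegral_congr fun t => ?_
        rw [lintegral_const_mul' _ _ (by simp [hρ])]
        congr 1
        exact lintegral_sub_right_eq_self (fun z => ‖h z‖ₑ ^ 2) t
    _ = ∫⁻ z, ‖h z‖ₑ ^ 2 := by rw [lintegral_mul_const _ hρm, hρ1, one_mul]

/-- The mollifier supported in the ball of radius `1 / (n + 1)`. -/
noncomputable def mollifier (n : ℕ) : ContDiffBump (0 : ℂ) where
  rIn := 1 / (n + 2)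
  rOut := 1 / (n + 1)
  rIn_pos := by positivity
  rIn_lt_rOut := by gcongr; norm_num

theorem tendsto_mollifier_rOut : Tendsto (fun n => (mollifier n).rOut) atTop (𝓝 0) :=
  tendsto_one_div_add_atTop_nhds_zero_nat

theorem tendstoUniformlyOn_mollify {g : ℂ → ℂ} {C V : Set ℂ} (hC : IsCompact C) (hV : IsOpen V)
    (hCV : C ⊆ V) (hgm : AEStronglyMeasurable g volume) (hg : ContinuousOn g V) :
    TendstoUniformlyOn (fun n => ((mollifier n).normed volume
      ⋆[ContinuousLinearMap.lsmul ℝ ℝ, volume] g)) g atTop C := by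
  rw [Metric.tendstoUniformlyOn_iff]
  intro ε hε
  obtain ⟨δ₁, hδ₁, hsub⟩ := hC.exists_cthickening_subset_open hV hCV
  have huc : UniformContinuousOn g (Metric.cthickening δ₁ C) :=
    (hC.cthickening).uniformContinuousOn_of_continuous (hg.mono hsub)
  rw [Metric.uniformContinuousOn_iff] at huc
  obtain ⟨δ₂, hδ₂, hu⟩ := huc (ε / 2) (by positivity)
  filter_upwards [tendsto_mollifier_rOut.eventually_lt_const (lt_min hδ₁ hδ₂)] with n hn z hz
  rw [dist_comm]
  refine lt_of_le_of_lt (ContDiffBump.dist_normed_convolution_le (ε := ε / 2) hgm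
    fun x hx => (hu x ?_ z (Metric.self_subset_cthickening _ hz) ?_).le) (by linarith)
  · exact Metric.mem_cthickening_of_dist_le x z δ₁ C hz
      (((Metric.mem_ball.1 hx).trans hn).le.trans (min_le_left _ _))
  · exact ((Metric.mem_ball.1 hx).trans hn).trans_le (min_le_right _ _)

/-- Mollification contracts `L²`, and for a continuous compactly supported `k` it converges
uniformly on `C`; such `k` are dense in `L²`. -/
theorem tendsto_lintegral_mollify_sub {h : ℂ → ℂ} (hh : MemLp h 2 volume) {C : Set ℂ}
    (hC : IsCompact C) :
    Tendsto (fun n => ∫⁻ z in C, ‖((mollifier n).normed volume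
      ⋆[ContinuousLinearMap.lsmul ℝ ℝ, volume] h) z - h z‖ₑ ^ 2) atTop (𝓝 0) := by
  have hli : ∀ k : ℂ → ℂ, MemLp k 2 volume → LocallyIntegrable k volume := fun k hk =>
    hk.locallyIntegrable (by norm_num)
  have hsq : ∀ k : ℂ → ℂ, eLpNorm k 2 volume ^ 2 = ∫⁻ z, ‖k z‖ₑ ^ 2 := by
    intro k
    rw [eLpNorm_eq_lintegral_rpow_enorm_toReal (by norm_num) (by norm_num), ← ENNReal.rpow_natCast,
      ← ENNReal.rpow_mul]
    norm_num
  rw [ENNReal.tendsto_nhds_zero]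
  intro ε hε
  -- The factor 12 is 8 + 4: two terms `4η²` from `h - k` and its mollification, and `4η²` from the
  -- error of `k`.
  obtain ⟨η, hη0, hη⟩ : ∃ η : ℝ≥0∞, η ≠ 0 ∧ 12 * η ^ 2 ≤ ε := by
    have : Tendsto (fun η : ℝ≥0∞ => 12 * η ^ 2) (𝓝[>] 0) (𝓝 0) := by
      have h1 : Continuous fun η : ℝ≥0∞ => 12 * η ^ 2 :=
        (ENNReal.continuous_const_mul (by norm_num)).comp (ENNReal.continuous_pow 2)
      have := (h1.tendsto 0).mono_left (nhdsWithin_le_nhds (s := Ioi 0))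
      simpa using this
    obtain ⟨η, h1, h2⟩ := ((ENNReal.tendsto_nhds_zero.1 this ε hε).and self_mem_nhdsWithin).exists
    exact ⟨η, (ne_of_gt h2), h1⟩
  obtain ⟨k, hkc, hk, hkcont, hk2⟩ := hh.exists_hasCompactSupport_eLpNorm_sub_le (by norm_num) hη0
  have hu := tendstoUniformlyOn_mollify (g := k) hC isOpen_univ (subset_univ _)
    hk2.aestronglyMeasurable hkcont.continuousOn
  have hk' : ∫⁻ z, ‖(h - k) z‖ₑ ^ 2 ≤ η ^ 2 := by
    rw [← hsq]; gcongr
  have hterm : Tendsto (fun n => ∫⁻ z in C, ‖((mollifier n).normed volume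
      ⋆[ContinuousLinearMap.lsmul ℝ ℝ, volume] k) z - k z‖ₑ ^ 2) atTop (𝓝 0) := by
    rw [ENNReal.tendsto_nhds_zero]
    intro ε' hε'
    obtain ⟨d, hd0, hd⟩ : ∃ d : ℝ, 0 < d ∧ ENNReal.ofReal (d ^ 2) * volume C ≤ ε' := by
      have : Tendsto (fun d : ℝ => ENNReal.ofReal (d ^ 2) * volume C) (𝓝[>] 0) (𝓝 0) := by
        have h1 : Continuous fun d : ℝ => ENNReal.ofReal (d ^ 2) * volume C :=
          (ENNReal.continuous_mul_const hC.measure_lt_top.ne).comp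
            (ENNReal.continuous_ofReal.comp (continuous_pow 2))
        have := (h1.tendsto 0).mono_left (nhdsWithin_le_nhds (s := Ioi 0))
        simpa using this
      obtain ⟨η, h1, h2⟩ :=
        ((ENNReal.tendsto_nhds_zero.1 this ε' hε').and self_mem_nhdsWithin).exists
      exact ⟨η, h2, h1⟩
    filter_upwards [Metric.tendstoUniformlyOn_iff.1 hu d hd0] with n hn
    refine le_trans ?_ hd
    rw [← setLIntegral_const]
    refine setLIntegral_mono measurable_const fun z hz => ?_
    have := (hn z hz).le
    rw [dist_comm, dist_eq_norm] at this
    rw [← ofReal_norm, ← ENNReal.ofReal_pow (norm_nonneg _)]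
    gcongr
  have h3 : ∀ n, ∫⁻ z in C, ‖((mollifier n).normed volume
      ⋆[ContinuousLinearMap.lsmul ℝ ℝ, volume] h) z - h z‖ₑ ^ 2 ≤ 8 * η ^ 2 + 4 * ∫⁻ z in C,
      ‖((mollifier n).normed volume ⋆[ContinuousLinearMap.lsmul ℝ ℝ, volume] k) z - k z‖ₑ ^ 2 := by
    intro n
    set T := fun g : ℂ → ℂ => ((mollifier n).normed volume
      ⋆[ContinuousLinearMap.lsmul ℝ ℝ, volume] g)
    have hadd : T h = T (h - k) + T k := by
      have e1 : ∀ g : ℂ → ℂ, LocallyIntegrable g volume → ConvolutionExists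
          ((mollifier n).normed volume) g (ContinuousLinearMap.lsmul ℝ ℝ) volume := fun g hg =>
        ((mollifier n).hasCompactSupport_normed).convolutionExists_left _
          (mollifier n).continuous_normed hg
      have := (e1 (h - k) ((hli h hh).sub (hli k hk2))).distrib_add (e1 k (hli k hk2))
      rw [sub_add_cancel] at this
      exact this
    have hm1 : AEMeasurable (fun z => ‖T (h - k) z‖ₑ ^ 2) (volume.restrict C) := by
      have : Continuous (T (h - k)) := ((mollifier n).hasCompactSupport_normed).continuous_convolution_left _
          (mollifier n).continuous_normed ((hli h hh).sub (hli k hk2))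
      exact (this.enorm.measurable.pow_const 2).aemeasurable
    have hm2 : AEMeasurable (fun z => ‖(h - k) z‖ₑ ^ 2) (volume.restrict C) :=
      ((hh.sub hk2).aestronglyMeasurable.enorm.pow_const 2).restrict
    calc ∫⁻ z in C, ‖T h z - h z‖ₑ ^ 2
        ≤ ∫⁻ z in C, (4 * ‖T (h - k) z‖ₑ ^ 2 + (4 * ‖(h - k) z‖ₑ ^ 2 + 4 * ‖T k z - k z‖ₑ ^ 2)) := by
          refine lintegral_mono fun z => ?_
          have e : T h z - h z = (T (h - k) z - (h - k) z) + (T k z - k z) := by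
            rw [hadd]; simp only [Pi.add_apply, Pi.sub_apply]; ring
          calc ‖T h z - h z‖ₑ ^ 2 ≤ ((‖T (h - k) z‖ₑ + ‖(h - k) z‖ₑ) + ‖T k z - k z‖ₑ) ^ 2 := by
                rw [e]; gcongr
                exact (enorm_add_le _ _).trans (by gcongr; exact enorm_sub_le)
            _ ≤ 2 * ((‖T (h - k) z‖ₑ + ‖(h - k) z‖ₑ) ^ 2 + ‖T k z - k z‖ₑ ^ 2) := add_sq_le _ _
            _ ≤ 2 * (2 * (‖T (h - k) z‖ₑ ^ 2 + ‖(h - k) z‖ₑ ^ 2) + 2 * ‖T k z - k z‖ₑ ^ 2) := by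
                gcongr
                · exact add_sq_le _ _
                · exact le_mul_of_one_le_left' (by norm_num)
            _ = _ := by ring
      _ = 4 * (∫⁻ z in C, ‖T (h - k) z‖ₑ ^ 2) + (4 * (∫⁻ z in C, ‖(h - k) z‖ₑ ^ 2)
            + 4 * ∫⁻ z in C, ‖T k z - k z‖ₑ ^ 2) := by
          rw [lintegral_add_left' (hm1.const_mul _), lintegral_add_left' (hm2.const_mul _),
            lintegral_const_mul'' _ hm1, lintegral_const_mul'' _ hm2,
            lintegral_const_mul' _ _ (by norm_num)]
      _ ≤ 4 * η ^ 2 + (4 * η ^ 2 + 4 * ∫⁻ z in C, ‖T k z - k z‖ₑ ^ 2) := by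
          gcongr
          · exact (setLIntegral_le_lintegral _ _).trans ((lintegral_sq_normed_convolution_le _
              (hh.sub hk2).aestronglyMeasurable).trans hk')
          · exact (setLIntegral_le_lintegral _ _).trans hk'
      _ = _ := by ring
  have hη2 : (0 : ℝ≥0∞) < η ^ 2 := by positivity
  filter_upwards [ENNReal.tendsto_nhds_zero.1 hterm _ hη2] with n hn
  calc _ ≤ 8 * η ^ 2 + 4 * η ^ 2 := (h3 n).trans (by gcongr)
    _ = 12 * η ^ 2 := by ring
    _ ≤ ε := hη

/-- Cutting `f` off outside a compact neighbourhood `C'` of `C` makes it integrable on the plane.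
For `z ∈ C` and a small radius, `t ↦ ρ (z - t)` is a test function supported in `C'`, so the
derivative of the mollification is the mollification of the weak derivative and the convergence in
`L²` applies to it. -/
theorem exists_smooth_approx {U C : Set ℂ} (hU : IsOpen U) (hC : IsCompact C) (hCU : C ⊆ U)
    {f fx fy : ℂ → ℂ} (hf : ContinuousOn f U) (hfx : IsL2Loc U fx) (hfy : IsL2Loc U fy)
    (wx : IsWeakDerivOn U f fx 1) (wy : IsWeakDerivOn U f fy Complex.I) :
    ∃ g : ℕ → ℂ → ℂ, (∀ n, ContDiff ℝ ∞ (g n)) ∧ TendstoUniformlyOn g f atTop C ∧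
      Tendsto (fun n => ∫⁻ z in C, ‖fderiv ℝ (g n) z 1 - fx z‖ₑ ^ 2) atTop (𝓝 0) ∧
      Tendsto (fun n => ∫⁻ z in C, ‖fderiv ℝ (g n) z Complex.I - fy z‖ₑ ^ 2) atTop (𝓝 0) := by
  obtain ⟨C', hC', hCC', hC'U⟩ := exists_compact_between hC hU hCU
  set f₁ := C'.indicator f with hf₁
  have hm : MeasurableSet C' := hC'.measurableSet
  have hfi : Integrable f₁ volume :=
    (integrable_indicator_iff hm).2 ((hf.mono hC'U).integrableOn_compact hC')
  have hcont : ContinuousOn f₁ (interior C') :=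
    (hf.mono (interior_subset.trans hC'U)).congr fun x hx => indicator_of_mem (interior_subset hx) _
  set L := ContinuousLinearMap.lsmul ℝ ℝ (E := ℂ)
  have key : ∀ (v : ℂ) (fv : ℂ → ℂ), IsL2Loc U fv → IsWeakDerivOn U f fv v →
      Tendsto (fun n => ∫⁻ z in C, ‖fderiv ℝ ((mollifier n).normed volume ⋆[L, volume] f₁) z v
        - fv z‖ₑ ^ 2) atTop (𝓝 0) := by
    intro v fv hfv wv
    have hmem : MemLp (C'.indicator fv) 2 volume := (memLp_indicator_iff_restrict hm).2 (hfv C' hC' hC'U)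
    refine (tendsto_lintegral_mollify_sub hmem hC).congr' ?_
    obtain ⟨δ, hδ, hsub⟩ := hC.exists_cthickening_subset_open isOpen_interior hCC'
    filter_upwards [tendsto_mollifier_rOut.eventually_lt_const hδ] with n hn
    refine setLIntegral_congr_fun hC.measurableSet fun z hz => ?_
    have hzC' : z ∈ C' := interior_subset (hCC' hz)
    have e1 : fderiv ℝ ((mollifier n).normed volume ⋆[L, volume] f₁) z v
        = ((mollifier n).normed volume ⋆[L, volume] C'.indicator fv) z := by
      set ρ := (mollifier n).normed volume with hρ
      have hρc : ContDiff ℝ ∞ ρ := (mollifier n).contDiff_normed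
      have hρs : HasCompactSupport ρ := (mollifier n).hasCompactSupport_normed
      have hd := hρs.hasFDerivAt_convolution_left L (hρc.of_le (by simp))
        hfi.locallyIntegrable z
      rw [hd.fderiv]
      have happ : (fderiv ℝ ρ ⋆[L.precompL ℂ, volume] f₁) z v
          = ∫ t, (fderiv ℝ ρ (z - t) v) • f₁ t := by
        rw [convolution_eq_swap]
        rw [ContinuousLinearMap.integral_apply]
        · simp [ContinuousLinearMap.precompL_apply, L]
        · have hex := (hρs.fderiv (𝕜 := ℝ)).convolutionExists_left (L.precompL ℂ) (μ := volume)
            (hρc.continuous_fderiv (by simp)) hfi.locallyIntegrable z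
          exact hex.integrable_swap
      have hφs : tsupport (fun t => ρ (z - t)) ⊆ interior C' := by
        have : tsupport (fun t => ρ (z - t)) ⊆ Metric.closedBall z (mollifier n).rOut := by
          refine closure_minimal (fun t ht => ?_) Metric.isClosed_closedBall
          have h1 : z - t ∈ Function.support ρ := ht
          rw [hρ, (mollifier n).support_normed_eq, mem_ball_zero_iff] at h1
          rw [Metric.mem_closedBall, dist_comm, dist_eq_norm]; exact h1.le
        refine this.trans (Subset.trans ?_ hsub)
        intro t ht
        exact Metric.mem_cthickening_of_dist_le t z δ C hz ((Metric.mem_closedBall.1 ht).trans hn.le)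
      have hφd : ∀ t, fderiv ℝ (fun t => ρ (z - t)) t v = - fderiv ℝ ρ (z - t) v := by
        intro t
        have h1 : HasFDerivAt ρ (fderiv ℝ ρ (z - t)) (z - t) :=
          (hρc.differentiable (by simp) _).hasFDerivAt
        have h2 : HasFDerivAt (fun t : ℂ => z - t) (-ContinuousLinearMap.id ℝ ℂ) t :=
          (hasFDerivAt_id t).const_sub z
        have h3 : HasFDerivAt (fun t => ρ (z - t)) _ t := h1.comp t h2
        rw [h3.fderiv]; simp
      have hw := wv (fun t => ρ (z - t)) (hρc.comp (contDiff_const.sub contDiff_id))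
        (hρs.comp_homeomorph (Homeomorph.subLeft z)) (hφs.trans (interior_subset.trans hC'U))
      have hz0 : ∀ t, t ∉ C' → ρ (z - t) = 0 := fun t ht => by
        by_contra h
        exact ht (interior_subset (hφs (subset_tsupport _ h)))
      have hz1 : ∀ t, t ∉ C' → fderiv ℝ ρ (z - t) v = 0 := fun t ht => by
        have : fderiv ℝ (fun t => ρ (z - t)) t = 0 := by
          by_contra h
          exact ht (interior_subset (hφs (support_fderiv_subset ℝ h)))
        have h2 := hφd t
        rw [this] at h2
        simpa using h2.symm
      rw [happ, convolution_lsmul_swap]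
      have h3 : ∫ t, (fderiv ℝ ρ (z - t) v) • f₁ t = - ∫ t, (fderiv ℝ (fun t => ρ (z - t)) t v) • f t := by
        rw [← integral_neg]
        refine integral_congr_ae (Eventually.of_forall fun t => ?_)
        by_cases ht : t ∈ C'
        · simp [hφd, hf₁, ht]
        · simp [hφd, hf₁, ht, hz1 t ht]
      rw [h3, hw, neg_neg]
      refine integral_congr_ae (Eventually.of_forall fun t => ?_)
      by_cases ht : t ∈ C'
      · simp [ht]
      · simp [ht, hz0 t ht]
    simp only [e1, indicator_of_mem hzC', L]
  refine ⟨fun n => ((mollifier n).normed volume ⋆[L, volume] f₁), fun n => ?_, ?_, key 1 fx hfx wx,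
    key Complex.I fy hfy wy⟩
  · exact ((mollifier n).hasCompactSupport_normed).contDiff_convolution_left _
      (mollifier n).contDiff_normed hfi.locallyIntegrable
  · exact (tendstoUniformlyOn_mollify hC isOpen_interior hCC' hfi.aestronglyMeasurable
      hcont).congr_right fun z hz => indicator_of_mem (interior_subset (hCC' hz)) _

/-! ### Lifting to strips by the exponential -/

/-- The open vertical strip `{a < re z < b}`. -/
def vertStrip (a b : ℝ) : Set ℂ := {z | a < z.re ∧ z.re < b}

theorem isOpen_vertStrip (a b : ℝ) : IsOpen (vertStrip a b) :=
  (isOpen_lt continuous_const Complex.continuous_re).inter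
    (isOpen_lt Complex.continuous_re continuous_const)

theorem convex_vertStrip (a b : ℝ) : Convex ℝ (vertStrip a b) :=
  (convex_Ioo a b).linear_preimage Complex.reLm

theorem vertStrip_nonempty {a b : ℝ} (h : a < b) : (vertStrip a b).Nonempty :=
  ⟨((a + b) / 2 : ℝ), by simp only [vertStrip, mem_ofPred_eq, Complex.ofReal_re]; constructor <;> linarith⟩

theorem exists_continuousOn_log_vertStrip {a b : ℝ} (hab : a < b) {f : ℂ → ℂ}
    (hf : ContinuousOn f (vertStrip a b)) (h0 : ∀ z ∈ vertStrip a b, f z ≠ 0) :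
    ∃ F : ℂ → ℂ, ContinuousOn F (vertStrip a b) ∧ ∀ z ∈ vertStrip a b, Complex.exp (F z) = f z := by
  have hsc : IsSimplyConnected (vertStrip a b) := by
    have := (convex_vertStrip a b).contractibleSpace (vertStrip_nonempty hab)
    exact (inferInstance : SimplyConnectedSpace (vertStrip a b))
  obtain ⟨F, h1, h2⟩ := Complex.exists_continuousOn_eqOn_exp_comp hsc (isOpen_vertStrip a b) hf
    (by rintro ⟨z, hz, h⟩; exact h0 z hz h)
  exact ⟨F, h1, h2⟩

/-- `(F₁ - F₂) / 2πi` is continuous and integer valued, hence constant on a connected set. -/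
theorem IsPreconnected.exists_int_of_exp_eq {S : Set ℂ} (hS : IsPreconnected S) {F₁ F₂ : ℂ → ℂ}
    (h₁ : ContinuousOn F₁ S) (h₂ : ContinuousOn F₂ S)
    (h : ∀ z ∈ S, Complex.exp (F₁ z) = Complex.exp (F₂ z)) :
    ∃ k : ℤ, ∀ z ∈ S, F₁ z = F₂ z + k * (2 * Real.pi * Complex.I) := by
  rcases S.eq_empty_or_nonempty with rfl | ⟨z₀, hz₀⟩
  · exact ⟨0, by simp⟩
  have hk : ∀ z ∈ S, ∃ k : ℤ, F₁ z = F₂ z + k * (2 * Real.pi * Complex.I) := fun z hz =>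
    Complex.exp_eq_exp_iff_exists_int.1 (h z hz)
  choose! k hk using hk
  refine ⟨k z₀, fun z hz => ?_⟩
  suffices k z = k z₀ by rw [hk z hz, this]
  have hp := Real.pi_pos
  have hval : ∀ z ∈ S, (F₁ z - F₂ z).im / (2 * Real.pi) = k z := by
    intro z hz
    rw [hk z hz]; simp
  have hc : ContinuousOn (fun z => (F₁ z - F₂ z).im / (2 * Real.pi)) S :=
    (Complex.continuous_im.comp_continuousOn (h₁.sub h₂)).div_const _
  have hpc := hS.image _ hc
  by_contra hne
  wlog hlt : k z < k z₀ generalizing z z₀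
  · exact this z hz z₀ hz₀ (Ne.symm hne) (lt_of_le_of_ne (not_lt.1 hlt) (Ne.symm hne))
  have hmem := hpc.ordConnected.out (mem_image_of_mem _ hz) (mem_image_of_mem _ hz₀)
  -- If the integer jumped, the intermediate value property would produce a half-integer value.
  have : ((k z : ℝ) + 1 / 2) ∈ Icc ((F₁ z - F₂ z).im / (2 * Real.pi))
      ((F₁ z₀ - F₂ z₀).im / (2 * Real.pi)) := by
    rw [hval z hz, hval z₀ hz₀]
    have : (k z : ℝ) + 1 ≤ k z₀ := by exact_mod_cast hlt
    constructor <;> linarith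
  obtain ⟨w, hw, hw2⟩ := hmem this
  simp only [hval w hw] at hw2
  have h3 : (2 * k w : ℝ) = 2 * k z + 1 := by linarith
  have h4 : 2 * k w = 2 * k z + 1 := by exact_mod_cast h3
  omega

/-- `F` and `G` are mutually inverse homeomorphisms between the strips of widths `R` and `R'`, and
`F` is equivariant with respect to the vertical translations by multiples of `2 π`. -/
structure IsStripHomeo (R R' : ℝ) (F G : ℂ → ℂ) (m : ℤ) : Prop where
  mapsTo : MapsTo F (vertStrip 0 R) (vertStrip 0 R')
  mapsTo_inv : MapsTo G (vertStrip 0 R') (vertStrip 0 R)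
  left_inv : ∀ z ∈ vertStrip 0 R, G (F z) = z
  right_inv : ∀ w ∈ vertStrip 0 R', F (G w) = w
  continuousOn : ContinuousOn F (vertStrip 0 R)
  continuousOn_inv : ContinuousOn G (vertStrip 0 R')
  period : ∀ z ∈ vertStrip 0 R, F (z + 2 * Real.pi * Complex.I) = F z + m * (2 * Real.pi * Complex.I)
  sq_degree : m = 1 ∨ m = -1

theorem exp_mem_roundAnnulus {r : ℝ} (hr : 1 < r) {z : ℂ} :
    Complex.exp z ∈ roundAnnulus r ↔ z ∈ vertStrip 0 (Real.log r) := by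
  simp only [roundAnnulus, vertStrip, mem_ofPred_eq, Complex.norm_exp, Real.one_lt_exp_iff]
  rw [Real.lt_log_iff_exp_lt (by linarith)]

theorem add_int_mul_mem_vertStrip {a b : ℝ} {z : ℂ} (k : ℤ) :
    z + k * (2 * Real.pi * Complex.I) ∈ vertStrip a b ↔ z ∈ vertStrip a b := by
  simp [vertStrip]

theorem add_period_mem_vertStrip {a b : ℝ} {z : ℂ} :
    z + 2 * Real.pi * Complex.I ∈ vertStrip a b ↔ z ∈ vertStrip a b := by
  simp [vertStrip]

theorem map_add_int_mul_period {S : Set ℂ} {F : ℂ → ℂ} {c : ℂ}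
    (hS : ∀ (k : ℤ) z, z + k * (2 * Real.pi * Complex.I) ∈ S ↔ z ∈ S)
    (h : ∀ z ∈ S, F (z + 2 * Real.pi * Complex.I) = F z + c) (k : ℤ) :
    ∀ z ∈ S, F (z + k * (2 * Real.pi * Complex.I)) = F z + k * c := by
  induction k using Int.induction_on with
  | zero => simp
  | succ n ih =>
    intro z hz
    have h1 := h (z + (n : ℤ) * (2 * Real.pi * Complex.I)) ((hS n z).2 hz)
    rw [ih z hz] at h1
    push_cast at h1 ⊢
    rw [show z + (n + 1) * (2 * Real.pi * Complex.I)
      = z + n * (2 * Real.pi * Complex.I) + 2 * Real.pi * Complex.I by ring, h1]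
    ring
  | pred n ih =>
    intro z hz
    have h1 := h (z + ((-(n : ℤ) - 1 : ℤ) : ℂ) * (2 * Real.pi * Complex.I)) ((hS _ z).2 hz)
    have h2 := ih z hz
    push_cast at h1 h2 ⊢
    rw [show z + (-(n : ℂ) - 1) * (2 * Real.pi * Complex.I) + 2 * Real.pi * Complex.I
      = z + -(n : ℂ) * (2 * Real.pi * Complex.I) by ring, h2] at h1
    linear_combination -h1

/-- Both `ψ` and its inverse lift, the strips being simply connected. The lifts are mutually inverse
up to a deck translation, which is absorbed into one of them, and their degrees multiply to 1. -/
theorem exists_strip_lift {r r' : ℝ} (hr : 1 < r) (hr' : 1 < r') (ψ : OpenPartialHomeomorph ℂ ℂ)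
    (hs : ψ.source = roundAnnulus r) (ht : ψ.target = roundAnnulus r') :
    ∃ (F G : ℂ → ℂ) (m : ℤ), IsStripHomeo (Real.log r) (Real.log r') F G m ∧
      ∀ z ∈ vertStrip 0 (Real.log r), Complex.exp (F z) = ψ (Complex.exp z) := by
  have key : ∀ {r r' : ℝ}, 1 < r → 1 < r' → ∀ f : ℂ → ℂ, ContinuousOn f (roundAnnulus r) →
      MapsTo f (roundAnnulus r) (roundAnnulus r') → ∃ (F : ℂ → ℂ) (m : ℤ),
        ContinuousOn F (vertStrip 0 (Real.log r)) ∧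
        MapsTo F (vertStrip 0 (Real.log r)) (vertStrip 0 (Real.log r')) ∧
        (∀ z ∈ vertStrip 0 (Real.log r), Complex.exp (F z) = f (Complex.exp z)) ∧
        ∀ z ∈ vertStrip 0 (Real.log r),
          F (z + 2 * Real.pi * Complex.I) = F z + m * (2 * Real.pi * Complex.I) := by
    intro r r' hr hr' f hf hfm
    obtain ⟨F, hF, hFe⟩ := exists_continuousOn_log_vertStrip (Real.log_pos hr)
      (f := fun z => f (Complex.exp z))
      (hf.comp Complex.continuous_exp.continuousOn fun z hz => (exp_mem_roundAnnulus hr).2 hz)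
      (fun z hz => by
        have := (hfm ((exp_mem_roundAnnulus hr).2 hz)).1
        intro h0; rw [h0] at this; norm_num at this)
    obtain ⟨m, hm⟩ := (convex_vertStrip 0 (Real.log r)).isPreconnected.exists_int_of_exp_eq
      (F₁ := fun z => F (z + 2 * Real.pi * Complex.I)) (F₂ := F)
      (hF.comp (by fun_prop) fun z hz => add_period_mem_vertStrip.2 hz) hF
      (fun z hz => by rw [hFe z hz, hFe _ (add_period_mem_vertStrip.2 hz), Complex.exp_periodic])
    refine ⟨F, m, hF, fun z hz => ?_, hFe, hm⟩
    rw [← exp_mem_roundAnnulus hr', hFe z hz]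
    exact hfm ((exp_mem_roundAnnulus hr).2 hz)
  obtain ⟨F, m, hF, hFm, hFe, hFp⟩ := key hr hr' ψ (hs ▸ ψ.continuousOn)
    (fun z hz => ht ▸ ψ.map_source (hs.symm ▸ hz))
  obtain ⟨G₀, n, hG₀, hG₀m, hG₀e, hG₀p⟩ := key hr' hr ψ.symm (ht ▸ ψ.symm.continuousOn)
    (fun z hz => hs ▸ ψ.map_target (ht.symm ▸ hz))
  set S := vertStrip 0 (Real.log r)
  set S' := vertStrip 0 (Real.log r')
  obtain ⟨k, hk⟩ := (convex_vertStrip 0 (Real.log r)).isPreconnected.exists_int_of_exp_eq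
    (F₁ := fun z => G₀ (F z)) (F₂ := id) (hG₀.comp hF hFm) continuousOn_id (fun z hz => by
      rw [hG₀e _ (hFm hz), hFe z hz, ψ.left_inv (hs.symm ▸ (exp_mem_roundAnnulus hr).2 hz)]; rfl)
  -- `G₀ ∘ F` is the translation by `2πik`; subtracting it makes `G` a left inverse.
  set G : ℂ → ℂ := fun w => G₀ w - k * (2 * Real.pi * Complex.I) with hG
  have hGF : ∀ z ∈ S, G (F z) = z := fun z hz => by simp [hG, hk z hz]
  have hGm : MapsTo G S' S := fun w hw => by
    have := (add_int_mul_mem_vertStrip (-k)).2 (hG₀m hw)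
    simpa [hG, sub_eq_add_neg] using this
  have hGc : ContinuousOn G S' := hG₀.sub continuousOn_const
  have hGp : ∀ (j : ℤ), ∀ w ∈ S', G (w + j * (2 * Real.pi * Complex.I))
      = G w + j * (n * (2 * Real.pi * Complex.I)) := fun j =>
    map_add_int_mul_period (fun _ _ => add_int_mul_mem_vertStrip _)
      (fun z hz => by simp only [hG, hG₀p z hz]; ring) j
  have h2pi : (2 * Real.pi * Complex.I : ℂ) ≠ 0 := Complex.two_pi_I_ne_zero
  -- Evaluate `G (F (z + 2πi))` as `z + 2πi` and, by the two periods, as `z + mn · 2πi`.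
  have hmn : m * n = 1 := by
    obtain ⟨z, hz⟩ := vertStrip_nonempty (Real.log_pos hr)
    have h1 := hGF _ (add_period_mem_vertStrip.2 hz)
    rw [hFp z hz, hGp m _ (hFm hz), hGF z hz, ← mul_assoc] at h1
    have h2 := mul_right_cancel₀ h2pi ((add_left_cancel h1).trans (one_mul _).symm)
    exact_mod_cast h2
  refine ⟨F, G, m, ⟨hFm, hGm, hGF, ?_, hF, hGc, hFp, Int.eq_one_or_neg_one_of_mul_eq_one hmn⟩, hFe⟩
  -- `F ∘ G` is a translation by `2πij`. Applying `G` to it yields `j n = 0`, and `n ≠ 0`.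
  obtain ⟨j, hj⟩ := (convex_vertStrip 0 (Real.log r')).isPreconnected.exists_int_of_exp_eq
    (F₁ := fun z => F (G z)) (F₂ := id) (hF.comp hGc hGm) continuousOn_id (fun w hw => by
      rw [hFe _ (hGm hw)]
      have : Complex.exp (G w) = ψ.symm (Complex.exp w) := by
        rw [← hG₀e w hw, hG]
        exact Complex.exp_periodic.sub_int_mul_eq k
      rw [this, ψ.right_inv (ht.symm ▸ (exp_mem_roundAnnulus hr').2 hw)]; rfl)
  intro w hw
  have h1 := hGF _ (hGm hw)
  rw [hj w hw, id, hGp j w hw] at h1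
  have h2 : (j : ℂ) * (n * (2 * Real.pi * Complex.I)) = 0 := by simpa using h1
  have hn : (n : ℂ) ≠ 0 := by
    intro h0
    have : n = 0 := by exact_mod_cast h0
    simp [this] at hmn
  have hj0 : (j : ℂ) = 0 := by simpa [hn, h2pi] using h2
  rw [hj w hw, hj0]; simp

namespace IsStripHomeo

variable {R R' : ℝ} {F G : ℂ → ℂ} {m : ℤ}

theorem map_add_int_mul (h : IsStripHomeo R R' F G m) (k : ℤ) {z : ℂ} (hz : z ∈ vertStrip 0 R) :
    F (z + k * (2 * Real.pi * Complex.I)) = F z + k * (m * (2 * Real.pi * Complex.I)) :=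
  map_add_int_mul_period (fun _ _ => add_int_mul_mem_vertStrip _) h.period k z hz

theorem symm (h : IsStripHomeo R R' F G m) : IsStripHomeo R' R G F m where
  mapsTo := h.mapsTo_inv
  mapsTo_inv := h.mapsTo
  left_inv := h.right_inv
  right_inv := h.left_inv
  continuousOn := h.continuousOn_inv
  continuousOn_inv := h.continuousOn
  period w hw := by
    have h1 := h.map_add_int_mul m (h.mapsTo_inv hw)
    have h2 : (m : ℂ) * m = 1 := by rcases h.sq_degree with h | h <;> simp [h]
    rw [h.right_inv w hw, ← mul_assoc (m : ℂ) (m : ℂ), h2, one_mul] at h1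
    rw [← h1, h.left_inv _ ((add_int_mul_mem_vertStrip m).2 (h.mapsTo_inv hw))]
  sq_degree := h.sq_degree

theorem sub_mem_vertStrip {z : ℂ} : (R : ℂ) - z ∈ vertStrip 0 R ↔ z ∈ vertStrip 0 R := by
  simp only [vertStrip, mem_ofPred_eq, Complex.sub_re, Complex.ofReal_re]
  constructor <;> rintro ⟨h1, h2⟩ <;> constructor <;> linarith

theorem reflect_source (h : IsStripHomeo R R' F G m) :
    IsStripHomeo R R' (fun z => F (R - z)) (fun w => R - G w) (-m) where
  mapsTo z hz := h.mapsTo (sub_mem_vertStrip.2 hz)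
  mapsTo_inv w hw := sub_mem_vertStrip.2 (h.mapsTo_inv hw)
  left_inv z hz := by simp [h.left_inv _ (sub_mem_vertStrip.2 hz)]
  right_inv w hw := by simp [h.right_inv w hw]
  continuousOn := h.continuousOn.comp (by fun_prop) fun z hz => sub_mem_vertStrip.2 hz
  continuousOn_inv := continuousOn_const.sub h.continuousOn_inv
  period z hz := by
    have := h.map_add_int_mul (-1) (sub_mem_vertStrip.2 hz)
    push_cast at this ⊢
    rw [show (R : ℂ) - (z + 2 * Real.pi * Complex.I) = R - z + -1 * (2 * Real.pi * Complex.I) by ring,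
      this]
    ring
  sq_degree := by rcases h.sq_degree with h | h <;> simp [h]

theorem reflect_target (h : IsStripHomeo R R' F G m) :
    IsStripHomeo R R' (fun z => R' - F z) (fun w => G (R' - w)) (-m) := by
  simpa using h.symm.reflect_source.symm

/-- A closed substrip is compact modulo `2πi`, and translation by a period does not change `Re F`.
-/
theorem exists_re_bounds (h : IsStripHomeo R R' F G m) {a b : ℝ} (ha : 0 < a) (hab : a ≤ b)
    (hb : b < R) : ∃ α β : ℝ, 0 < α ∧ β < R' ∧
      ∀ z : ℂ, a ≤ z.re → z.re ≤ b → α ≤ (F z).re ∧ (F z).re ≤ β := by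
  have hsub : Icc a b ×ℂ Icc 0 (2 * Real.pi) ⊆ vertStrip 0 R := fun z hz =>
    ⟨ha.trans_le hz.1.1, hz.1.2.trans_lt hb⟩
  have hK : IsCompact (Icc a b ×ℂ Icc 0 (2 * Real.pi)) := isCompact_Icc.reProdIm isCompact_Icc
  have hc : ContinuousOn (fun z => (F z).re) (Icc a b ×ℂ Icc 0 (2 * Real.pi)) :=
    Complex.continuous_re.comp_continuousOn (h.continuousOn.mono hsub)
  have hne : (Icc a b ×ℂ Icc 0 (2 * Real.pi)).Nonempty :=
    ⟨(a : ℂ), by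
      have := Real.pi_pos
      simp only [Complex.mem_reProdIm, mem_Icc, Complex.ofReal_re, Complex.ofReal_im]
      refine ⟨⟨le_rfl, hab⟩, le_rfl, by positivity⟩⟩
  obtain ⟨z₁, hz₁, h1⟩ := hK.exists_isMinOn hne hc
  obtain ⟨z₂, hz₂, h2⟩ := hK.exists_isMaxOn hne hc
  refine ⟨_, _, (h.mapsTo (hsub hz₁)).1, (h.mapsTo (hsub hz₂)).2, fun z hza hzb => ?_⟩
  set k := ⌊z.im / (2 * Real.pi)⌋
  have hp : 0 < 2 * Real.pi := by have := Real.pi_pos; positivity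
  set z' : ℂ := z + (-k : ℤ) * (2 * Real.pi * Complex.I) with hz'
  have hre : z'.re = z.re := by simp [hz']
  have him : z'.im = z.im - k * (2 * Real.pi) := by simp [hz', sub_eq_add_neg]
  have hmem : z' ∈ Icc a b ×ℂ Icc 0 (2 * Real.pi) := by
    refine ⟨by simp only [mem_preimage, hre]; exact ⟨hza, hzb⟩, ?_⟩
    simp only [mem_preimage, him]
    have h3 := Int.floor_le (z.im / (2 * Real.pi))
    have h4 := (Int.lt_floor_add_one (z.im / (2 * Real.pi))).le
    rw [le_div_iff₀ hp] at h3
    rw [div_le_iff₀ hp] at h4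
    constructor <;> linarith
  have hF : (F z').re = (F z).re := by
    rw [hz', h.map_add_int_mul (-k) ⟨ha.trans_le hza, hzb.trans_lt hb⟩]
    simp
  rw [← hF]
  exact ⟨h1 hmem, h2 hmem⟩

end IsStripHomeo

/-! ### Behaviour of the lift at the two ends of the strip -/

/-- The real part of `F` tends to `0` at the left end and to `R'` at the right end of the strip. -/
structure PreservesEnds (R R' : ℝ) (F : ℂ → ℂ) : Prop where
  left : ∀ α > 0, ∃ δ > 0, ∀ z ∈ vertStrip 0 R, z.re < δ → (F z).re < α
  right : ∀ β < R', ∃ d < R, ∀ z ∈ vertStrip 0 R, d < z.re → β < (F z).re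

namespace IsStripHomeo

variable {R R' : ℝ} {F G : ℂ → ℂ} {m : ℤ}

/-- When `w` is near the left end, `G w` can lie neither in a closed substrip, where `Re F` has a
positive lower bound, nor near the right end, where `Re F > R'/2`. The right end is symmetric. -/
theorem preservesEnds_symm (h : IsStripHomeo R R' F G m) (hR : 0 < R) (hR' : 0 < R')
    (hF : PreservesEnds R R' F) : PreservesEnds R' R G := by
  constructor
  · intro α hα
    obtain ⟨d, hd, hd'⟩ := hF.right (R' / 2) (by linarith)
    set a := min α (R / 2)
    have ha : 0 < a := lt_min hα (by linarith)
    have haR : a < R := (min_le_right _ _).trans_lt (by linarith)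
    obtain ⟨α', β', hα', -, hb⟩ := h.exists_re_bounds (b := max a d) ha (le_max_left _ _)
      (max_lt haR hd)
    refine ⟨min α' (R' / 2), lt_min hα' (by linarith), fun w hw hwr => ?_⟩
    refine lt_of_lt_of_le ?_ (min_le_left α (R / 2))
    by_contra! hcon
    rcases le_or_gt (G w).re (max a d) with h1 | h1
    · have := (hb (G w) hcon h1).1
      rw [h.right_inv w hw] at this
      exact absurd (hwr.trans_le (min_le_left _ _)) (not_lt.2 this)
    · have := hd' _ (h.mapsTo_inv hw) ((le_max_right _ _).trans_lt h1)
      rw [h.right_inv w hw] at this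
      exact absurd (hwr.trans_le (min_le_right _ _)) (not_lt.2 this.le)
  · intro β hβ
    obtain ⟨d, hd, hd'⟩ := hF.left (R' / 2) (by linarith)
    set b := max β (R / 2)
    have hb : b < R := max_lt hβ (by linarith)
    have hb0 : 0 < b := lt_of_lt_of_le (by linarith) (le_max_right _ _)
    obtain ⟨α', β', -, hβ', hbd⟩ := h.exists_re_bounds (a := min b d) (lt_min hb0 hd)
      (min_le_left _ _) hb
    refine ⟨max β' (R' / 2), max_lt hβ' (by linarith), fun w hw hwr => ?_⟩
    refine lt_of_le_of_lt (le_max_left β (R / 2)) ?_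
    by_contra! hcon
    rcases le_or_gt (min b d) (G w).re with h1 | h1
    · have := (hbd (G w) h1 hcon).2
      rw [h.right_inv w hw] at this
      exact absurd ((le_max_left _ _).trans_lt hwr) (not_lt.2 this)
    · have := hd' _ (h.mapsTo_inv hw) (h1.trans_le (min_le_right _ _))
      rw [h.right_inv w hw] at this
      exact absurd ((le_max_right _ _).trans_lt hwr) (not_lt.2 this.le)

/-- The preimage of a closed substrip of the target stays away from the left end. So near that end
`Re F` omits the middle third of `(0, R')`, and by connectedness it stays on one side. Shrinking the
neighbourhood then pushes `Re F` past any prescribed value. -/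
theorem left_end (h : IsStripHomeo R R' F G m) (hR' : 0 < R') :
    (∀ α > 0, ∃ δ > 0, ∀ z ∈ vertStrip 0 R, z.re < δ → (F z).re < α) ∨
    ∀ β < R', ∃ δ > 0, ∀ z ∈ vertStrip 0 R, z.re < δ → β < (F z).re := by
  have avoid : ∀ α β, 0 < α → α ≤ β → β < R' → ∃ a > 0, ∀ z ∈ vertStrip 0 R, z.re < a →
      (F z).re < α ∨ β < (F z).re := by
    intro α β hα hαβ hβ
    obtain ⟨a, b, ha, -, hab⟩ := h.symm.exists_re_bounds hα hαβ hβ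
    refine ⟨a, ha, fun z hz hza => ?_⟩
    by_contra! hcon
    have := (hab (F z) hcon.1 hcon.2).1
    rw [h.left_inv z hz] at this
    linarith
  obtain ⟨a, ha, hav⟩ := avoid (R' / 3) (2 * R' / 3) (by linarith) (by linarith) (by linarith)
  set S := vertStrip 0 (min a R)
  have hS : S ⊆ vertStrip 0 R := fun z hz => ⟨hz.1, hz.2.trans_le (min_le_right _ _)⟩
  have hmem : ∀ z ∈ vertStrip 0 R, z.re < a → z ∈ S := fun z hz hza => ⟨hz.1, lt_min hza hz.2⟩
  have hdich : (∀ z ∈ S, (F z).re < R' / 3) ∨ ∀ z ∈ S, 2 * R' / 3 < (F z).re := by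
    by_contra! hcon
    obtain ⟨⟨z₁, hz₁, h1⟩, z₂, hz₂, h2⟩ := hcon
    have h1' := (hav z₁ (hS hz₁) (hz₁.2.trans_le (min_le_left _ _))).resolve_left (not_lt.2 h1)
    obtain ⟨z, hz, hzF⟩ := (convex_vertStrip 0 (min a R)).isPreconnected.intermediate_value hz₂ hz₁
      (f := fun z => (F z).re) (Complex.continuous_re.comp_continuousOn (h.continuousOn.mono hS))
      ⟨h2, h1'.le⟩
    have := hav z (hS hz) (hz.2.trans_le (min_le_left _ _))
    simp only at hzF
    rcases this with h3 | h3 <;> linarith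
  rcases hdich with hd | hd
  · left
    intro α hα
    obtain ⟨a', ha', hav'⟩ := avoid (min α (R' / 3)) (R' / 3) (lt_min hα (by linarith))
      (min_le_right _ _) (by linarith)
    refine ⟨min a a', lt_min ha ha', fun z hz hza => ?_⟩
    have h1 := hd z (hmem z hz (hza.trans_le (min_le_left _ _)))
    rcases hav' z hz (hza.trans_le (min_le_right _ _)) with h2 | h2
    · exact h2.trans_le (min_le_left _ _)
    · linarith
  · right
    intro β hβ
    obtain ⟨a', ha', hav'⟩ := avoid (2 * R' / 3) (max β (2 * R' / 3)) (by linarith)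
      (le_max_right _ _) (max_lt hβ (by linarith))
    refine ⟨min a a', lt_min ha ha', fun z hz hza => ?_⟩
    have h1 := hd z (hmem z hz (hza.trans_le (min_le_left _ _)))
    rcases hav' z hz (hza.trans_le (min_le_right _ _)) with h2 | h2
    · linarith
    · exact (le_max_left _ _).trans_lt h2

/-- Otherwise `Re F` would be bounded by a number less than `R'`, against surjectivity. -/
theorem not_both_ends_left (h : IsStripHomeo R R' F G m) (hR : 0 < R) (hR' : 0 < R')
    (h1 : ∀ α > 0, ∃ δ > 0, ∀ z ∈ vertStrip 0 R, z.re < δ → (F z).re < α)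
    (h2 : ∀ α > 0, ∃ δ > 0, ∀ z ∈ vertStrip 0 R, R - z.re < δ → (F z).re < α) : False := by
  obtain ⟨d₁, hd₁, h1⟩ := h1 (R' / 2) (by linarith)
  obtain ⟨d₂, hd₂, h2⟩ := h2 (R' / 2) (by linarith)
  set a := min d₁ (R / 2)
  set b := max (R - d₂) (R / 2)
  obtain ⟨α₀, β, -, hβ, hab⟩ := h.exists_re_bounds (a := a) (b := b) (lt_min hd₁ (by linarith))
    ((min_le_right _ _).trans (le_max_right _ _)) (max_lt (by linarith) (by linarith))
  set x := (max β (R' / 2) + R') / 2 with hx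
  have hm : max β (R' / 2) < R' := max_lt hβ (by linarith)
  have hx1 : β < x := by have := le_max_left β (R' / 2); linarith
  have hx2 : R' / 2 < x := by have := le_max_right β (R' / 2); linarith
  have hxm : (x : ℂ) ∈ vertStrip 0 R' := by
    constructor <;> simp only [Complex.ofReal_re] <;> linarith
  have hG := h.mapsTo_inv hxm
  have hFG : (F (G x)).re = x := by rw [h.right_inv _ hxm]; simp
  rcases lt_or_ge (G x).re d₁ with h3 | h3
  · have := h1 _ hG h3; linarith
  rcases lt_or_ge (R - (G x).re) d₂ with h4 | h4
  · have := h2 _ hG h4; linarith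
  have := (hab (G x) ((min_le_left _ _).trans h3) (le_trans (by linarith) (le_max_left _ _))).2
  linarith

/-- Each end goes to one of the two ends, and surjectivity excludes that both go to the same one. -/
theorem preservesEnds_or (h : IsStripHomeo R R' F G m) (hR : 0 < R) (hR' : 0 < R') :
    PreservesEnds R R' F ∨ PreservesEnds R R' (fun z => R' - F z) := by
  have hr := h.reflect_source.left_end hR'
  have refl : ∀ P : ℝ → Prop, ∀ δ, (∀ z ∈ vertStrip 0 R, z.re < δ → P (F (R - z)).re) →
      ∀ z ∈ vertStrip 0 R, R - z.re < δ → P (F z).re := by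
    intro P δ hP z hz hzd
    have := hP (R - z) (sub_mem_vertStrip.2 hz) (by simpa using hzd)
    simpa using this
  rcases h.left_end hR' with hl | hl <;> rcases hr with hr | hr
  · exact (h.not_both_ends_left hR hR' hl fun α hα => by
      obtain ⟨δ, hδ, h1⟩ := hr α hα
      exact ⟨δ, hδ, refl (fun x => x < α) δ h1⟩).elim
  · refine Or.inl ⟨hl, fun β hβ => ?_⟩
    obtain ⟨δ, hδ, h1⟩ := hr β hβ
    exact ⟨R - δ, by linarith, fun z hz hzd => refl (fun x => β < x) δ h1 z hz (by linarith)⟩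
  · refine Or.inr ⟨fun α hα => ?_, fun β hβ => ?_⟩
    · obtain ⟨δ, hδ, h1⟩ := hl (R' - α) (by linarith)
      refine ⟨δ, hδ, fun z hz hzd => ?_⟩
      have := h1 z hz hzd
      simp only [Complex.sub_re, Complex.ofReal_re]; linarith
    · obtain ⟨δ, hδ, h1⟩ := hr (R' - β) (by linarith)
      refine ⟨R - δ, by linarith, fun z hz hzd => ?_⟩
      have := refl (fun x => x < R' - β) δ h1 z hz (by linarith)
      simp only [Complex.sub_re, Complex.ofReal_re]; linarith
  · refine (h.reflect_target.not_both_ends_left hR hR' (fun α hα => ?_) fun α hα => ?_).elim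
    · obtain ⟨δ, hδ, h1⟩ := hl (R' - α) (by linarith)
      refine ⟨δ, hδ, fun z hz hzd => ?_⟩
      have := h1 z hz hzd
      simp only [Complex.sub_re, Complex.ofReal_re]; linarith
    · obtain ⟨δ, hδ, h1⟩ := hr (R' - α) (by linarith)
      refine ⟨δ, hδ, fun z hz hzd => ?_⟩
      have := refl (fun x => R' - α < x) δ h1 z hz hzd
      simp only [Complex.sub_re, Complex.ofReal_re]; linarith

end IsStripHomeo

/-! ### Exponential coordinates and the Beltrami inequality -/

/-- `exp` is injective on an open period rectangle, and its real Jacobian `|exp z|²` is at least 1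
because `Re z > a ≥ 0`. -/
theorem lintegral_comp_exp_le {a b c : ℝ} (ha : 0 ≤ a) {C : Set ℂ}
    (hC : ∀ z : ℂ, a < z.re → z.re < b → Complex.exp z ∈ C) (k : ℂ → ℝ≥0∞) :
    ∫⁻ z in Ioo a b ×ℂ Ioo c (c + 2 * Real.pi), k (Complex.exp z) ≤ ∫⁻ w in C, k w := by
  set Q := Ioo a b ×ℂ Ioo c (c + 2 * Real.pi)
  have hQ : MeasurableSet Q := (isOpen_Ioo.reProdIm isOpen_Ioo).measurableSet
  set D : ℂ → ℂ →L[ℝ] ℂ := fun z =>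
    (ContinuousLinearMap.toSpanSingleton ℂ (Complex.exp z)).restrictScalars ℝ
  have hder : ∀ z ∈ Q, HasFDerivWithinAt Complex.exp (D z) Q z := fun z _ =>
    ((Complex.hasDerivAt_exp z).hasFDerivAt.restrictScalars ℝ).hasFDerivWithinAt
  have hinj : InjOn Complex.exp Q := by
    intro z hz w hw h
    obtain ⟨n, hn⟩ := Complex.exp_eq_exp_iff_exists_int.1 h
    have him : z.im = w.im + n * (2 * Real.pi) := by rw [hn]; simp
    have hp := Real.pi_pos
    have h1 := hz.2.1; have h2 := hz.2.2; have h3 := hw.2.1; have h4 := hw.2.2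
    have h5 : (n : ℝ) < 1 := by nlinarith
    have h6 : (-1 : ℝ) < n := by nlinarith
    have : n = 0 := by
      have h7 : n < 1 := by exact_mod_cast h5
      have h8 : -1 < n := by exact_mod_cast h6
      omega
    simpa [this] using hn
  have hdet : ∀ z ∈ Q, 1 ≤ ENNReal.ofReal |(D z).det| := by
    intro z hz
    have h1 : (D z).det = Complex.normSq (Complex.exp z) := by
      change LinearMap.det ((LinearMap.toSpanSingleton ℂ ℂ (Complex.exp z)).restrictScalars ℝ) = _
      rw [LinearMap.det_restrictScalars, Algebra.norm_complex_apply]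
      congr 1
      simp
    rw [h1, ENNReal.one_le_ofReal, abs_of_nonneg (Complex.normSq_nonneg _), Complex.normSq_eq_norm_sq,
      Complex.norm_exp]
    exact one_le_pow₀ (Real.one_le_exp (ha.trans hz.1.1.le))
  calc ∫⁻ z in Q, k (Complex.exp z)
      ≤ ∫⁻ z in Q, ENNReal.ofReal |(D z).det| * k (Complex.exp z) :=
        setLIntegral_mono' hQ fun z hz => le_mul_of_one_le_left' (hdet z hz)
    _ = ∫⁻ w in Complex.exp '' Q, k w :=
        (lintegral_image_eq_lintegral_abs_det_fderiv_mul volume hQ hder hinj k).symm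
    _ ≤ ∫⁻ w in C, k w := lintegral_mono_set (by
        rintro _ ⟨z, hz, rfl⟩
        exact hC z hz.1.1 hz.1.2)

/-- With `A = |ψ_z|` and `B = |ψ_z̄|` the left side is `2 (A² + B²)` and the Jacobian is `A² - B²`.
The claim is then `(K + 1) B² ≤ (K - 1) A²`, which follows from the hypothesis and `B ≤ A`. -/
theorem norm_sq_add_norm_sq_le_of_beltrami {K : ℝ} (hK : 1 ≤ K) {p q : ℂ}
    (h : ‖(p + Complex.I * q) / 2‖ ≤ (K - 1) / (K + 1) * ‖(p - Complex.I * q) / 2‖) :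
    ‖p‖ ^ 2 + ‖q‖ ^ 2 ≤ 2 * K * ((starRingEnd ℂ) p * q).im := by
  have h0 : 0 < K + 1 := by linarith
  set A := ‖(p - Complex.I * q) / 2‖ with hA
  set B := ‖(p + Complex.I * q) / 2‖ with hB
  have hA0 : 0 ≤ A := norm_nonneg _
  have hB0 : 0 ≤ B := norm_nonneg _
  have h1 : (K + 1) * B ≤ (K - 1) * A := by
    rw [div_mul_eq_mul_div, le_div_iff₀ h0] at h; linarith
  have hA2 : A ^ 2 = ((p.re + q.im) ^ 2 + (p.im - q.re) ^ 2) / 4 := by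
    rw [hA, ← Complex.normSq_eq_norm_sq]; simp [Complex.normSq_apply]; ring
  have hB2 : B ^ 2 = ((p.re - q.im) ^ 2 + (p.im + q.re) ^ 2) / 4 := by
    rw [hB, ← Complex.normSq_eq_norm_sq]; simp [Complex.normSq_apply]; ring
  have h2 : (K + 1) * B ^ 2 ≤ (K - 1) * A ^ 2 := by
    have hBA : B ≤ A := by nlinarith
    nlinarith
  rw [← Complex.normSq_eq_norm_sq, ← Complex.normSq_eq_norm_sq]
  simp only [Complex.normSq_apply, Complex.mul_im, Complex.conj_re, Complex.conj_im]
  nlinarith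

/-- The derivative in the direction `v` of a branch of `log (ψ (exp z))`, in terms of the partial
derivatives `fx`, `fy` of `ψ`. -/
noncomputable def logDerivExp (ψ fx fy : ℂ → ℂ) (v z : ℂ) : ℂ :=
  (((Complex.exp z * v).re : ℂ) * fx (Complex.exp z) + ((Complex.exp z * v).im : ℂ) *
    fy (Complex.exp z)) / ψ (Complex.exp z)

theorem measurable_logDerivExp {ψ fx fy : ℂ → ℂ} (hψ : Measurable ψ) (hx : Measurable fx)
    (hy : Measurable fy) (v : ℂ) : Measurable (logDerivExp ψ fx fy v) := by
  have he : Measurable Complex.exp := Complex.measurable_exp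
  unfold logDerivExp
  exact (((Complex.measurable_ofReal.comp (Complex.measurable_re.comp (he.mul_const v))).mul
    (hx.comp he)).add ((Complex.measurable_ofReal.comp (Complex.measurable_im.comp
      (he.mul_const v))).mul (hy.comp he))).div (hψ.comp he)

/-- `exp` and `log` are conformal, so passing to logarithmic coordinates multiplies the energy
density and the Jacobian by the same factor `|exp z|² / |ψ (exp z)|²`. -/
theorem norm_sq_logDerivExp_le {K : ℝ} (hK : 1 ≤ K) {ψ fx fy : ℂ → ℂ} {z : ℂ}
    (h : ‖(fx (Complex.exp z) + Complex.I * fy (Complex.exp z)) / 2‖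
      ≤ (K - 1) / (K + 1) * ‖(fx (Complex.exp z) - Complex.I * fy (Complex.exp z)) / 2‖) :
    ‖logDerivExp ψ fx fy 1 z‖ ^ 2 + ‖logDerivExp ψ fx fy Complex.I z‖ ^ 2
      ≤ 2 * K * ((starRingEnd ℂ) (logDerivExp ψ fx fy 1 z) * logDerivExp ψ fx fy Complex.I z).im := by
  have h1 := norm_sq_add_norm_sq_le_of_beltrami hK h
  unfold logDerivExp
  set w := Complex.exp z
  set p := fx w
  set q := fy w
  set t := ψ w
  have e1 : ‖(((w * 1).re : ℂ) * p + ((w * 1).im : ℂ) * q) / t‖ ^ 2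
      + ‖(((w * Complex.I).re : ℂ) * p + ((w * Complex.I).im : ℂ) * q) / t‖ ^ 2
      = Complex.normSq w / Complex.normSq t * (‖p‖ ^ 2 + ‖q‖ ^ 2) := by
    simp only [norm_div, div_pow, ← Complex.normSq_eq_norm_sq]
    simp [Complex.normSq_apply]
    ring
  have e2 : ((starRingEnd ℂ) ((((w * 1).re : ℂ) * p + ((w * 1).im : ℂ) * q) / t)
      * ((((w * Complex.I).re : ℂ) * p + ((w * Complex.I).im : ℂ) * q) / t)).im
      = Complex.normSq w / Complex.normSq t * ((starRingEnd ℂ) p * q).im := by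
    rw [map_div₀, div_mul_div_comm, mul_comm ((starRingEnd ℂ) t), Complex.mul_conj,
      Complex.div_ofReal_im]
    simp [Complex.normSq_apply]
    ring
  rw [e1, e2]
  have h3 : 0 ≤ Complex.normSq w / Complex.normSq t :=
    div_nonneg (Complex.normSq_nonneg _) (Complex.normSq_nonneg _)
  nlinarith [mul_le_mul_of_nonneg_left h1 h3]

/-- By the change of variables, `exp` pulls a null set back to a null set on each period rectangle,
and countably many of these cover the strip. -/
theorem ae_comp_exp {R : ℝ} {C : Set ℂ}
    (hC : ∀ z ∈ vertStrip 0 R, Complex.exp z ∈ C) {p : ℂ → Prop}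
    (hp : ∀ᵐ w ∂(volume.restrict C), p w) :
    ∀ᵐ z ∂(volume.restrict (vertStrip 0 R)), p (Complex.exp z) := by
  rw [ae_iff] at hp
  have hm : MeasurableSet (vertStrip 0 R) := (isOpen_vertStrip 0 R).measurableSet
  obtain ⟨T, hT, hTm, hT0⟩ := exists_measurable_superset_of_null hp
  have hcover : vertStrip 0 R ⊆ ⋃ q : ℚ, Ioo 0 R ×ℂ Ioo (q : ℝ) (q + 2 * Real.pi) := by
    intro z hz
    obtain ⟨q, hq1, hq2⟩ := exists_rat_btwn (show z.im - 2 * Real.pi < z.im by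
      have := Real.pi_pos; linarith)
    exact mem_iUnion.2 ⟨q, hz, hq2, by change z.im < _; linarith⟩
  have hnull : ∀ q : ℚ, ∀ᵐ z ∂(volume.restrict (Ioo 0 R ×ℂ Ioo (q : ℝ) (q + 2 * Real.pi))),
      p (Complex.exp z) := by
    intro q
    have h1 := lintegral_comp_exp_le (a := 0) (b := R) (c := q) le_rfl (C := C)
      (fun z h1 h2 => hC z ⟨h1, h2⟩) (T.indicator 1)
    rw [lintegral_indicator_one hTm, hT0, nonpos_iff_eq_zero,
      lintegral_eq_zero_iff (f := fun z => T.indicator 1 (Complex.exp z))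
      ((measurable_one.indicator hTm).comp Complex.measurable_exp)] at h1
    filter_upwards [h1] with z hz
    by_contra hcon
    have : Complex.exp z ∈ T := hT hcon
    simp [this] at hz
  refine ae_restrict_of_ae_restrict_of_subset hcover ?_
  rw [ae_restrict_iUnion_iff]
  exact hnull

/-! ### Sobolev regularity of the lift -/

/-- On every substrip `{a < re z < b}`, `F` is a uniform limit of smooth functions with the same
period behaviour, whose partial derivatives converge to `gx` and `gy` in `L²` of a period. -/
def IsStripSobolev (R : ℝ) (F gx gy : ℂ → ℂ) (m : ℤ) : Prop :=
  ∀ a b, 0 < a → a < b → b < R → ∃ f : ℕ → ℂ → ℂ,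
    (∀ n, ContDiffOn ℝ ∞ (f n) (vertStrip a b)) ∧
    (∀ n, ∀ z ∈ vertStrip a b,
      f n (z + 2 * Real.pi * Complex.I) = f n z + m * (2 * Real.pi * Complex.I)) ∧
    TendstoUniformlyOn f F atTop (vertStrip a b) ∧
    (∀ c : ℝ, Tendsto (fun n => ∫⁻ z in Ioo a b ×ℂ Ioo c (c + 2 * Real.pi),
      ‖fderiv ℝ (f n) z 1 - gx z‖ₑ ^ 2) atTop (𝓝 0)) ∧
    ∀ c : ℝ, Tendsto (fun n => ∫⁻ z in Ioo a b ×ℂ Ioo c (c + 2 * Real.pi),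
      ‖fderiv ℝ (f n) z Complex.I - gy z‖ₑ ^ 2) atTop (𝓝 0)

/-- Near `z₀`, continuity confines `Im (f z - f z₀)` to `(-π, π)`, so `f - f z₀` is the principal
logarithm of `h / h z₀`. -/
theorem contDiffOn_of_exp_eq {S : Set ℂ} (hS : IsOpen S) {f h : ℂ → ℂ} (hf : ContinuousOn f S)
    (hh : ContDiffOn ℝ ∞ h S) (he : ∀ z ∈ S, Complex.exp (f z) = h z) : ContDiffOn ℝ ∞ f S := by
  intro z₀ hz₀
  have hfc : ContinuousAt f z₀ := hf.continuousAt (hS.mem_nhds hz₀)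
  have hhc : ContDiffAt ℝ ∞ h z₀ := hh.contDiffAt (hS.mem_nhds hz₀)
  have hloc : ∀ᶠ z in 𝓝 z₀, f z = f z₀ + Complex.log (h z / h z₀) := by
    have h1 : ∀ᶠ z in 𝓝 z₀, |(f z - f z₀).im| < Real.pi := by
      have : ContinuousAt (fun z => |(f z - f z₀).im|) z₀ := by fun_prop
      refine this.eventually_lt_const ?_
      simp [Real.pi_pos]
    filter_upwards [h1, hS.mem_nhds hz₀] with z hz hzS
    rw [← he z hzS, ← he z₀ hz₀, ← Complex.exp_sub, Complex.log_exp (abs_lt.1 hz).1 (abs_lt.1 hz).2.le]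
    ring
  have h0 : h z₀ ≠ 0 := he z₀ hz₀ ▸ Complex.exp_ne_zero _
  refine ContDiffAt.contDiffWithinAt ?_
  refine ContDiffAt.congr_of_eventuallyEq ?_ hloc
  refine contDiffAt_const.add ?_
  have hl : ContDiffAt ℝ ∞ Complex.log (h z₀ / h z₀) := by
    refine (Complex.contDiffAt_log ?_).restrict_scalars ℝ
    rw [div_self h0]; exact Complex.one_mem_slitPlane
  exact hl.comp z₀ (hhc.div_const _)

theorem fderiv_of_exp_eq {S : Set ℂ} (hS : IsOpen S) {f g : ℂ → ℂ} (hf : ContDiffOn ℝ ∞ f S)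
    (hg : ContDiff ℝ ∞ g) (he : ∀ z ∈ S, Complex.exp (f z) = g (Complex.exp z)) {z : ℂ} (hz : z ∈ S)
    (v : ℂ) : fderiv ℝ f z v
      = logDerivExp g (fun w => fderiv ℝ g w 1) (fun w => fderiv ℝ g w Complex.I) v z := by
  have hexp : ∀ w : ℂ, HasFDerivAt Complex.exp
      ((ContinuousLinearMap.toSpanSingleton ℂ (Complex.exp w)).restrictScalars ℝ) w := fun w =>
    (Complex.hasDerivAt_exp w).hasFDerivAt.restrictScalars ℝ
  have h1 : HasFDerivAt f (fderiv ℝ f z) z :=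
    ((hf.contDiffAt (hS.mem_nhds hz)).differentiableAt (by simp)).hasFDerivAt
  have h2 := (hexp (f z)).comp z h1
  have h3 : HasFDerivAt g (fderiv ℝ g (Complex.exp z)) (Complex.exp z) :=
    (hg.differentiable (by simp) _).hasFDerivAt
  have h4 := h3.comp z (hexp z)
  have h5 := h2.unique (h4.congr_of_eventuallyEq (by
    filter_upwards [hS.mem_nhds hz] with w hw using he w hw))
  have h6 := congrArg (fun T => T v) h5
  simp only [ContinuousLinearMap.comp_apply, ContinuousLinearMap.coe_restrictScalars',
    ContinuousLinearMap.toSpanSingleton_apply, smul_eq_mul] at h6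
  have hne : g (Complex.exp z) ≠ 0 := he z hz ▸ Complex.exp_ne_zero _
  rw [he z hz, mul_comm v] at h6
  rw [logDerivExp, eq_div_iff hne, h6]
  set w := Complex.exp z * v
  have hw : w = w.re • (1 : ℂ) + w.im • Complex.I := by
    simp [Complex.re_add_im]
  conv_lhs => rw [hw, map_add, map_smul, map_smul]
  simp

theorem enorm_logDerivExp_sub_sq_le {ψ g fx fy gx gy : ℂ → ℂ} {z v : ℂ} {M : ℝ≥0∞} (hv : ‖v‖ₑ = 1)
    (hM : ‖Complex.exp z‖ₑ ≤ M) (hψ : 1 ≤ ‖ψ (Complex.exp z)‖)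
    (hg : 1 / 2 ≤ ‖g (Complex.exp z)‖) :
    ‖logDerivExp g gx gy v z - logDerivExp ψ fx fy v z‖ₑ ^ 2 ≤
      16 * M ^ 2 * (‖gx (Complex.exp z) - fx (Complex.exp z)‖ₑ ^ 2
        + ‖gy (Complex.exp z) - fy (Complex.exp z)‖ₑ ^ 2
        + ‖g (Complex.exp z) - ψ (Complex.exp z)‖ₑ ^ 2 * (‖fx (Complex.exp z)‖ₑ ^ 2
          + ‖fy (Complex.exp z)‖ₑ ^ 2)) := by
  unfold logDerivExp
  set w := Complex.exp z
  set c : ℂ := ((w * v).re : ℂ)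
  set d : ℂ := ((w * v).im : ℂ)
  have hwv : ‖w * v‖ₑ ≤ M := by rw [enorm_mul, hv, mul_one]; exact hM
  have hc : ‖c‖ₑ ≤ M := by
    refine le_trans ?_ hwv
    rw [← ofReal_norm, ← ofReal_norm, Complex.norm_real]
    exact ENNReal.ofReal_le_ofReal (Complex.abs_re_le_norm _)
  have hd : ‖d‖ₑ ≤ M := by
    refine le_trans ?_ hwv
    rw [← ofReal_norm, ← ofReal_norm, Complex.norm_real]
    exact ENNReal.ofReal_le_ofReal (Complex.abs_im_le_norm _)
  have hψ0 : ψ w ≠ 0 := by intro h; rw [h] at hψ; norm_num at hψ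
  have hg0 : g w ≠ 0 := by intro h; rw [h] at hg; norm_num at hg
  have hinvψ : ‖(ψ w)⁻¹‖ₑ ≤ 1 := by
    rw [← ofReal_norm, norm_inv, ← ENNReal.ofReal_one]
    exact ENNReal.ofReal_le_ofReal (inv_le_one_of_one_le₀ hψ)
  have hinvg : ‖(g w)⁻¹‖ₑ ≤ 2 := by
    rw [← ofReal_norm, norm_inv, show (2 : ℝ≥0∞) = ENNReal.ofReal 2 by simp]
    refine ENNReal.ofReal_le_ofReal ?_
    rw [inv_le_comm₀ (by linarith) (by norm_num)]; linarith
  -- This splits the error into the difference of the derivatives and the difference of the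
  -- denominators; the two reciprocals are bounded by 2 and 1.
  have hid : (c * gx w + d * gy w) / g w - (c * fx w + d * fy w) / ψ w
      = (g w)⁻¹ * ((c * (gx w - fx w) + d * (gy w - fy w))
        - (ψ w)⁻¹ * ((g w - ψ w) * (c * fx w + d * fy w))) := by
    field_simp
    ring
  have hlin : ∀ p q : ℂ, ‖c * p + d * q‖ₑ ^ 2 ≤ 2 * M ^ 2 * (‖p‖ₑ ^ 2 + ‖q‖ₑ ^ 2) := by
    intro p q
    calc ‖c * p + d * q‖ₑ ^ 2 ≤ (M * ‖p‖ₑ + M * ‖q‖ₑ) ^ 2 := by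
          gcongr
          refine (enorm_add_le _ _).trans ?_
          rw [enorm_mul, enorm_mul]
          gcongr
      _ ≤ 2 * ((M * ‖p‖ₑ) ^ 2 + (M * ‖q‖ₑ) ^ 2) := ENNReal.add_sq_le _ _
      _ = _ := by ring
  rw [hid]
  set X := c * (gx w - fx w) + d * (gy w - fy w)
  set Y := c * fx w + d * fy w
  calc ‖(g w)⁻¹ * (X - (ψ w)⁻¹ * ((g w - ψ w) * Y))‖ₑ ^ 2
      ≤ (2 * (‖X‖ₑ + 1 * (‖g w - ψ w‖ₑ * ‖Y‖ₑ))) ^ 2 := by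
        gcongr
        rw [enorm_mul]
        gcongr
        refine enorm_sub_le.trans ?_
        rw [enorm_mul, enorm_mul]
        gcongr
    _ = 4 * (‖X‖ₑ + ‖g w - ψ w‖ₑ * ‖Y‖ₑ) ^ 2 := by ring
    _ ≤ 4 * (2 * (‖X‖ₑ ^ 2 + (‖g w - ψ w‖ₑ * ‖Y‖ₑ) ^ 2)) := by gcongr; exact ENNReal.add_sq_le _ _
    _ = 8 * (‖X‖ₑ ^ 2 + ‖g w - ψ w‖ₑ ^ 2 * ‖Y‖ₑ ^ 2) := by ring
    _ ≤ 8 * (2 * M ^ 2 * (‖gx w - fx w‖ₑ ^ 2 + ‖gy w - fy w‖ₑ ^ 2)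
        + ‖g w - ψ w‖ₑ ^ 2 * (2 * M ^ 2 * (‖fx w‖ₑ ^ 2 + ‖fy w‖ₑ ^ 2))) := by
        gcongr
        · exact hlin _ _
        · exact hlin _ _
    _ = _ := by ring

/-- Given smooth `g n → ψ` on a closed annulus, the approximants are `F + log (g n ∘ exp / ψ ∘
exp)`. The correction depends only on `exp z`, so the period behaviour of `F` is kept exactly, and
the sum is smooth because it is a continuous logarithm of `g n ∘ exp`. -/
theorem isStripSobolev_of_lift {r : ℝ} (hr : 1 < r) {ψ fx fy F : ℂ → ℂ} {m : ℤ}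
    (hψ : ContinuousOn ψ (roundAnnulus r)) (hψ1 : ∀ w ∈ roundAnnulus r, 1 ≤ ‖ψ w‖)
    (hfx : IsL2Loc (roundAnnulus r) fx) (hfy : IsL2Loc (roundAnnulus r) fy)
    (wx : IsWeakDerivOn (roundAnnulus r) ψ fx 1)
    (wy : IsWeakDerivOn (roundAnnulus r) ψ fy Complex.I)
    (hF : ContinuousOn F (vertStrip 0 (Real.log r)))
    (hFe : ∀ z ∈ vertStrip 0 (Real.log r), Complex.exp (F z) = ψ (Complex.exp z))
    (hFp : ∀ z ∈ vertStrip 0 (Real.log r),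
      F (z + 2 * Real.pi * Complex.I) = F z + m * (2 * Real.pi * Complex.I)) :
    IsStripSobolev (Real.log r) F (logDerivExp ψ fx fy 1) (logDerivExp ψ fx fy Complex.I) m := by
  intro a b ha hab hb
  set C : Set ℂ := {w | Real.exp a ≤ ‖w‖ ∧ ‖w‖ ≤ Real.exp b} with hCdef
  have hU : IsOpen (roundAnnulus r) := (isOpen_lt continuous_const continuous_norm).inter
    (isOpen_lt continuous_norm continuous_const)
  have hCc : IsCompact C := by
    refine (isCompact_closedBall (0 : ℂ) (Real.exp b)).of_isClosed_subset
      ((isClosed_le continuous_const continuous_norm).inter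
        (isClosed_le continuous_norm continuous_const)) fun w hw => ?_
    simpa using hw.2
  have hebr : Real.exp b < r := (Real.lt_log_iff_exp_lt (by linarith)).1 hb
  have hCU : C ⊆ roundAnnulus r := fun w hw =>
    ⟨(Real.one_lt_exp_iff.2 ha).trans_le hw.1, hw.2.trans_lt hebr⟩
  have hSC : ∀ z : ℂ, a < z.re → z.re < b → Complex.exp z ∈ C := fun z h1 h2 => by
    rw [hCdef, mem_ofPred_eq, Complex.norm_exp]
    exact ⟨Real.exp_le_exp.2 h1.le, Real.exp_le_exp.2 h2.le⟩
  have hSS : vertStrip a b ⊆ vertStrip 0 (Real.log r) := fun z hz =>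
    ⟨ha.trans hz.1, hz.2.trans hb⟩
  obtain ⟨g₀, hg₀, hu₀, hx₀, hy₀⟩ := exists_smooth_approx hU hCc hCU hψ hfx hfy wx wy
  -- Discarding finitely many terms gives `|g n - ψ| < 1/2` on `C`. As `|ψ| ≥ 1`, the quotient `g n
  -- / ψ` stays in the right half-plane and `|g n| ≥ 1/2`.
  obtain ⟨n₀, hn₀⟩ := eventually_atTop.1 (Metric.tendstoUniformlyOn_iff.1 hu₀ (1 / 2) (by norm_num))
  set g := fun n => g₀ (n + n₀) with hg
  have hgs : ∀ n, ContDiff ℝ ∞ (g n) := fun n => hg₀ _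
  have hclose : ∀ n, ∀ w ∈ C, ‖g n w - ψ w‖ < 1 / 2 := fun n w hw => by
    have := hn₀ (n + n₀) (by omega) w hw
    rwa [dist_comm, dist_eq_norm] at this
  have hu : TendstoUniformlyOn g ψ atTop C := fun V hV =>
    (tendsto_add_atTop_nat n₀).eventually (hu₀ V hV)
  have hx : Tendsto (fun n => ∫⁻ z in C, ‖fderiv ℝ (g n) z 1 - fx z‖ₑ ^ 2) atTop (𝓝 0) :=
    hx₀.comp (tendsto_add_atTop_nat n₀)
  have hy : Tendsto (fun n => ∫⁻ z in C, ‖fderiv ℝ (g n) z Complex.I - fy z‖ₑ ^ 2) atTop (𝓝 0) :=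
    hy₀.comp (tendsto_add_atTop_nat n₀)
  have hψ0 : ∀ w ∈ C, ψ w ≠ 0 := fun w hw h => by
    have := hψ1 w (hCU hw); rw [h] at this; norm_num at this
  have hgn : ∀ n, ∀ w ∈ C, 1 / 2 ≤ ‖g n w‖ := fun n w hw => by
    have h1 := hψ1 w (hCU hw)
    have h2 := hclose n w hw
    have h3 := norm_sub_norm_le (ψ w) (g n w)
    rw [norm_sub_rev] at h3
    linarith
  have hg0 : ∀ n, ∀ w ∈ C, g n w ≠ 0 := fun n w hw h => by
    have := hgn n w hw; rw [h] at this; norm_num at this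
  have hrat : ∀ n, ∀ w ∈ C, ‖g n w / ψ w - 1‖ ≤ ‖g n w - ψ w‖ := fun n w hw => by
    rw [div_sub_one (hψ0 w hw), norm_div]
    exact div_le_self (norm_nonneg _) (hψ1 w (hCU hw))
  have hslit : ∀ n, ∀ w ∈ C, g n w / ψ w ∈ Complex.slitPlane := fun n w hw => by
    have h1 := (hrat n w hw).trans_lt (hclose n w hw)
    have h2 := (Complex.abs_re_le_norm (g n w / ψ w - 1)).trans_lt h1
    left
    simp only [Complex.sub_re, Complex.one_re] at h2
    have := (abs_lt.1 h2).1
    linarith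
  set f : ℕ → ℂ → ℂ := fun n z => F z + Complex.log (g n (Complex.exp z) / ψ (Complex.exp z))
    with hf
  have hfe : ∀ n, ∀ z ∈ vertStrip a b, Complex.exp (f n z) = g n (Complex.exp z) := by
    intro n z hz
    have hw := hSC z hz.1 hz.2
    rw [hf, Complex.exp_add, hFe z (hSS hz), Complex.exp_log (div_ne_zero (hg0 n _ hw) (hψ0 _ hw)),
      mul_div_cancel₀ _ (hψ0 _ hw)]
  have hfc : ∀ n, ContinuousOn (f n) (vertStrip a b) := by
    intro n
    have he : MapsTo Complex.exp (vertStrip a b) C := fun z hz => hSC z hz.1 hz.2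
    refine (hF.mono hSS).add (ContinuousOn.clog ?_ fun z hz => hslit n _ (he hz))
    exact ((hgs n).continuous.comp Complex.continuous_exp).continuousOn.div
      ((hψ.mono hCU).comp Complex.continuous_exp.continuousOn he) fun z hz => hψ0 _ (he hz)
  have hfs : ∀ n, ContDiffOn ℝ ∞ (f n) (vertStrip a b) := fun n =>
    contDiffOn_of_exp_eq (isOpen_vertStrip a b) (hfc n)
      ((hgs n).comp Complex.contDiff_exp).contDiffOn (hfe n)
  refine ⟨f, hfs, fun n z hz => ?_, ?_, ?_⟩
  · simp only [hf, hFp z (hSS hz), Complex.exp_periodic z]; ring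
  · rw [Metric.tendstoUniformlyOn_iff]
    intro ε hε
    -- For `|ζ| ≤ 1/2` one has `|log (1 + ζ)| ≤ (3/2) |ζ|`, so `ε / 2` is small enough.
    filter_upwards [Metric.tendstoUniformlyOn_iff.1 hu (min (1 / 2) (ε / 2)) (by positivity)]
      with n hn z hz
    have hw := hSC z hz.1 hz.2
    have h1 := hn _ hw
    rw [dist_comm, dist_eq_norm] at h1
    have h2 := hrat n _ hw
    rw [dist_comm, dist_eq_norm]
    simp only [hf, add_sub_cancel_left]
    have h3 := Complex.norm_log_one_add_half_le_self
      (z := g n (Complex.exp z) / ψ (Complex.exp z) - 1)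
      (h2.trans (h1.le.trans (min_le_left _ _)))
    rw [add_sub_cancel] at h3
    have := h1.trans_le (min_le_right _ _)
    linarith
  · set M : ℝ≥0∞ := ENNReal.ofReal r
    set B := ∫⁻ w in C, (‖fx w‖ₑ ^ 2 + ‖fy w‖ₑ ^ 2) with hBdef
    have hL2 : ∀ k : ℂ → ℂ, MemLp k 2 (volume.restrict C) → ∫⁻ w in C, ‖k w‖ₑ ^ 2 < ⊤ := by
      intro k hk
      have := lintegral_rpow_enorm_lt_top_of_eLpNorm_lt_top (p := 2) (by norm_num) (by norm_num) hk.2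
      simpa using this
    have hfxm := (hfx C hCc hCU).aestronglyMeasurable
    have hfym := (hfy C hCc hCU).aestronglyMeasurable
    have hB : B ≠ ⊤ := by
      rw [hBdef, lintegral_add_left' (hfxm.enorm.pow_const 2)]
      exact (ENNReal.add_lt_top.2 ⟨hL2 _ (hfx C hCc hCU), hL2 _ (hfy C hCc hCU)⟩).ne
    set e : ℕ → ℝ≥0∞ := fun n => ⨆ w ∈ C, ‖g n w - ψ w‖ₑ
    have hE : Tendsto e atTop (𝓝 0) := by
      rw [ENNReal.tendsto_nhds_zero]
      intro ε hε
      obtain ⟨δ, hδ0, hδ⟩ : ∃ δ : ℝ, 0 < δ ∧ ENNReal.ofReal δ ≤ ε := by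
        rcases eq_or_ne ε ⊤ with h | h
        · exact ⟨1, one_pos, h ▸ le_top⟩
        · exact ⟨ε.toReal, ENNReal.toReal_pos hε.ne' h, ENNReal.ofReal_toReal_le⟩
      filter_upwards [Metric.tendstoUniformlyOn_iff.1 hu δ hδ0] with n hn
      refine iSup₂_le fun w hw => le_trans ?_ hδ
      have := (hn w hw).le
      rw [dist_comm, dist_eq_norm] at this
      rw [← ofReal_norm]
      exact ENNReal.ofReal_le_ofReal this
    have hgen : ∀ v : ℂ, ‖v‖ₑ = 1 → ∀ c : ℝ, Tendsto (fun n => ∫⁻ z in Ioo a b ×ℂ Ioo c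
        (c + 2 * Real.pi), ‖fderiv ℝ (f n) z v - logDerivExp ψ fx fy v z‖ₑ ^ 2) atTop (𝓝 0) := by
      intro v hv c
      have hbound : ∀ n, ∫⁻ z in Ioo a b ×ℂ Ioo c (c + 2 * Real.pi),
          ‖fderiv ℝ (f n) z v - logDerivExp ψ fx fy v z‖ₑ ^ 2
          ≤ 16 * M ^ 2 * ((∫⁻ w in C, ‖fderiv ℝ (g n) w 1 - fx w‖ₑ ^ 2)
            + (∫⁻ w in C, ‖fderiv ℝ (g n) w Complex.I - fy w‖ₑ ^ 2) + e n ^ 2 * B) := by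
        intro n
        have hcont : ∀ u : ℂ, Continuous fun w => fderiv ℝ (g n) w u := fun u =>
          ((hgs n).continuous_fderiv (by simp)).clm_apply continuous_const
        set k : ℂ → ℝ≥0∞ := fun w => 16 * M ^ 2 *
          (‖fderiv ℝ (g n) w 1 - fx w‖ₑ ^ 2 + ‖fderiv ℝ (g n) w Complex.I - fy w‖ₑ ^ 2
            + e n ^ 2 * (‖fx w‖ₑ ^ 2 + ‖fy w‖ₑ ^ 2)) with hk
        calc _ ≤ ∫⁻ z in Ioo a b ×ℂ Ioo c (c + 2 * Real.pi), k (Complex.exp z) := by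
              refine setLIntegral_mono' (isOpen_Ioo.reProdIm isOpen_Ioo).measurableSet fun z hz => ?_
              have hw := hSC z hz.1.1 hz.1.2
              rw [fderiv_of_exp_eq (isOpen_vertStrip a b) (hfs n) (hgs n) (hfe n) hz.1]
              refine (enorm_logDerivExp_sub_sq_le hv (M := M) ?_ (hψ1 _ (hCU hw)) (hgn n _ hw)).trans ?_
              · rw [← ofReal_norm]
                exact ENNReal.ofReal_le_ofReal (hw.2.trans hebr.le)
              · simp only [hk]
                gcongr
                exact le_iSup₂ (f := fun w (_ : w ∈ C) => ‖g n w - ψ w‖ₑ) _ hw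
          _ ≤ ∫⁻ w in C, k w := lintegral_comp_exp_le ha.le hSC _
          _ = _ := by
              rw [lintegral_const_mul' _ _ (by simp [M, ENNReal.mul_eq_top]),
                lintegral_add_left', lintegral_add_left', lintegral_const_mul'']
              · exact (hfxm.enorm.pow_const 2).add (hfym.enorm.pow_const 2)
              · exact (((hcont 1).aestronglyMeasurable.sub hfxm).enorm.pow_const 2)
              · exact (((hcont 1).aestronglyMeasurable.sub hfxm).enorm.pow_const 2).add
                  (((hcont Complex.I).aestronglyMeasurable.sub hfym).enorm.pow_const 2)
      refine tendsto_of_tendsto_of_tendsto_of_le_of_le tendsto_const_nhds ?_ (fun _ => zero_le) hbound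
      have hE2 : Tendsto (fun n => e n ^ 2 * B) atTop (𝓝 0) := by
        have h1 := ENNReal.Tendsto.mul_const (b := B)
          (((ENNReal.continuous_pow 2).tendsto 0).comp hE) (Or.inr hB)
        simpa using h1
      have := ENNReal.Tendsto.const_mul (a := 16 * M ^ 2) ((hx.add hy).add hE2)
        (Or.inr (by simp [M, ENNReal.mul_eq_top]))
      simpa using this
    exact ⟨hgen 1 (by simp), hgen Complex.I (by rw [← ofReal_norm]; simp)⟩

/-! ### Green's formula for the Jacobian over a period -/

/-- The integrand is `φ(u) du ∧ dv = d (Φ(u) dv)`. On the boundary of the rectangle the horizontal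
sides cancel by periodicity, the left side contributes 0 because `Φ` vanishes there, and the right
side contributes `M` times the increment `D` of `v`. -/
theorem integral_comp_mul_jacobian_of_period {a b a' b' c T D M α β : ℝ} {u v : ℝ × ℝ → ℝ}
    (haa' : a < a') (hab' : a' ≤ b') (hbb' : b' < b) (hT : 0 ≤ T)
    (hu : ContDiffOn ℝ ∞ u {p | a < p.1 ∧ p.1 < b}) (hv : ContDiffOn ℝ ∞ v {p | a < p.1 ∧ p.1 < b})
    (hup : ∀ p : ℝ × ℝ, a < p.1 → p.1 < b → u (p + (0, T)) = u p)
    (hvp : ∀ p : ℝ × ℝ, a < p.1 → p.1 < b → v (p + (0, T)) = v p + D)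
    {Φ φ : ℝ → ℝ} (hΦ : ∀ t, HasDerivAt Φ (φ t) t) (hφ : Continuous φ)
    (hα : ∀ t ≤ α, Φ t = 0) (hβ : ∀ t, β ≤ t → Φ t = M)
    (hua : ∀ y, u (a', y) ≤ α) (hub : ∀ y, β ≤ u (b', y)) :
    ∫ p in Icc (a', c) (b', c + T), φ (u p) * (fderiv ℝ u p (1, 0) * fderiv ℝ v p (0, 1)
      - fderiv ℝ u p (0, 1) * fderiv ℝ v p (1, 0)) = M * D := by
  set O : Set (ℝ × ℝ) := {p | a < p.1 ∧ p.1 < b} with hOdef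
  have hO : IsOpen O := (isOpen_lt continuous_const continuous_fst).inter
    (isOpen_lt continuous_fst continuous_const)
  have hOsub : Icc (a', c) (b', c + T) ⊆ O := fun p hp =>
    ⟨haa'.trans_le hp.1.1, hp.2.1.trans_lt hbb'⟩
  have hΦc : Continuous Φ := continuous_iff_continuousAt.2 fun t => (hΦ t).continuousAt
  have hdu : ∀ p ∈ O, HasFDerivAt u (fderiv ℝ u p) p := fun p hp =>
    ((hu.contDiffAt (hO.mem_nhds hp)).differentiableAt (by simp)).hasFDerivAt
  have hdv : ∀ p ∈ O, HasFDerivAt v (fderiv ℝ v p) p := fun p hp =>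
    ((hv.contDiffAt (hO.mem_nhds hp)).differentiableAt (by simp)).hasFDerivAt
  have hddv : ∀ p ∈ O, HasFDerivAt (fderiv ℝ v) (fderiv ℝ (fderiv ℝ v) p) p := fun p hp =>
    (((hv.contDiffAt (hO.mem_nhds hp)).fderiv_right (m := 1) (by norm_cast)).differentiableAt
      (by simp)).hasFDerivAt
  have hdvw : ∀ p ∈ O, ∀ w : ℝ × ℝ, HasFDerivAt (fun p => fderiv ℝ v p w)
      ((fderiv ℝ (fderiv ℝ v) p).flip w) p := fun p hp w => by
    have := (hddv p hp).clm_apply (hasFDerivAt_const w p)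
    simpa using this
  have hsymm : ∀ p ∈ O, ∀ x y, fderiv ℝ (fderiv ℝ v) p x y = fderiv ℝ (fderiv ℝ v) p y x := by
    intro p hp x y
    have : IsSymmSndFDerivAt ℝ v p := (hv.contDiffAt (hO.mem_nhds hp)).isSymmSndFDerivAt
      (by rw [minSmoothness_of_isRCLikeNormedField]; norm_cast)
    exact this x y
  have hcu : ContinuousOn u O := hu.continuousOn
  have hcdu : ∀ w : ℝ × ℝ, ContinuousOn (fun p => fderiv ℝ u p w) O := fun w =>
    (hu.continuousOn_fderiv_of_isOpen hO (by simp)).clm_apply continuousOn_const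
  have hcdv : ∀ w : ℝ × ℝ, ContinuousOn (fun p => fderiv ℝ v p w) O := fun w =>
    (hv.continuousOn_fderiv_of_isOpen hO (by simp)).clm_apply continuousOn_const
  -- The field `(P, Q)` has the integrand as its divergence; the terms with second derivatives of
  -- `v` cancel by symmetry.
  set P : ℝ × ℝ → ℝ := fun p => Φ (u p) * fderiv ℝ v p (0, 1) with hP
  set Q : ℝ × ℝ → ℝ := fun p => -(Φ (u p) * fderiv ℝ v p (1, 0)) with hQ
  set P' : ℝ × ℝ → ℝ × ℝ →L[ℝ] ℝ := fun p => Φ (u p) • (fderiv ℝ (fderiv ℝ v) p).flip (0, 1)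
    + fderiv ℝ v p (0, 1) • (φ (u p) • fderiv ℝ u p) with hP'
  set Q' : ℝ × ℝ → ℝ × ℝ →L[ℝ] ℝ := fun p => -(Φ (u p) • (fderiv ℝ (fderiv ℝ v) p).flip (1, 0)
    + fderiv ℝ v p (1, 0) • (φ (u p) • fderiv ℝ u p)) with hQ'
  have hdP : ∀ p ∈ O, HasFDerivAt P (P' p) p := fun p hp =>
    ((hΦ (u p)).comp_hasFDerivAt p (hdu p hp)).mul (hdvw p hp (0, 1))
  have hdQ : ∀ p ∈ O, HasFDerivAt Q (Q' p) p := fun p hp =>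
    (((hΦ (u p)).comp_hasFDerivAt p (hdu p hp)).mul (hdvw p hp (1, 0))).neg
  have hdiv : ∀ p ∈ O, P' p (1, 0) + Q' p (0, 1) = φ (u p) * (fderiv ℝ u p (1, 0) *
      fderiv ℝ v p (0, 1) - fderiv ℝ u p (0, 1) * fderiv ℝ v p (1, 0)) := fun p hp => by
    have := hsymm p hp (1, 0) (0, 1)
    simp only [hP', hQ', add_apply, neg_apply,
      smul_apply, ContinuousLinearMap.flip_apply, smul_eq_mul, this]
    ring
  have hcP : ContinuousOn P O := (hΦc.comp_continuousOn hcu).mul (hcdv _)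
  have hcQ : ContinuousOn Q O := ((hΦc.comp_continuousOn hcu).mul (hcdv _)).neg
  have hsub : Ioo a' b' ×ˢ Ioo c (c + T) ⊆ O := fun p hp =>
    ⟨haa'.trans hp.1.1, hp.1.2.trans hbb'⟩
  have hmain := integral_divergence_prod_Icc_of_hasFDerivAt_of_le P Q P' Q' (a', c) (b', c + T)
    ⟨hab', by simpa using hT⟩ (hcP.mono hOsub) (hcQ.mono hOsub) (fun p hp => hdP p (hsub hp))
    (fun p hp => hdQ p (hsub hp)) (by
      refine IntegrableOn.congr_fun ?_ (fun p hp => (hdiv p (hOsub hp)).symm) measurableSet_Icc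
      refine ContinuousOn.integrableOn_compact isCompact_Icc (ContinuousOn.mono ?_ hOsub)
      exact (hφ.comp_continuousOn hcu).mul (((hcdu _).mul (hcdv _)).sub ((hcdu _).mul (hcdv _))))
  rw [setIntegral_congr_fun measurableSet_Icc fun p hp => (hdiv p (hOsub hp)).symm, hmain]
  have hdper : ∀ p ∈ O, fderiv ℝ v (p + (0, T)) = fderiv ℝ v p := by
    intro p hp
    rw [← fderiv_comp_add_right]
    have : (fun x => v (x + (0, T))) =ᶠ[𝓝 p] fun x => v x + D := by
      filter_upwards [hO.mem_nhds hp] with x hx using hvp x hx.1 hx.2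
    rw [this.fderiv_eq, fderiv_add_const]
  have h1 : ∫ x in a'..b', Q (x, c + T) = ∫ x in a'..b', Q (x, c) := by
    refine intervalIntegral.integral_congr fun x hx => ?_
    rw [uIcc_of_le hab'] at hx
    have hxO : (x, c) ∈ O := ⟨haa'.trans_le hx.1, hx.2.trans_lt hbb'⟩
    have e : ((x, c + T) : ℝ × ℝ) = (x, c) + (0, T) := by simp
    simp only [hQ, e, hdper _ hxO, hup _ hxO.1 hxO.2]
  have h2 : ∫ y in c..(c + T), P (a', y) = 0 := by
    rw [intervalIntegral.integral_congr (g := fun _ => 0) fun y _ => by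
      simp only [hP, hα _ (hua y), zero_mul]]
    simp
  have h3 : ∫ y in c..(c + T), P (b', y) = M * D := by
    have hbO : ∀ y, ((b', y) : ℝ × ℝ) ∈ O := fun y => ⟨haa'.trans_le hab', hbb'⟩
    rw [intervalIntegral.integral_congr (g := fun y => M * fderiv ℝ v (b', y) (0, 1)) fun y _ => by
      simp only [hP, hβ _ (hub y)]]
    rw [intervalIntegral.integral_const_mul]
    congr 1
    have hd : ∀ y, HasDerivAt (fun y => v (b', y)) (fderiv ℝ v (b', y) (0, 1)) y := fun y =>
      (hdv _ (hbO y)).comp_hasDerivAt y ((hasDerivAt_const y b').prodMk (hasDerivAt_id y))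
    rw [intervalIntegral.integral_eq_sub_of_hasDerivAt (fun y _ => hd y)]
    · have e : ((b', c + T) : ℝ × ℝ) = (b', c) + (0, T) := by simp
      rw [e, hvp _ (hbO c).1 (hbO c).2]; ring
    · refine ContinuousOn.intervalIntegrable ?_
      exact (hcdv (0, 1)).comp (by fun_prop) fun y _ => hbO y
  rw [h1, h2, h3]; ring

theorem integral_comp_re_mul_jacobian {a b a' b' c M α β : ℝ} {m : ℤ} {f : ℂ → ℂ}
    (haa' : a < a') (hab' : a' ≤ b') (hbb' : b' < b)
    (hf : ContDiffOn ℝ ∞ f (vertStrip a b))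
    (hfp : ∀ z ∈ vertStrip a b, f (z + 2 * Real.pi * Complex.I) = f z + m * (2 * Real.pi * Complex.I))
    {Φ φ : ℝ → ℝ} (hΦ : ∀ t, HasDerivAt Φ (φ t) t) (hφ : Continuous φ)
    (hα : ∀ t ≤ α, Φ t = 0) (hβ : ∀ t, β ≤ t → Φ t = M)
    (hfa : ∀ z : ℂ, z.re = a' → (f z).re ≤ α) (hfb : ∀ z : ℂ, z.re = b' → β ≤ (f z).re) :
    ∫ z in Icc a' b' ×ℂ Icc c (c + 2 * Real.pi),
      φ (f z).re * ((starRingEnd ℂ) (fderiv ℝ f z 1) * fderiv ℝ f z Complex.I).im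
      = M * (m * (2 * Real.pi)) := by
  set L := Complex.equivRealProdCLM.symm
  have hLre : ∀ p, (L p).re = p.1 := fun p => rfl
  have hL10 : L (1, 0) = 1 := by apply Complex.ext <;> rfl
  have hL01 : L (0, 1) = Complex.I := by apply Complex.ext <;> rfl
  have hLT : ∀ p, L (p + (0, 2 * Real.pi)) = L p + 2 * Real.pi * Complex.I := fun p => by
    rw [map_add]
    congr 1
    apply Complex.ext
    · change (0 : ℝ) = _; simp
    · change (2 * Real.pi : ℝ) = _; simp
  have hfL : ContDiffOn ℝ ∞ (fun p => f (L p)) {p | a < p.1 ∧ p.1 < b} :=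
    hf.comp L.contDiff.contDiffOn fun p hp => hp
  have hd : ∀ p : ℝ × ℝ, a < p.1 → p.1 < b → ∀ (T : ℂ →L[ℝ] ℝ) (w : ℝ × ℝ),
      fderiv ℝ (fun p => T (f (L p))) p w = T (fderiv ℝ f (L p) (L w)) := by
    intro p h1 h2 T w
    have hfd : HasFDerivAt f (fderiv ℝ f (L p)) (L p) :=
      ((hf.contDiffAt ((isOpen_vertStrip a b).mem_nhds ⟨h1, h2⟩)).differentiableAt
        (by simp)).hasFDerivAt
    have h3 : HasFDerivAt (fun p => T (f (L p))) _ p :=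
      T.hasFDerivAt.comp p (hfd.comp p L.hasFDerivAt)
    rw [h3.fderiv]; rfl
  have main := integral_comp_mul_jacobian_of_period (c := c) (T := 2 * Real.pi)
    (D := m * (2 * Real.pi)) (u := fun p => Complex.reCLM (f (L p)))
    (v := fun p => Complex.imCLM (f (L p))) haa' hab' hbb' (by have := Real.pi_pos; positivity)
    (Complex.reCLM.contDiff.comp_contDiffOn hfL) (Complex.imCLM.contDiff.comp_contDiffOn hfL)
    (fun p h1 h2 => by rw [hLT, hfp _ ⟨h1, h2⟩]; simp)
    (fun p h1 h2 => by rw [hLT, hfp _ ⟨h1, h2⟩]; simp) hΦ hφ hα hβ (fun y => hfa _ rfl)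
    (fun y => hfb _ rfl)
  rw [← main, ← Complex.volume_preserving_equiv_real_prod.symm.setIntegral_preimage_emb
    Complex.measurableEquivRealProd.symm.measurableEmbedding]
  have hset : Complex.measurableEquivRealProd.symm ⁻¹' (Icc a' b' ×ℂ Icc c (c + 2 * Real.pi))
      = Icc (a', c) (b', c + 2 * Real.pi) := by
    ext p
    simp only [mem_preimage, Complex.mem_reProdIm, mem_Icc, Prod.le_def]
    change ((a' ≤ p.1 ∧ p.1 ≤ b') ∧ (c ≤ p.2 ∧ p.2 ≤ _)) ↔ _
    tauto
  rw [hset]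
  refine setIntegral_congr_fun measurableSet_Icc fun p hp => ?_
  have h1 : a < p.1 := haa'.trans_le hp.1.1
  have h2 : p.1 < b := hp.2.1.trans_lt hbb'
  have hLp : Complex.measurableEquivRealProd.symm p = L p := rfl
  rw [hLp, hd p h1 h2, hd p h1 h2, hd p h1 h2, hd p h1 h2, hL10, hL01]
  simp only [Complex.reCLM_apply, Complex.imCLM_apply,
    Complex.mul_im, Complex.conj_re, Complex.conj_im]
  ring

/-- The closed rectangle `[a, b] × [c, c + 2 π]`. -/
def periodRect (a b c : ℝ) : Set ℂ := Icc a b ×ℂ Icc c (c + 2 * Real.pi)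

theorem isCompact_periodRect (a b c : ℝ) : IsCompact (periodRect a b c) :=
  isCompact_Icc.reProdIm isCompact_Icc

theorem measurableSet_periodRect (a b c : ℝ) : MeasurableSet (periodRect a b c) :=
  (isCompact_periodRect a b c).measurableSet

theorem periodRect_subset_vertStrip {a b a' b' c : ℝ} (ha : a < a') (hb : b' < b) :
    periodRect a' b' c ⊆ vertStrip a b := fun _ hz => ⟨ha.trans_le hz.1.1, hz.1.2.trans_lt hb⟩

/-- Two open period rectangles, shifted by `-1` and `+1`, cover the closed one, so convergence
passes to closed rectangles. -/
theorem IsStripSobolev.exists_approx {R : ℝ} {F gx gy : ℂ → ℂ} {m : ℤ}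
    (h : IsStripSobolev R F gx gy m) {a' b' : ℝ} (ha' : 0 < a') (hab' : a' ≤ b') (hb' : b' < R) :
    ∃ (a b : ℝ) (f : ℕ → ℂ → ℂ), 0 < a ∧ a < a' ∧ b' < b ∧ b < R ∧
      (∀ n, ContDiffOn ℝ ∞ (f n) (vertStrip a b)) ∧
      (∀ n, ∀ z ∈ vertStrip a b,
        f n (z + 2 * Real.pi * Complex.I) = f n z + m * (2 * Real.pi * Complex.I)) ∧
      TendstoUniformlyOn f F atTop (vertStrip a b) ∧
      (∀ c : ℝ, Tendsto (fun n => ∫⁻ z in periodRect a' b' c,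
        ‖fderiv ℝ (f n) z 1 - gx z‖ₑ ^ 2) atTop (𝓝 0)) ∧
      ∀ c : ℝ, Tendsto (fun n => ∫⁻ z in periodRect a' b' c,
        ‖fderiv ℝ (f n) z Complex.I - gy z‖ₑ ^ 2) atTop (𝓝 0) := by
  have hp := Real.pi_gt_three
  obtain ⟨f, hf, hfp, hfu, hx, hy⟩ := h (a' / 2) ((b' + R) / 2) (by linarith) (by linarith)
    (by linarith)
  have hcov : ∀ c, periodRect a' b' c ⊆
      (Ioo (a' / 2) ((b' + R) / 2) ×ℂ Ioo (c - 1) (c - 1 + 2 * Real.pi)) ∪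
      (Ioo (a' / 2) ((b' + R) / 2) ×ℂ Ioo (c + 1) (c + 1 + 2 * Real.pi)) := by
    intro c z hz
    have h1 := hz.1.1; have h2 := hz.1.2; have h3 := hz.2.1; have h4 := hz.2.2
    have hre : z.re ∈ Ioo (a' / 2) ((b' + R) / 2) := ⟨by linarith, by linarith⟩
    rcases lt_or_ge (c + 1) z.im with h5 | h5
    · exact Or.inr ⟨hre, h5, by linarith⟩
    · exact Or.inl ⟨hre, by change c - 1 < z.im; linarith, by change z.im < _; linarith⟩
  have key : ∀ k : ℕ → ℂ → ℝ≥0∞, (∀ c : ℝ, Tendsto (fun n => ∫⁻ z in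
      Ioo (a' / 2) ((b' + R) / 2) ×ℂ Ioo c (c + 2 * Real.pi), k n z) atTop (𝓝 0)) →
      ∀ c : ℝ, Tendsto (fun n => ∫⁻ z in periodRect a' b' c, k n z) atTop (𝓝 0) := by
    intro k hk c
    have := (hk (c - 1)).add (hk (c + 1))
    rw [add_zero] at this
    exact tendsto_of_tendsto_of_tendsto_of_le_of_le tendsto_const_nhds this (fun _ => zero_le)
      fun n => (lintegral_mono_set (hcov c)).trans (lintegral_union_le _ _ _)
  exact ⟨a' / 2, (b' + R) / 2, f, by linarith, by linarith, by linarith, by linarith, hf, hfp, hfu,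
    key _ hx, key _ hy⟩

theorem lintegral_sq_lt_top_of_tendsto {S Q : Set ℂ} (hS : IsOpen S) (hQ : IsCompact Q)
    (hQS : Q ⊆ S) {f : ℕ → ℂ → ℂ} (hf : ∀ n, ContDiffOn ℝ ∞ (f n) S) {g : ℂ → ℂ} {v : ℂ}
    (ht : Tendsto (fun n => ∫⁻ z in Q, ‖fderiv ℝ (f n) z v - g z‖ₑ ^ 2) atTop (𝓝 0)) :
    ∫⁻ z in Q, ‖g z‖ₑ ^ 2 < ⊤ := by
  obtain ⟨n, hn⟩ := (ht.eventually_lt_const (show (0 : ℝ≥0∞) < 1 by norm_num)).exists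
  have hc : ContinuousOn (fun z => fderiv ℝ (f n) z v) Q :=
    (((hf n).continuousOn_fderiv_of_isOpen hS (by simp)).clm_apply continuousOn_const).mono hQS
  have h1 : ∫⁻ z in Q, ‖fderiv ℝ (f n) z v‖ₑ ^ 2 < ⊤ := by
    obtain ⟨M, hM⟩ := hQ.exists_bound_of_continuousOn hc
    refine lt_of_le_of_lt (setLIntegral_mono' hQ.measurableSet (g := fun _ =>
      ENNReal.ofReal M ^ 2) fun z hz => ?_) ?_
    · rw [← ofReal_norm]
      gcongr
      exact hM z hz
    · rw [setLIntegral_const]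
      exact ENNReal.mul_lt_top (by simp) hQ.measure_lt_top
  have hm : Measurable fun z => ‖fderiv ℝ (f n) z v‖ₑ ^ 2 :=
    (measurable_fderiv_apply_const ℝ (f n) v).enorm.pow_const 2
  calc ∫⁻ z in Q, ‖g z‖ₑ ^ 2
      ≤ ∫⁻ z in Q, 2 * (‖fderiv ℝ (f n) z v‖ₑ ^ 2 + ‖fderiv ℝ (f n) z v - g z‖ₑ ^ 2) := by
        refine lintegral_mono fun z => ?_
        refine le_trans ?_ (ENNReal.add_sq_le _ _)
        gcongr
        calc ‖g z‖ₑ = ‖fderiv ℝ (f n) z v - (fderiv ℝ (f n) z v - g z)‖ₑ := by rw [_root_.sub_sub_cancel]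
          _ ≤ _ := enorm_sub_le
    _ = 2 * ((∫⁻ z in Q, ‖fderiv ℝ (f n) z v‖ₑ ^ 2)
        + ∫⁻ z in Q, ‖fderiv ℝ (f n) z v - g z‖ₑ ^ 2) := by
        rw [lintegral_const_mul' _ _ (by norm_num), lintegral_add_left hm]
    _ < ⊤ := ENNReal.mul_lt_top (by norm_num) (ENNReal.add_lt_top.2 ⟨h1, hn.trans (by norm_num)⟩)

theorem tendsto_lintegral_mul_zero {α : Type*} [MeasurableSpace α] (μ : Measure α)
    {k l : ℕ → α → ℝ≥0∞} {B : ℝ≥0∞} (hB : B ≠ ⊤) (hk : ∀ n, AEMeasurable (k n) μ)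
    (hl : ∀ n, AEMeasurable (l n) μ) (hkB : ∀ᶠ n in atTop, ∫⁻ x, k n x ^ 2 ∂μ ≤ B)
    (ht : Tendsto (fun n => ∫⁻ x, l n x ^ 2 ∂μ) atTop (𝓝 0)) :
    Tendsto (fun n => ∫⁻ x, k n x * l n x ∂μ) atTop (𝓝 0) := by
  refine tendsto_zero_of_sq_tendsto_zero ?_
  have h1 := ENNReal.Tendsto.const_mul (a := B) ht (Or.inr hB)
  rw [mul_zero] at h1
  refine tendsto_of_tendsto_of_tendsto_of_le_of_le' tendsto_const_nhds h1
    (Eventually.of_forall fun _ => zero_le) ?_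
  filter_upwards [hkB] with n hn
  exact (sq_lintegral_mul_le μ (hk n) (hl n)).trans (by gcongr)

/-- The Jacobian determinant `Im (conj p * q)` of a map with partial derivatives `p` and `q`. -/
noncomputable def jac (p q : ℂ) : ℝ := ((starRingEnd ℂ) p * q).im

theorem enorm_jac_le (p q : ℂ) : ‖jac p q‖ₑ ≤ ‖p‖ₑ * ‖q‖ₑ := by
  rw [← enorm_mul, ← ofReal_norm, ← ofReal_norm]
  refine ENNReal.ofReal_le_ofReal ?_
  have := Complex.abs_im_le_norm ((starRingEnd ℂ) p * q)
  rw [norm_mul, Complex.norm_conj, ← norm_mul] at this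
  exact this

theorem jac_sub_jac (p q p' q' : ℂ) :
    jac p' q' - jac p q = jac p (q' - q) + jac (p' - p) q + jac (p' - p) (q' - q) := by
  simp only [jac, Complex.mul_im, Complex.conj_re, Complex.conj_im, Complex.sub_re, Complex.sub_im]
  ring

theorem measurable_jac {p q : ℂ → ℂ} (hp : Measurable p) (hq : Measurable q) :
    Measurable fun z => jac (p z) (q z) :=
  Complex.measurable_im.comp ((Complex.continuous_conj.measurable.comp hp).mul hq)

/-- The Jacobian is bilinear in the partial derivatives, so their `L²` convergence gives `L¹`
convergence of the Jacobians. With the uniform convergence of `φ (Re f n)`, Green's formula passes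
from the smooth approximants to `F`. -/
theorem IsStripSobolev.integral_comp_re_mul_jac {R : ℝ} {F gx gy : ℂ → ℂ} {m : ℤ}
    (h : IsStripSobolev R F gx gy m) (hF : ContinuousOn F (vertStrip 0 R))
    (hgx : Measurable gx) (hgy : Measurable gy) {a b c α β M : ℝ}
    (ha : 0 < a) (hab : a ≤ b) (hb : b < R)
    {Φ φ : ℝ → ℝ} (hΦ : ∀ t, HasDerivAt Φ (φ t) t) (hφ : UniformContinuous φ)
    (hφ1 : ∀ t, |φ t| ≤ 1) (hα : ∀ t ≤ α, Φ t = 0) (hβ : ∀ t, β ≤ t → Φ t = M)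
    {α' β' : ℝ} (hαα' : α' < α) (hββ' : β < β')
    (hFa : ∀ z : ℂ, z.re = a → (F z).re ≤ α') (hFb : ∀ z : ℂ, z.re = b → β' ≤ (F z).re) :
    IntegrableOn (fun z => φ (F z).re * jac (gx z) (gy z)) (periodRect a b c) ∧
      ∫ z in periodRect a b c, φ (F z).re * jac (gx z) (gy z) = M * (m * (2 * Real.pi)) := by
  obtain ⟨a₀, b₀, f, ha₀, haa₀, hbb₀, hb₀, hf, hfp, hfu, hx, hy⟩ := h.exists_approx ha hab hb
  set Q := periodRect a b c with hQ
  have hQc : IsCompact Q := isCompact_periodRect a b c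
  have hQm : MeasurableSet Q := hQc.measurableSet
  have hQS : Q ⊆ vertStrip a₀ b₀ := periodRect_subset_vertStrip haa₀ hbb₀
  have hS := isOpen_vertStrip a₀ b₀
  have hgx2 := lintegral_sq_lt_top_of_tendsto hS hQc hQS hf (hx c)
  have hgy2 := lintegral_sq_lt_top_of_tendsto hS hQc hQS hf (hy c)
  have hFQ : ContinuousOn F Q := hF.mono (periodRect_subset_vertStrip ha hb)
  have hφF : AEStronglyMeasurable (fun z => φ (F z).re) (volume.restrict Q) :=
    (hφ.continuous.comp_continuousOn (Complex.continuous_re.comp_continuousOn hFQ)).aestronglyMeasurable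
      hQm
  have hJm : Measurable fun z => jac (gx z) (gy z) := measurable_jac hgx hgy
  have hJ1 : ∫⁻ z in Q, ‖jac (gx z) (gy z)‖ₑ < ⊤ := by
    have h1 : ∫⁻ z in Q, ‖gx z‖ₑ * ‖gy z‖ₑ < ⊤ := by
      have := sq_lintegral_mul_le (volume.restrict Q) hgx.enorm.aemeasurable hgy.enorm.aemeasurable
      have := this.trans_lt (ENNReal.mul_lt_top hgx2 hgy2)
      exact (ENNReal.pow_lt_top_iff.1 this).resolve_right (by norm_num)
    exact (lintegral_mono fun z => enorm_jac_le _ _).trans_lt h1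
  have hJi : Integrable (fun z => jac (gx z) (gy z)) (volume.restrict Q) :=
    ⟨hJm.aestronglyMeasurable, hJ1⟩
  have hi : Integrable (fun z => φ (F z).re * jac (gx z) (gy z)) (volume.restrict Q) :=
    hJi.bdd_mul hφF (c := 1) (Eventually.of_forall fun z => hφ1 _)
  refine ⟨hi, ?_⟩
  set X : ℕ → ℂ → ℂ := fun n z => fderiv ℝ (f n) z 1 with hX
  set Y : ℕ → ℂ → ℂ := fun n z => fderiv ℝ (f n) z Complex.I with hY
  have hXm : ∀ n, Measurable (X n) := fun n => measurable_fderiv_apply_const ℝ (f n) 1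
  have hYm : ∀ n, Measurable (Y n) := fun n => measurable_fderiv_apply_const ℝ (f n) Complex.I
  have hXc : ∀ n, ContinuousOn (X n) Q := fun n =>
    (((hf n).continuousOn_fderiv_of_isOpen hS (by simp)).clm_apply continuousOn_const).mono hQS
  have hYc : ∀ n, ContinuousOn (Y n) Q := fun n =>
    (((hf n).continuousOn_fderiv_of_isOpen hS (by simp)).clm_apply continuousOn_const).mono hQS
  have hlim : Tendsto (fun n => ∫ z in Q, φ (f n z).re * jac (X n z) (Y n z)) atTop
      (𝓝 (∫ z in Q, φ (F z).re * jac (gx z) (gy z))) := by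
    refine tendsto_integral_of_L1 _ hi.1 (Eventually.of_forall fun n => ?_) ?_
    · refine ContinuousOn.integrableOn_compact hQc ?_
      refine (hφ.continuous.comp_continuousOn (Complex.continuous_re.comp_continuousOn
        ((hf n).continuousOn.mono hQS))).mul ?_
      exact Complex.continuous_im.comp_continuousOn
        ((Complex.continuous_conj.comp_continuousOn (hXc n)).mul (hYc n))
    · have hT1 : Tendsto (fun n => ∫⁻ z in Q, ‖gx z‖ₑ * ‖Y n z - gy z‖ₑ) atTop (𝓝 0) :=
        tendsto_lintegral_mul_zero _ hgx2.ne (fun _ => hgx.enorm.aemeasurable)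
          (fun n => ((hYm n).sub hgy).enorm.aemeasurable) (Eventually.of_forall fun _ => le_rfl) (hy c)
      have hT2 : Tendsto (fun n => ∫⁻ z in Q, ‖gy z‖ₑ * ‖X n z - gx z‖ₑ) atTop (𝓝 0) :=
        tendsto_lintegral_mul_zero _ hgy2.ne (fun _ => hgy.enorm.aemeasurable)
          (fun n => ((hXm n).sub hgx).enorm.aemeasurable) (Eventually.of_forall fun _ => le_rfl) (hx c)
      have hT3 : Tendsto (fun n => ∫⁻ z in Q, ‖X n z - gx z‖ₑ * ‖Y n z - gy z‖ₑ) atTop (𝓝 0) :=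
        tendsto_lintegral_mul_zero _ one_ne_top (fun n => ((hXm n).sub hgx).enorm.aemeasurable)
          (fun n => ((hYm n).sub hgy).enorm.aemeasurable)
          ((hx c).eventually_le_const (by norm_num)) (hy c)
      set B := ∫⁻ z in Q, ‖jac (gx z) (gy z)‖ₑ with hB
      set e : ℕ → ℝ≥0∞ := fun n => ⨆ z ∈ Q, ‖φ (f n z).re - φ (F z).re‖ₑ
      have hE : Tendsto e atTop (𝓝 0) := by
        rw [ENNReal.tendsto_nhds_zero]
        intro ε hε
        obtain ⟨δ, hδ0, hδ⟩ : ∃ δ : ℝ, 0 < δ ∧ ENNReal.ofReal δ ≤ ε := by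
          rcases eq_or_ne ε ⊤ with h | h
          · exact ⟨1, one_pos, h ▸ le_top⟩
          · exact ⟨ε.toReal, ENNReal.toReal_pos hε.ne' h, ENNReal.ofReal_toReal_le⟩
        obtain ⟨η, hη, hφη⟩ := Metric.uniformContinuous_iff.1 hφ δ hδ0
        filter_upwards [Metric.tendstoUniformlyOn_iff.1 hfu η hη] with n hn
        refine iSup₂_le fun z hz => le_trans ?_ hδ
        rw [← ofReal_norm, ← dist_eq_norm]
        refine ENNReal.ofReal_le_ofReal (hφη ?_).le
        refine lt_of_le_of_lt ?_ (hn z (hQS hz))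
        rw [dist_comm (F z), dist_eq_norm, dist_eq_norm, ← Complex.sub_re]
        exact Complex.abs_re_le_norm _
      have hsum := ((hT1.add hT2).add hT3).add
        (ENNReal.Tendsto.mul_const (b := B) hE (Or.inr hJ1.ne))
      simp only [add_zero, zero_mul] at hsum
      refine tendsto_of_tendsto_of_tendsto_of_le_of_le tendsto_const_nhds hsum
        (fun _ => zero_le) fun n => ?_
      calc ∫⁻ z in Q, ‖φ (f n z).re * jac (X n z) (Y n z) - φ (F z).re * jac (gx z) (gy z)‖ₑ
          ≤ ∫⁻ z in Q, (‖gx z‖ₑ * ‖Y n z - gy z‖ₑ + ‖gy z‖ₑ * ‖X n z - gx z‖ₑ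
            + ‖X n z - gx z‖ₑ * ‖Y n z - gy z‖ₑ + e n * ‖jac (gx z) (gy z)‖ₑ) := by
            refine setLIntegral_mono' hQm fun z hz => ?_
            have e1 : φ (f n z).re * jac (X n z) (Y n z) - φ (F z).re * jac (gx z) (gy z)
              = φ (f n z).re * (jac (X n z) (Y n z) - jac (gx z) (gy z))
                + (φ (f n z).re - φ (F z).re) * jac (gx z) (gy z) := by ring
            rw [e1]
            refine (enorm_add_le _ _).trans ?_
            rw [enorm_mul, enorm_mul]
            refine add_le_add ?_ ?_
            · have hφe : ‖φ (f n z).re‖ₑ ≤ 1 := by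
                rw [← ofReal_norm, ← ENNReal.ofReal_one]
                exact ENNReal.ofReal_le_ofReal (hφ1 _)
              refine (mul_le_of_le_one_left' hφe).trans ?_
              rw [jac_sub_jac]
              refine (enorm_add_le _ _).trans (add_le_add ((enorm_add_le _ _).trans
                (add_le_add (enorm_jac_le _ _) ?_)) (enorm_jac_le _ _))
              rw [mul_comm]; exact enorm_jac_le _ _
            · gcongr
              exact le_iSup₂ (f := fun z (_ : z ∈ Q) => ‖φ (f n z).re - φ (F z).re‖ₑ) z hz
        _ = _ := by
            have m1 := ((hYm n).sub hgy).enorm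
            have m2 := ((hXm n).sub hgx).enorm
            rw [lintegral_add_left, lintegral_add_left, lintegral_add_left,
              lintegral_const_mul _ hJm.enorm]
            · exact hgx.enorm.mul m1
            · exact (hgx.enorm.mul m1).add (hgy.enorm.mul m2)
            · exact ((hgx.enorm.mul m1).add (hgy.enorm.mul m2)).add (m2.mul m1)
  refine tendsto_nhds_unique hlim (tendsto_const_nhds.congr' ?_)
  -- The gaps between `α'` and `α` and between `β` and `β'` absorb the uniform error: on the
  -- vertical sides `Re f n` lies where `Φ` is constant.
  set ε := min (α - α') (β' - β)
  filter_upwards [Metric.tendstoUniformlyOn_iff.1 hfu ε (lt_min (by linarith) (by linarith))]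
    with n hn
  have hre : ∀ z ∈ vertStrip a₀ b₀, |(F z).re - (f n z).re| < ε := fun z hz => by
    rw [← Complex.sub_re]
    refine (Complex.abs_re_le_norm _).trans_lt ?_
    rw [← dist_eq_norm]; exact hn z hz
  refine (integral_comp_re_mul_jacobian haa₀ hab hbb₀ (hf n) (hfp n) hΦ hφ.continuous hα hβ
    (fun z hz => ?_) fun z hz => ?_).symm
  · have h1 := (abs_lt.1 (hre z ⟨by rw [hz]; exact haa₀, by rw [hz]; linarith⟩)).1
    have h2 := hFa z hz
    have h3 := min_le_left (α - α') (β' - β)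
    linarith
  · have h1 := (abs_lt.1 (hre z ⟨by rw [hz]; linarith, by rw [hz]; exact hbb₀⟩)).2
    have h2 := hFb z hz
    have h3 := min_le_right (α - α') (β' - β)
    linarith

/-! ### The energy bound -/

/-- A cut-off `φ` which is `1` on `[s, t]` together with a primitive `Φ`, constant off `[α, β]`. -/
theorem exists_cutoff {R' s t : ℝ} (hs : 0 < s) (hst : s ≤ t) (ht : t < R') :
    ∃ (α β M : ℝ) (Φ φ : ℝ → ℝ), 0 < α ∧ β < R' ∧ |M| ≤ R' ∧ (∀ x, HasDerivAt Φ (φ x) x) ∧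
      UniformContinuous φ ∧ (∀ x, 0 ≤ φ x) ∧ (∀ x, |φ x| ≤ 1) ∧ (∀ x ∈ Icc s t, φ x = 1) ∧
      (∀ x ≤ α, Φ x = 0) ∧ ∀ x, β ≤ x → Φ x = M := by
  have hR' : 0 < R' := by linarith
  -- The bump is centred at `R'/2`. Its inner radius reaches `s` and `t`, with `R'/4` keeping it
  -- positive; the outer radius `ρ` is halfway from there to `R'/2`, so the support stays inside
  -- `(0, R')` and the integral is at most `2ρ ≤ R'`.
  set ρ := (max (max (R' / 2 - s) (t - R' / 2)) (R' / 4) + R' / 2) / 2 with hρ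
  have hm : max (max (R' / 2 - s) (t - R' / 2)) (R' / 4) < R' / 2 :=
    max_lt (max_lt (by linarith) (by linarith)) (by linarith)
  have hm1 : R' / 2 - s ≤ max (max (R' / 2 - s) (t - R' / 2)) (R' / 4) :=
    (le_max_left _ _).trans (le_max_left _ _)
  have hm2 : t - R' / 2 ≤ max (max (R' / 2 - s) (t - R' / 2)) (R' / 4) :=
    (le_max_right _ _).trans (le_max_left _ _)
  have hm3 : R' / 4 ≤ max (max (R' / 2 - s) (t - R' / 2)) (R' / 4) := le_max_right _ _
  set b : ContDiffBump (R' / 2 : ℝ) :=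
    ⟨max (max (R' / 2 - s) (t - R' / 2)) (R' / 4), ρ, by linarith, by linarith⟩ with hb
  set α := R' / 2 - ρ
  set β := R' / 2 + ρ
  have hαβ : α ≤ β := by simp only [α, β]; linarith
  have hbi : ∀ x y, IntervalIntegrable b volume x y := fun x y => b.continuous.intervalIntegrable x y
  have hzl : ∀ x ≤ α, b x = 0 := fun x hx => b.zero_of_le_dist (by
    rw [dist_comm, Real.dist_eq]
    have : ρ ≤ R' / 2 - x := by simp only [α] at hx; linarith
    exact this.trans (le_abs_self _))
  have hzr : ∀ x, β ≤ x → b x = 0 := fun x hx => b.zero_of_le_dist (by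
    rw [Real.dist_eq]
    have : ρ ≤ x - R' / 2 := by simp only [β] at hx; linarith
    exact this.trans (le_abs_self _))
  have hM0 : 0 ≤ ∫ u in α..β, b u := intervalIntegral.integral_nonneg hαβ fun u _ => b.nonneg
  have hM1 : ∫ u in α..β, b u ≤ R' := by
    calc ∫ u in α..β, b u ≤ ∫ u in α..β, (1 : ℝ) :=
          intervalIntegral.integral_mono_on hαβ (hbi _ _) (by simp) fun u _ => b.le_one
      _ = 2 * ρ := by simp [α, β]; ring
      _ ≤ R' := by linarith
  refine ⟨α, β, ∫ u in α..β, b u, fun x => ∫ u in α..x, b u, b, by simp only [α]; linarith,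
    by simp only [β]; linarith, by rw [abs_of_nonneg hM0]; exact hM1, fun x =>
    (b.continuous.integral_hasStrictDerivAt α x).hasDerivAt,
    b.hasCompactSupport.uniformContinuous_of_continuous b.continuous, fun x => b.nonneg,
    fun x => by rw [abs_of_nonneg b.nonneg]; exact b.le_one, fun x hx => ?_, fun x hx => ?_,
    fun x hx => ?_⟩
  · refine b.one_of_mem_closedBall ?_
    rw [Metric.mem_closedBall, Real.dist_eq, abs_le]
    change -(max (max (R' / 2 - s) (t - R' / 2)) (R' / 4)) ≤ _ ∧
      _ ≤ max (max (R' / 2 - s) (t - R' / 2)) (R' / 4)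
    constructor <;> linarith [hx.1, hx.2]
  · change ∫ u in α..x, b u = 0
    rw [intervalIntegral.integral_congr (g := fun _ => (0 : ℝ)) fun u hu => ?_]
    · simp
    · rw [uIcc_of_ge hx] at hu
      exact hzl u hu.2
  · change ∫ u in α..x, b u = _
    rw [← intervalIntegral.integral_add_adjacent_intervals (hbi α β) (hbi β x),
      intervalIntegral.integral_congr (a := β) (b := x) (g := fun _ => (0 : ℝ)) fun u hu => ?_]
    · simp
    · rw [uIcc_of_le hx] at hu
      exact hzr u hu.1

theorem setLIntegral_le_of_forall_periodRect {R c : ℝ} (hR : 0 < R) {k : ℂ → ℝ≥0∞} {B : ℝ≥0∞}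
    (h : ∀ a b, 0 < a → a ≤ b → b < R → ∫⁻ z in periodRect a b c, k z ≤ B) :
    ∫⁻ z in Ioo 0 R ×ℂ Icc c (c + 2 * Real.pi), k z ≤ B := by
  set a : ℕ → ℝ := fun n => R / 2 / (n + 1) with ha
  have ha0 : ∀ n, 0 < a n := fun n => by positivity
  have ha1 : ∀ n, a n ≤ R / 2 := fun n => by
    rw [ha]; exact div_le_self (by linarith) (by linarith [(Nat.cast_nonneg n : (0 : ℝ) ≤ n)])
  have hanti : Antitone a := fun i j hij => by
    simp only [ha]; gcongr
  have hlim : Tendsto a atTop (𝓝 0) := by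
    have := (tendsto_one_div_add_atTop_nhds_zero_nat (𝕜 := ℝ)).const_mul (R / 2)
    simpa [ha, div_eq_mul_inv] using this
  have hmono : Monotone fun n => periodRect (a n) (R - a n) c := fun i j hij z hz =>
    ⟨⟨(hanti hij).trans hz.1.1, hz.1.2.trans (by linarith [hanti hij])⟩, hz.2⟩
  have hun : Ioo 0 R ×ℂ Icc c (c + 2 * Real.pi) ⊆ ⋃ n, periodRect (a n) (R - a n) c := by
    intro z hz
    have h1 : 0 < z.re := hz.1.1
    have h2 : z.re < R := hz.1.2
    obtain ⟨n, hn1, hn2⟩ := ((hlim.eventually_lt_const h1).and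
      (hlim.eventually_lt_const (sub_pos.2 h2))).exists
    exact mem_iUnion.2 ⟨n, ⟨hn1.le, by change z.re ≤ _; linarith⟩, hz.2⟩
  have hms : ∀ n, MeasurableSet (periodRect (a n) (R - a n) c) := fun n =>
    measurableSet_periodRect _ _ _
  calc ∫⁻ z in Ioo 0 R ×ℂ Icc c (c + 2 * Real.pi), k z
      ≤ ∫⁻ z in ⋃ n, periodRect (a n) (R - a n) c, k z := lintegral_mono_set hun
    _ = (volume.withDensity k) (⋃ n, periodRect (a n) (R - a n) c) :=
        (withDensity_apply _ (MeasurableSet.iUnion hms)).symm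
    _ = ⨆ n, (volume.withDensity k) (periodRect (a n) (R - a n) c) := hmono.measure_iUnion
    _ ≤ B := iSup_le fun n => by
        rw [withDensity_apply _ (hms n)]
        exact h _ _ (ha0 n) (by linarith [ha1 n]) (by linarith [ha0 n])

/-- On a closed substrip `Re F` ranges over a compact part of `(0, R')`, where a cut-off can equal
1. There the energy is at most `2K` times the cut-off Jacobian integral, which is `M m · 2π ≤ 2πR'`.
The bound is uniform, so exhausting the strip gives the claim. -/
theorem energy_le {R R' K : ℝ} {F G gx gy : ℂ → ℂ} {m : ℤ} (hR : 0 < R) (hK : 1 ≤ K)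
    (h : IsStripHomeo R R' F G m) (hends : PreservesEnds R R' F)
    (hsob : IsStripSobolev R F gx gy m) (hgx : Measurable gx) (hgy : Measurable gy)
    (hJ : ∀ᵐ z ∂(volume.restrict (vertStrip 0 R)),
      ‖gx z‖ ^ 2 + ‖gy z‖ ^ 2 ≤ 2 * K * jac (gx z) (gy z)) (c : ℝ) :
    ∫⁻ z in Ioo 0 R ×ℂ Icc c (c + 2 * Real.pi), (‖gx z‖ₑ ^ 2 + ‖gy z‖ₑ ^ 2)
      ≤ ENNReal.ofReal (4 * Real.pi * K * R') := by
  refine setLIntegral_le_of_forall_periodRect hR fun a₀ b₀ ha₀ hab₀ hb₀ => ?_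
  obtain ⟨s, t, hs, ht, hst⟩ := h.exists_re_bounds ha₀ hab₀ hb₀
  have hst' : s ≤ t := by
    have := hst a₀ le_rfl hab₀
    exact this.1.trans this.2
  obtain ⟨α, β, M, Φ, φ, hα0, hβR, hM, hΦ, hφ, hφ0, hφ1, hφst, hΦα, hΦβ⟩ :=
    exists_cutoff hs hst' ht
  obtain ⟨δ, hδ, hδF⟩ := hends.left (α / 2) (by linarith)
  obtain ⟨d, hd, hdF⟩ := hends.right ((β + R') / 2) (by linarith)
  -- The rectangle is widened until its vertical sides are mapped beyond the support of the cut-off;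
  -- the integrand is nonnegative, so this only enlarges the integral.
  set a := min a₀ (δ / 2)
  set b := max b₀ ((d + R) / 2)
  have ha : 0 < a := lt_min ha₀ (by linarith)
  have hb : b < R := max_lt hb₀ (by linarith)
  have haa : a ≤ a₀ := min_le_left _ _
  have hbb : b₀ ≤ b := le_max_left _ _
  have haδ : a < δ := (min_le_right _ _).trans_lt (by linarith)
  have hbd : d < b := lt_of_lt_of_le (by linarith) (le_max_right b₀ ((d + R) / 2))
  obtain ⟨hint, heq⟩ := hsob.integral_comp_re_mul_jac (c := c) h.continuousOn hgx hgy ha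
    (haa.trans (hab₀.trans hbb)) hb hΦ hφ hφ1 hΦα hΦβ (α' := α / 2) (β' := (β + R') / 2)
    (by linarith) (by linarith)
    (fun z hz => (hδF z ⟨by rw [hz]; exact ha, by rw [hz]; linarith⟩ (by rw [hz]; exact haδ)).le)
    (fun z hz => (hdF z ⟨by rw [hz]; linarith, by rw [hz]; exact hb⟩ (by rw [hz]; exact hbd)).le)
  have hsubQ : periodRect a₀ b₀ c ⊆ periodRect a b c := fun z hz =>
    ⟨⟨haa.trans hz.1.1, hz.1.2.trans hbb⟩, hz.2⟩
  have hJQ : ∀ᵐ z ∂(volume.restrict (periodRect a b c)),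
      ‖gx z‖ ^ 2 + ‖gy z‖ ^ 2 ≤ 2 * K * jac (gx z) (gy z) :=
    ae_restrict_of_ae_restrict_of_subset (periodRect_subset_vertStrip ha hb) hJ
  have hpos : ∀ᵐ z ∂(volume.restrict (periodRect a b c)), 0 ≤ φ (F z).re * jac (gx z) (gy z) := by
    filter_upwards [hJQ] with z hz
    refine mul_nonneg (hφ0 _) ?_
    have : 0 ≤ 2 * K * jac (gx z) (gy z) := le_trans (by positivity) hz
    exact nonneg_of_mul_nonneg_right this (by linarith)
  calc ∫⁻ z in periodRect a₀ b₀ c, (‖gx z‖ₑ ^ 2 + ‖gy z‖ₑ ^ 2)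
      ≤ ∫⁻ z in periodRect a₀ b₀ c, ENNReal.ofReal (2 * K) *
          ENNReal.ofReal (φ (F z).re * jac (gx z) (gy z)) := by
        refine lintegral_mono_ae ?_
        filter_upwards [ae_restrict_of_ae_restrict_of_subset hsubQ hJQ,
          ae_restrict_mem (measurableSet_periodRect a₀ b₀ c)] with z hz hzQ
        have := hst z hzQ.1.1 hzQ.1.2
        rw [hφst _ ⟨this.1, this.2⟩, one_mul, ← ENNReal.ofReal_mul (by linarith), ← ofReal_norm,
          ← ofReal_norm, ← ENNReal.ofReal_pow (norm_nonneg _), ← ENNReal.ofReal_pow (norm_nonneg _),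
          ← ENNReal.ofReal_add (by positivity) (by positivity)]
        exact ENNReal.ofReal_le_ofReal hz
    _ = ENNReal.ofReal (2 * K) * ∫⁻ z in periodRect a₀ b₀ c,
          ENNReal.ofReal (φ (F z).re * jac (gx z) (gy z)) :=
        lintegral_const_mul' _ _ ENNReal.ofReal_ne_top
    _ ≤ ENNReal.ofReal (2 * K) * ∫⁻ z in periodRect a b c,
          ENNReal.ofReal (φ (F z).re * jac (gx z) (gy z)) := by
        gcongr
    _ = ENNReal.ofReal (2 * K * (M * (m * (2 * Real.pi)))) := by
        rw [← ofReal_integral_eq_lintegral_ofReal hint hpos, heq, ENNReal.ofReal_mul (p := 2 * K)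
          (by linarith)]
    _ ≤ ENNReal.ofReal (4 * Real.pi * K * R') := by
        refine ENNReal.ofReal_le_ofReal ?_
        have hMm : M * m ≤ R' := by
          have := abs_le.1 hM
          rcases h.sq_degree with h1 | h1 <;> rw [h1] <;> push_cast <;> linarith [this.1, this.2]
        have hp := Real.pi_pos
        calc 2 * K * (M * (m * (2 * Real.pi))) = 4 * Real.pi * K * (M * m) := by ring
          _ ≤ _ := by gcongr

/-! ### Absolute continuity on almost every line -/

theorem setLIntegral_reProdIm {s t : Set ℝ} {k : ℂ → ℝ≥0∞} (hk : Measurable k) :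
    ∫⁻ z in s ×ℂ t, k z = ∫⁻ x in s, ∫⁻ y in t, k ⟨x, y⟩ := by
  rw [← Complex.volume_preserving_equiv_real_prod.symm.setLIntegral_comp_preimage_emb
    Complex.measurableEquivRealProd.symm.measurableEmbedding]
  have hset : Complex.measurableEquivRealProd.symm ⁻¹' (s ×ℂ t) = s ×ˢ t := rfl
  rw [hset, Measure.volume_eq_prod, ← Measure.prod_restrict, lintegral_prod]
  · rfl
  · exact (hk.comp Complex.measurableEquivRealProd.symm.measurable).aemeasurable

theorem measurable_complex_mk : Measurable fun p : ℝ × ℝ => (⟨p.1, p.2⟩ : ℂ) :=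
  Complex.measurableEquivRealProd.symm.measurable

theorem setLIntegral_swap {s t : Set ℝ} {k : ℂ → ℝ≥0∞} (hk : Measurable k) :
    ∫⁻ x in s, ∫⁻ y in t, k ⟨x, y⟩ = ∫⁻ y in t, ∫⁻ x in s, k ⟨x, y⟩ :=
  lintegral_lintegral_swap (hk.comp measurable_complex_mk).aemeasurable

/-- Fatou's lemma. A vanishing lower limit is all that is needed later, so no subsequence has to be
extracted. -/
theorem ae_liminf_lintegral_eq_zero {α : Type*} [MeasurableSpace α] {μ : Measure α}
    {k : ℕ → α → ℝ≥0∞} (hk : ∀ n, Measurable (k n))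
    (h : Tendsto (fun n => ∫⁻ y, k n y ∂μ) atTop (𝓝 0)) :
    ∀ᵐ y ∂μ, liminf (fun n => k n y) atTop = 0 := by
  have h1 : ∫⁻ y, liminf (fun n => k n y) atTop ∂μ = 0 := by
    refine le_antisymm ((lintegral_liminf_le hk).trans ?_) (zero_le)
    rw [h.liminf_eq]
  exact (lintegral_eq_zero_iff (Measurable.liminf hk)).1 h1

/-- The fundamental theorem of calculus bounds the increment of `u n` by the integral of `‖g‖` plus
an error that is small for infinitely many `n`, while the increments themselves converge. -/
theorem enorm_sub_le_lintegral_of_approx {u u' : ℕ → ℝ → ℂ} {w g : ℝ → ℂ} {a b : ℝ}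
    (hg : Measurable g) (hd : ∀ n, ∀ t ∈ Icc a b, HasDerivAt (u n) (u' n t) t)
    (hc : ∀ n, ContinuousOn (u' n) (Icc a b))
    (hlim : ∀ t ∈ Icc a b, Tendsto (fun n => u n t) atTop (𝓝 (w t)))
    (hD : liminf (fun n => ∫⁻ t in Icc a b, ‖u' n t - g t‖ₑ) atTop = 0) {t₁ t₂ : ℝ} (h₁ : a ≤ t₁)
    (h₁₂ : t₁ ≤ t₂) (h₂ : t₂ ≤ b) : ‖w t₂ - w t₁‖ₑ ≤ ∫⁻ t in Icc t₁ t₂, ‖g t‖ₑ := by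
  have hsub : Icc t₁ t₂ ⊆ Icc a b := Icc_subset_Icc h₁ h₂
  have hn : ∀ n, ‖u n t₂ - u n t₁‖ₑ ≤ (∫⁻ t in Icc t₁ t₂, ‖g t‖ₑ)
      + ∫⁻ t in Icc a b, ‖u' n t - g t‖ₑ := by
    intro n
    rw [← intervalIntegral.integral_eq_sub_of_hasDerivAt (f := u n) (f' := u' n) (fun t ht => hd n t
      (hsub (by rwa [uIcc_of_le h₁₂] at ht)))
      (ContinuousOn.intervalIntegrable (by rw [uIcc_of_le h₁₂]; exact (hc n).mono hsub)),
      intervalIntegral.integral_of_le h₁₂]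
    calc _ ≤ ∫⁻ t in Ioc t₁ t₂, ‖u' n t‖ₑ := enorm_integral_le_lintegral_enorm _
      _ ≤ ∫⁻ t in Icc t₁ t₂, ‖u' n t‖ₑ := lintegral_mono_set Ioc_subset_Icc_self
      _ ≤ ∫⁻ t in Icc t₁ t₂, (‖g t‖ₑ + ‖u' n t - g t‖ₑ) := lintegral_mono fun t => by
          calc ‖u' n t‖ₑ = ‖g t + (u' n t - g t)‖ₑ := by rw [add_sub_cancel]
            _ ≤ _ := enorm_add_le _ _
      _ = _ := lintegral_add_left hg.enorm _
      _ ≤ _ := by gcongr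
  refine _root_.le_of_forall_pos_le_add fun ε hε => ?_
  have hfreq : ∃ᶠ n in atTop, ∫⁻ t in Icc a b, ‖u' n t - g t‖ₑ < ε :=
    frequently_lt_of_liminf_lt (by isBoundedDefault) (by rw [hD]; exact hε)
  have ht : Tendsto (fun n => ‖u n t₂ - u n t₁‖ₑ) atTop (𝓝 ‖w t₂ - w t₁‖ₑ) :=
    ((hlim t₂ ⟨h₁.trans h₁₂, h₂⟩).sub (hlim t₁ ⟨h₁, h₁₂.trans h₂⟩)).enorm
  exact le_of_tendsto_of_frequently ht (hfreq.mono fun n hlt => (hn n).trans (by gcongr))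

/-- On each rectangle with rational data, `L²` convergence implies `L¹` convergence, and Fubini
provides almost every line. Countably many such rectangles give one null set that serves all
segments. -/
theorem IsStripSobolev.ae_horizontal {R : ℝ} {F gx gy : ℂ → ℂ} {m : ℤ}
    (h : IsStripSobolev R F gx gy m) (hgx : Measurable gx) :
    ∀ᵐ y : ℝ, ∀ x₁ x₂ : ℝ, 0 < x₁ → x₁ ≤ x₂ → x₂ < R →
      ‖F ⟨x₂, y⟩ - F ⟨x₁, y⟩‖ₑ ≤ ∫⁻ x in Icc x₁ x₂, ‖gx ⟨x, y⟩‖ₑ := by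
  have key : ∀ a b c : ℚ, 0 < (a : ℝ) → (a : ℝ) ≤ b → (b : ℝ) < R →
      ∀ᵐ y : ℝ, y ∈ Icc (c : ℝ) (c + 2 * Real.pi) → ∀ x₁ x₂ : ℝ, a ≤ x₁ → x₁ ≤ x₂ → x₂ ≤ b →
      ‖F ⟨x₂, y⟩ - F ⟨x₁, y⟩‖ₑ ≤ ∫⁻ x in Icc x₁ x₂, ‖gx ⟨x, y⟩‖ₑ := by
    intro a b c ha hab hb
    rw [← ae_restrict_iff' measurableSet_Icc]
    obtain ⟨a₀, b₀, f, ha₀, haa₀, hbb₀, hb₀, hf, -, hfu, hx, -⟩ := h.exists_approx ha hab hb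
    have hXm : ∀ n, Measurable fun z => ‖fderiv ℝ (f n) z 1 - gx z‖ₑ := fun n =>
      ((measurable_fderiv_apply_const ℝ (f n) 1).sub hgx).enorm
    have h1 : Tendsto (fun n => ∫⁻ z in periodRect a b c, ‖fderiv ℝ (f n) z 1 - gx z‖ₑ) atTop (𝓝 0) := by
      have := tendsto_lintegral_mul_zero (volume.restrict (periodRect a b c)) (k := fun _ _ => 1)
        (B := volume (periodRect a b c))
        (l := fun n z => ‖fderiv ℝ (f n) z 1 - gx z‖ₑ)
        (isCompact_periodRect a b c).measure_lt_top.ne (fun _ => aemeasurable_const)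
        (fun n => (hXm n).aemeasurable) (Eventually.of_forall fun n => by simp) (hx c)
      simpa using this
    have h2 : ∀ n, ∫⁻ z in periodRect a b c, ‖fderiv ℝ (f n) z 1 - gx z‖ₑ
        = ∫⁻ y in Icc (c : ℝ) (c + 2 * Real.pi), ∫⁻ x in Icc (a : ℝ) b,
          ‖fderiv ℝ (f n) ⟨x, y⟩ 1 - gx ⟨x, y⟩‖ₑ := fun n => by
      rw [periodRect, setLIntegral_reProdIm (hXm n),
        setLIntegral_swap (hXm n)]
    simp only [h2] at h1
    have h3 := ae_liminf_lintegral_eq_zero (fun n =>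
      ((hXm n).comp measurable_complex_mk).lintegral_prod_left') h1
    filter_upwards [h3] with y hy x₁ x₂ hx₁ hx₁₂ hx₂
    have hmem : ∀ x ∈ Icc (a : ℝ) b, (⟨x, y⟩ : ℂ) ∈ vertStrip a₀ b₀ := fun x hx =>
      ⟨haa₀.trans_le hx.1, hx.2.trans_lt hbb₀⟩
    have hmk : ∀ x : ℝ, HasDerivAt (fun x : ℝ => (⟨x, y⟩ : ℂ)) 1 x := fun x => by
      have : HasDerivAt (fun x : ℝ => (x : ℂ) + y * Complex.I) 1 x :=
        (HasDerivAt.ofReal_comp (hasDerivAt_id x)).add_const _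
      refine this.congr_of_eventuallyEq (Eventually.of_forall fun x => ?_)
      exact Complex.mk_eq_add_mul_I x y
    refine enorm_sub_le_lintegral_of_approx (u := fun n x => f n ⟨x, y⟩)
      (u' := fun n x => fderiv ℝ (f n) ⟨x, y⟩ 1) (w := fun x => F ⟨x, y⟩) (g := fun x => gx ⟨x, y⟩)
      (hgx.comp (measurable_complex_mk.comp (measurable_id.prodMk measurable_const)))
      (fun n x hx => ?_) (fun n => ?_) (fun x hx => ?_) hy hx₁ hx₁₂ hx₂
    · have hfd : HasFDerivAt (f n) (fderiv ℝ (f n) ⟨x, y⟩) ⟨x, y⟩ :=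
        (((hf n).contDiffAt ((isOpen_vertStrip _ _).mem_nhds (hmem x hx))).differentiableAt
          (by simp)).hasFDerivAt
      exact hfd.comp_hasDerivAt x (hmk x)
    · have := ((hf n).continuousOn_fderiv_of_isOpen (isOpen_vertStrip _ _) (by simp)).clm_apply
        (continuousOn_const (c := (1 : ℂ)))
      exact this.comp (fun x _ => (hmk x).continuousAt.continuousWithinAt) hmem
    · exact hfu.tendsto_at (hmem x hx)
  have hall : ∀ᵐ y : ℝ, ∀ a b c : ℚ, 0 < (a : ℝ) → (a : ℝ) ≤ b → (b : ℝ) < R →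
      y ∈ Icc (c : ℝ) (c + 2 * Real.pi) → ∀ x₁ x₂ : ℝ, a ≤ x₁ → x₁ ≤ x₂ → x₂ ≤ b →
      ‖F ⟨x₂, y⟩ - F ⟨x₁, y⟩‖ₑ ≤ ∫⁻ x in Icc x₁ x₂, ‖gx ⟨x, y⟩‖ₑ := by
    simp only [ae_all_iff, eventually_imp_distrib_left] at *
    exact key
  filter_upwards [hall] with y hy x₁ x₂ h₁ h₁₂ h₂
  obtain ⟨a, ha0, ha⟩ := exists_rat_btwn h₁
  obtain ⟨b, hb, hbR⟩ := exists_rat_btwn h₂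
  obtain ⟨c, hc1, hc2⟩ := exists_rat_btwn (show y - 2 * Real.pi < y by linarith [Real.pi_pos])
  exact hy a b c ha0 (by linarith) hbR ⟨hc2.le, by linarith⟩ x₁ x₂ ha.le h₁₂ hb.le

theorem IsStripSobolev.ae_vertical {R : ℝ} {F gx gy : ℂ → ℂ} {m : ℤ}
    (h : IsStripSobolev R F gx gy m) (hgy : Measurable gy) :
    ∀ᵐ x : ℝ, 0 < x → x < R → ∀ y₁ y₂ : ℝ, y₁ ≤ y₂ → y₂ - y₁ < 2 * Real.pi →
      ‖F ⟨x, y₂⟩ - F ⟨x, y₁⟩‖ₑ ≤ ∫⁻ y in Icc y₁ y₂, ‖gy ⟨x, y⟩‖ₑ := by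
  have key : ∀ a b c : ℚ, 0 < (a : ℝ) → (a : ℝ) ≤ b → (b : ℝ) < R →
      ∀ᵐ x : ℝ, x ∈ Icc (a : ℝ) b → ∀ y₁ y₂ : ℝ, c ≤ y₁ → y₁ ≤ y₂ → y₂ ≤ c + 2 * Real.pi →
      ‖F ⟨x, y₂⟩ - F ⟨x, y₁⟩‖ₑ ≤ ∫⁻ y in Icc y₁ y₂, ‖gy ⟨x, y⟩‖ₑ := by
    intro a b c ha hab hb
    rw [← ae_restrict_iff' measurableSet_Icc]
    obtain ⟨a₀, b₀, f, ha₀, haa₀, hbb₀, hb₀, hf, -, hfu, -, hy⟩ := h.exists_approx ha hab hb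
    have hYm : ∀ n, Measurable fun z => ‖fderiv ℝ (f n) z Complex.I - gy z‖ₑ := fun n =>
      ((measurable_fderiv_apply_const ℝ (f n) Complex.I).sub hgy).enorm
    have h1 : Tendsto (fun n => ∫⁻ z in periodRect a b c, ‖fderiv ℝ (f n) z Complex.I - gy z‖ₑ)
        atTop (𝓝 0) := by
      have := tendsto_lintegral_mul_zero (volume.restrict (periodRect a b c)) (k := fun _ _ => 1)
        (B := volume (periodRect a b c))
        (l := fun n z => ‖fderiv ℝ (f n) z Complex.I - gy z‖ₑ)
        (isCompact_periodRect a b c).measure_lt_top.ne (fun _ => aemeasurable_const)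
        (fun n => (hYm n).aemeasurable) (Eventually.of_forall fun n => by simp) (hy c)
      simpa using this
    simp only [periodRect, setLIntegral_reProdIm (hYm _)] at h1
    have h3 := ae_liminf_lintegral_eq_zero (fun n =>
      ((hYm n).comp measurable_complex_mk).lintegral_prod_right') h1
    filter_upwards [h3, ae_restrict_mem measurableSet_Icc] with x hx hxab y₁ y₂ hy₁ hy₁₂ hy₂
    have hmem : ∀ y : ℝ, (⟨x, y⟩ : ℂ) ∈ vertStrip a₀ b₀ := fun y =>
      ⟨haa₀.trans_le hxab.1, hxab.2.trans_lt hbb₀⟩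
    have hmk : ∀ y : ℝ, HasDerivAt (fun y : ℝ => (⟨x, y⟩ : ℂ)) Complex.I y := fun y => by
      have : HasDerivAt (fun y : ℝ => (x : ℂ) + y * Complex.I) (1 * Complex.I) y :=
        ((HasDerivAt.ofReal_comp (hasDerivAt_id y)).mul_const _).const_add _
      rw [one_mul] at this
      refine this.congr_of_eventuallyEq (Eventually.of_forall fun y => ?_)
      exact Complex.mk_eq_add_mul_I x y
    refine enorm_sub_le_lintegral_of_approx (u := fun n y => f n ⟨x, y⟩)
      (u' := fun n y => fderiv ℝ (f n) ⟨x, y⟩ Complex.I) (w := fun y => F ⟨x, y⟩)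
      (g := fun y => gy ⟨x, y⟩)
      (hgy.comp (measurable_complex_mk.comp (measurable_const.prodMk measurable_id)))
      (fun n y _ => ?_) (fun n => ?_) (fun y _ => ?_) hx hy₁ hy₁₂ hy₂
    · have hfd : HasFDerivAt (f n) (fderiv ℝ (f n) ⟨x, y⟩) ⟨x, y⟩ :=
        (((hf n).contDiffAt ((isOpen_vertStrip _ _).mem_nhds (hmem y))).differentiableAt
          (by simp)).hasFDerivAt
      exact hfd.comp_hasDerivAt y (hmk y)
    · have := ((hf n).continuousOn_fderiv_of_isOpen (isOpen_vertStrip _ _) (by simp)).clm_apply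
        (continuousOn_const (c := Complex.I))
      exact this.comp (fun y _ => (hmk y).continuousAt.continuousWithinAt) fun y _ => hmem y
    · exact hfu.tendsto_at (hmem y)
  have hall : ∀ᵐ x : ℝ, ∀ a b c : ℚ, 0 < (a : ℝ) → (a : ℝ) ≤ b → (b : ℝ) < R →
      x ∈ Icc (a : ℝ) b → ∀ y₁ y₂ : ℝ, c ≤ y₁ → y₁ ≤ y₂ → y₂ ≤ c + 2 * Real.pi →
      ‖F ⟨x, y₂⟩ - F ⟨x, y₁⟩‖ₑ ≤ ∫⁻ y in Icc y₁ y₂, ‖gy ⟨x, y⟩‖ₑ := by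
    simp only [ae_all_iff, eventually_imp_distrib_left] at *
    exact key
  filter_upwards [hall] with x hx hx0 hxR y₁ y₂ h₁₂ hlt
  obtain ⟨a, ha0, ha⟩ := exists_rat_btwn hx0
  obtain ⟨b, hb, hbR⟩ := exists_rat_btwn hxR
  -- The strict bound `y₂ - y₁ < 2π` leaves room for a rational `c` with both points in `[c, c +
  -- 2π]`.
  obtain ⟨c, hc1, hc2⟩ := exists_rat_btwn (show y₂ - 2 * Real.pi < y₁ by linarith)
  exact hx a b c ha0 (by linarith) hbR ⟨ha.le, hb.le⟩ y₁ y₂ hc2.le h₁₂ (by linarith)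

/-! ### The length-area argument and crosscuts -/

/-- A homeomorphism `F` of strips, with inverse `G`, which is absolutely continuous on almost all
horizontal and vertical segments, with partial derivatives `gx` and `gy` of energy at most `E` on
each period. -/
structure IsFiniteEnergyStripMap (R R' E : ℝ) (F G gx gy : ℂ → ℂ) : Prop where
  homeo : ∃ m, IsStripHomeo R R' F G m
  ends : PreservesEnds R R' F
  ends_inv : PreservesEnds R' R G
  measurable_x : Measurable gx
  measurable_y : Measurable gy
  horizontal : ∀ᵐ y : ℝ, ∀ x₁ x₂ : ℝ, 0 < x₁ → x₁ ≤ x₂ → x₂ < R →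
    ‖F ⟨x₂, y⟩ - F ⟨x₁, y⟩‖ₑ ≤ ∫⁻ x in Icc x₁ x₂, ‖gx ⟨x, y⟩‖ₑ
  vertical : ∀ᵐ x : ℝ, 0 < x → x < R → ∀ y₁ y₂ : ℝ, y₁ ≤ y₂ → y₂ - y₁ < 2 * Real.pi →
    ‖F ⟨x, y₂⟩ - F ⟨x, y₁⟩‖ₑ ≤ ∫⁻ y in Icc y₁ y₂, ‖gy ⟨x, y⟩‖ₑ
  energy_x : ∀ c : ℝ, ∫⁻ y in Icc c (c + 2 * Real.pi), ∫⁻ x in Ioo 0 R, ‖gx ⟨x, y⟩‖ₑ ^ 2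
    ≤ ENNReal.ofReal E
  energy_y : ∀ c : ℝ, ∫⁻ x in Ioo 0 R, ∫⁻ y in Icc c (c + 2 * Real.pi), ‖gy ⟨x, y⟩‖ₑ ^ 2
    ≤ ENNReal.ofReal E

theorem ofReal_mul_setLIntegral_comp_affine_le {k : ℝ → ℝ≥0∞} {s t : Set ℝ} (hs : MeasurableSet s)
    {a b : ℝ} (ha : a ≠ 0) (hst : ∀ x ∈ s, a * x + b ∈ t) :
    ENNReal.ofReal |a| * ∫⁻ x in s, k (a * x + b) ≤ ∫⁻ y in t, k y := by
  rw [← lintegral_const_mul' _ _ ENNReal.ofReal_ne_top]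
  have hd : ∀ x ∈ s, HasDerivWithinAt (fun x : ℝ => a * x + b) a s x := fun x _ => by
    have := ((hasDerivAt_id x).const_mul a).add_const b
    rw [mul_one] at this
    exact this.hasDerivWithinAt
  have hinj : InjOn (fun x : ℝ => a * x + b) s := fun x _ y _ h =>
    mul_left_cancel₀ ha (add_right_cancel h)
  rw [← lintegral_image_eq_lintegral_abs_deriv_mul hs hd hinj k]
  exact lintegral_mono_set (by rintro _ ⟨x, hx, rfl⟩; exact hst x hx)

theorem ae_comp_affine {p : ℝ → Prop} (h : ∀ᵐ y, p y) {a : ℝ} (ha : a ≠ 0) (b : ℝ) :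
    ∀ᵐ x, p (a * x + b) := by
  have h1 : ∀ᵐ x : ℝ, p (x + b) := by
    rw [ae_iff] at *
    exact (measure_preimage_add_right volume b _).trans h
  rw [ae_iff] at *
  have := Real.volume_preimage_mul_left ha {x | ¬p (x + b)}
  rw [h1, mul_zero] at this
  exact this

namespace IsFiniteEnergyStripMap

variable {R R' E : ℝ} {F G gx gy : ℂ → ℂ}

theorem measurable_slice_x (h : IsFiniteEnergyStripMap R R' E F G gx gy) (y : ℝ) :
    Measurable fun x : ℝ => ‖gx ⟨x, y⟩‖ₑ :=
  (h.measurable_x.comp (measurable_complex_mk.comp (measurable_id.prodMk measurable_const))).enorm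

theorem measurable_slice_y (h : IsFiniteEnergyStripMap R R' E F G gx gy) (x : ℝ) :
    Measurable fun y : ℝ => ‖gy ⟨x, y⟩‖ₑ :=
  (h.measurable_y.comp (measurable_complex_mk.comp (measurable_const.prodMk measurable_id))).enorm

/-- Length-area method. The image of the crosscut at scale `s` has length controlled by the
integrals of `‖gx‖` and `‖gy‖` along its sides, each of length proportional to `s`. Cauchy-Schwarz
bounds the squared length by `4 s w(s)`, where `w` has integral at most `(2R + 2π/R) E`. Lengths
above `ε` at almost every scale would force `ε² log (1/σ) ≤ 4 (2R + 2π/R) E`. -/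
theorem exists_small_crosscut (h : IsFiniteEnergyStripMap R R' E F G gx gy) (hR : 0 < R)
    (hE : 0 ≤ E) {σ ε : ℝ} (hσ : 0 < σ) (hσ1 : σ < 1) (hε : 0 < ε)
    (hlog : 4 * ((2 * R + 2 * Real.pi / R) * E) < ε ^ 2 * Real.log (1 / σ)) (y₀ : ℝ) :
    ∃ s ∈ Ioo σ 1, ∃ p : ℂ, ∀ z ∈ vertStrip 0 R,
      ((z.re = R * s ∧ |z.im - y₀| ≤ Real.pi * s) ∨ (|z.im - y₀| = Real.pi * s ∧ z.re ≤ R * s)) →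
      ‖F z - p‖ ≤ ε := by
  have hp := Real.pi_gt_three
  set e : ℝ → ℝ≥0∞ := fun y => ∫⁻ x in Ioo 0 R, ‖gx ⟨x, y⟩‖ₑ ^ 2 with he
  set k : ℝ → ℝ≥0∞ := fun x => ∫⁻ y in Icc (y₀ - Real.pi) (y₀ - Real.pi + 2 * Real.pi),
    ‖gy ⟨x, y⟩‖ₑ ^ 2 with hk
  have hem : Measurable e :=
    ((h.measurable_x.comp measurable_complex_mk).enorm.pow_const 2).lintegral_prod_left'
  have hkm : Measurable k :=
    ((h.measurable_y.comp measurable_complex_mk).enorm.pow_const 2).lintegral_prod_right'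
  -- The weights `R` and `2π` are the side lengths at scale 1; `R * s + 0` is written as an affine
  -- map in the form used by the change of variables.
  set w : ℝ → ℝ≥0∞ := fun s => ENNReal.ofReal R * (e (-Real.pi * s + y₀) + e (Real.pi * s + y₀))
    + ENNReal.ofReal (2 * Real.pi) * k (R * s + 0) with hw
  -- The substitution `y = ±πs + y₀` gains a factor `1/π`, which is simply dropped.
  have hpi1 : (1 : ℝ≥0∞) ≤ ENNReal.ofReal Real.pi := ENNReal.one_le_ofReal.2 (by linarith)
  have hint_w : ∫⁻ s in Ioo σ 1, w s ≤ ENNReal.ofReal ((2 * R + 2 * Real.pi / R) * E) := by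
    have h1 : ∫⁻ s in Ioo σ 1, e (Real.pi * s + y₀) ≤ ENNReal.ofReal E := by
      refine (le_mul_of_one_le_left' hpi1).trans ?_
      have := ofReal_mul_setLIntegral_comp_affine_le (k := e) (s := Ioo σ 1) (a := Real.pi) (b := y₀)
        (t := Icc y₀ (y₀ + 2 * Real.pi)) measurableSet_Ioo (by linarith) (fun x hx =>
          ⟨by nlinarith [hx.1, hx.2], by nlinarith [hx.1, hx.2]⟩)
      rw [abs_of_pos (by linarith)] at this
      exact this.trans (h.energy_x y₀)
    have h2 : ∫⁻ s in Ioo σ 1, e (-Real.pi * s + y₀) ≤ ENNReal.ofReal E := by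
      refine (le_mul_of_one_le_left' hpi1).trans ?_
      have := ofReal_mul_setLIntegral_comp_affine_le (k := e) (s := Ioo σ 1) (a := -Real.pi) (b := y₀)
        (t := Icc (y₀ - Real.pi) (y₀ - Real.pi + 2 * Real.pi)) measurableSet_Ioo (by linarith)
        (fun x hx => ⟨by nlinarith [hx.1, hx.2], by nlinarith [hx.1, hx.2]⟩)
      rw [abs_neg, abs_of_pos (by linarith)] at this
      exact this.trans (h.energy_x _)
    have h3 : ENNReal.ofReal R * ∫⁻ s in Ioo σ 1, k (R * s + 0) ≤ ENNReal.ofReal E := by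
      have := ofReal_mul_setLIntegral_comp_affine_le (k := k) (s := Ioo σ 1) (a := R) (b := 0)
        (t := Ioo 0 R) measurableSet_Ioo hR.ne'
        (fun x hx => ⟨by nlinarith [hx.1, hx.2], by nlinarith [hx.1, hx.2]⟩)
      rw [abs_of_pos hR] at this
      exact this.trans (h.energy_y _)
    have m1 : Measurable fun s => e (-Real.pi * s + y₀) := hem.comp (by fun_prop)
    have m2 : Measurable fun s => e (Real.pi * s + y₀) := hem.comp (by fun_prop)
    calc ∫⁻ s in Ioo σ 1, w s
        = ENNReal.ofReal R * ((∫⁻ s in Ioo σ 1, e (-Real.pi * s + y₀))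
          + ∫⁻ s in Ioo σ 1, e (Real.pi * s + y₀))
          + ENNReal.ofReal (2 * Real.pi) * ∫⁻ s in Ioo σ 1, k (R * s + 0) := by
          have m3 : Measurable fun s => ENNReal.ofReal R * (e (-Real.pi * s + y₀)
            + e (Real.pi * s + y₀)) := (m1.add m2).const_mul _
          simp only [hw]
          rw [lintegral_add_left m3, lintegral_const_mul' _ _
            ENNReal.ofReal_ne_top, lintegral_add_left m1, lintegral_const_mul' _ _
            ENNReal.ofReal_ne_top]
      _ = ENNReal.ofReal R * ((∫⁻ s in Ioo σ 1, e (-Real.pi * s + y₀))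
          + ∫⁻ s in Ioo σ 1, e (Real.pi * s + y₀))
          + ENNReal.ofReal (2 * Real.pi / R) *
            (ENNReal.ofReal R * ∫⁻ s in Ioo σ 1, k (R * s + 0)) := by
          rw [← mul_assoc (ENNReal.ofReal (2 * Real.pi / R)), ← ENNReal.ofReal_mul (by positivity),
            div_mul_cancel₀ _ hR.ne']
      _ ≤ ENNReal.ofReal R * (ENNReal.ofReal E + ENNReal.ofReal E)
          + ENNReal.ofReal (2 * Real.pi / R) * ENNReal.ofReal E := by gcongr
      _ = _ := by
          rw [← ENNReal.ofReal_add hE hE, ← ENNReal.ofReal_mul hR.le, ← ENNReal.ofReal_mul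
            (by positivity), ← ENNReal.ofReal_add (by positivity) (by positivity)]
          congr 1; ring
  set A : ℝ → ℝ → ℝ≥0∞ := fun y s => ∫⁻ x in Ioc 0 (R * s), ‖gx ⟨x, y⟩‖ₑ with hA
  set V : ℝ → ℝ≥0∞ := fun s => ∫⁻ y in Icc (y₀ - Real.pi * s) (y₀ + Real.pi * s),
    ‖gy ⟨R * s, y⟩‖ₑ with hV
  have hA2 : ∀ s ∈ Ioo σ 1, ∀ y, A y s ^ 2 ≤ ENNReal.ofReal s * (ENNReal.ofReal R * e y) := by
    intro s hs y
    refine (sq_lintegral_le _ (h.measurable_slice_x y).aemeasurable).trans ?_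
    rw [Measure.restrict_apply_univ, Real.volume_Ioc, sub_zero, mul_comm R,
      ENNReal.ofReal_mul (hσ.le.trans hs.1.le), mul_assoc]
    gcongr
    exact lintegral_mono_set fun x hx => ⟨hx.1, hx.2.trans_lt (by nlinarith [hs.2])⟩
  have hV2 : ∀ s ∈ Ioo σ 1, V s ^ 2 ≤
      ENNReal.ofReal s * (ENNReal.ofReal (2 * Real.pi) * k (R * s + 0)) := by
    intro s hs
    refine (sq_lintegral_le _ (h.measurable_slice_y _).aemeasurable).trans ?_
    rw [Measure.restrict_apply_univ, Real.volume_Icc, add_zero,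
      show y₀ + Real.pi * s - (y₀ - Real.pi * s) = s * (2 * Real.pi) by ring,
      ENNReal.ofReal_mul (hσ.le.trans hs.1.le), mul_assoc]
    gcongr
    exact lintegral_mono_set (Icc_subset_Icc (by nlinarith [hs.2]) (by nlinarith [hs.2]))
  have hae : ∀ᵐ s : ℝ, (∀ x₁ x₂ : ℝ, 0 < x₁ → x₁ ≤ x₂ → x₂ < R →
        ‖F ⟨x₂, -Real.pi * s + y₀⟩ - F ⟨x₁, -Real.pi * s + y₀⟩‖ₑ
          ≤ ∫⁻ x in Icc x₁ x₂, ‖gx ⟨x, -Real.pi * s + y₀⟩‖ₑ) ∧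
      (∀ x₁ x₂ : ℝ, 0 < x₁ → x₁ ≤ x₂ → x₂ < R →
        ‖F ⟨x₂, Real.pi * s + y₀⟩ - F ⟨x₁, Real.pi * s + y₀⟩‖ₑ
          ≤ ∫⁻ x in Icc x₁ x₂, ‖gx ⟨x, Real.pi * s + y₀⟩‖ₑ) ∧
      (0 < R * s + 0 → R * s + 0 < R → ∀ y₁ y₂ : ℝ, y₁ ≤ y₂ → y₂ - y₁ < 2 * Real.pi →
        ‖F ⟨R * s + 0, y₂⟩ - F ⟨R * s + 0, y₁⟩‖ₑ ≤ ∫⁻ y in Icc y₁ y₂, ‖gy ⟨R * s + 0, y⟩‖ₑ) :=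
    (ae_comp_affine h.horizontal (by linarith) y₀).and
      ((ae_comp_affine h.horizontal (by linarith) y₀).and (ae_comp_affine h.vertical hR.ne' 0))
  have hgood : ∃ s ∈ Ioo σ 1, ((∀ x₁ x₂ : ℝ, 0 < x₁ → x₁ ≤ x₂ → x₂ < R →
        ‖F ⟨x₂, -Real.pi * s + y₀⟩ - F ⟨x₁, -Real.pi * s + y₀⟩‖ₑ
          ≤ ∫⁻ x in Icc x₁ x₂, ‖gx ⟨x, -Real.pi * s + y₀⟩‖ₑ) ∧
      (∀ x₁ x₂ : ℝ, 0 < x₁ → x₁ ≤ x₂ → x₂ < R →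
        ‖F ⟨x₂, Real.pi * s + y₀⟩ - F ⟨x₁, Real.pi * s + y₀⟩‖ₑ
          ≤ ∫⁻ x in Icc x₁ x₂, ‖gx ⟨x, Real.pi * s + y₀⟩‖ₑ) ∧
      (0 < R * s + 0 → R * s + 0 < R → ∀ y₁ y₂ : ℝ, y₁ ≤ y₂ → y₂ - y₁ < 2 * Real.pi →
        ‖F ⟨R * s + 0, y₂⟩ - F ⟨R * s + 0, y₁⟩‖ₑ ≤ ∫⁻ y in Icc y₁ y₂, ‖gy ⟨R * s + 0, y⟩‖ₑ)) ∧
      A (-Real.pi * s + y₀) s + (A (Real.pi * s + y₀) s + V s) ≤ ENNReal.ofReal ε := by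
    -- Failure at every good scale gives `ε²/s ≤ 4 w(s)` almost everywhere on `(σ, 1)`, and
    -- integration contradicts `hlog`.
    by_contra! hcon
    have hpt : ∀ᵐ s ∂(volume.restrict (Ioo σ 1)), ENNReal.ofReal (ε ^ 2 * s⁻¹) ≤ 4 * w s := by
      rw [ae_restrict_iff' measurableSet_Ioo]
      filter_upwards [hae] with s hs hsσ
      have hlt := (hcon s hsσ hs).le
      have hs0 : 0 < s := hσ.trans hsσ.1
      have h1 : ENNReal.ofReal (ε ^ 2) ≤ ENNReal.ofReal s * (4 * w s) := by
        calc ENNReal.ofReal (ε ^ 2) = ENNReal.ofReal ε ^ 2 := ENNReal.ofReal_pow hε.le 2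
          _ ≤ (A (-Real.pi * s + y₀) s + (A (Real.pi * s + y₀) s + V s)) ^ 2 := by gcongr
          _ ≤ 2 * (A (-Real.pi * s + y₀) s ^ 2 + (A (Real.pi * s + y₀) s + V s) ^ 2) :=
              ENNReal.add_sq_le _ _
          _ ≤ 2 * (2 * A (-Real.pi * s + y₀) s ^ 2
              + 2 * (A (Real.pi * s + y₀) s ^ 2 + V s ^ 2)) := by
              gcongr
              · exact le_mul_of_one_le_left' (by norm_num)
              · exact ENNReal.add_sq_le _ _
          _ = 4 * (A (-Real.pi * s + y₀) s ^ 2 + A (Real.pi * s + y₀) s ^ 2 + V s ^ 2) := by ring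
          _ ≤ 4 * (ENNReal.ofReal s * (ENNReal.ofReal R * e (-Real.pi * s + y₀))
              + ENNReal.ofReal s * (ENNReal.ofReal R * e (Real.pi * s + y₀))
              + ENNReal.ofReal s * (ENNReal.ofReal (2 * Real.pi) * k (R * s + 0))) := by
              gcongr
              · exact hA2 s hsσ _
              · exact hA2 s hsσ _
              · exact hV2 s hsσ
          _ = _ := by simp only [hw]; ring
      calc ENNReal.ofReal (ε ^ 2 * s⁻¹)
          = ENNReal.ofReal s⁻¹ * ENNReal.ofReal (ε ^ 2) := by
            rw [mul_comm, ENNReal.ofReal_mul (by positivity)]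
        _ ≤ ENNReal.ofReal s⁻¹ * (ENNReal.ofReal s * (4 * w s)) := by gcongr
        _ = 4 * w s := by
            rw [← mul_assoc, ← ENNReal.ofReal_mul (by positivity), inv_mul_cancel₀ hs0.ne',
              ENNReal.ofReal_one, one_mul]
    have hleft : ∫⁻ s in Ioo σ 1, ENNReal.ofReal (ε ^ 2 * s⁻¹)
        = ENNReal.ofReal (ε ^ 2 * Real.log (1 / σ)) := by
      have hii : IntervalIntegrable (fun s : ℝ => ε ^ 2 * s⁻¹) volume σ 1 := by
        refine ContinuousOn.intervalIntegrable (continuousOn_const.mul (continuousOn_inv₀.mono ?_))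
        intro x hx
        rw [uIcc_of_le hσ1.le] at hx
        exact (hσ.trans_le hx.1).ne'
      rw [← integral_one_div_of_pos hσ one_pos, ← intervalIntegral.integral_const_mul,
        intervalIntegral.integral_of_le hσ1.le, ← Measure.restrict_congr_set Ioo_ae_eq_Ioc]
      simp only [one_div]
      rw [ofReal_integral_eq_lintegral_ofReal]
      · exact (hii.1.mono_set Ioo_subset_Ioc_self)
      · filter_upwards [ae_restrict_mem measurableSet_Ioo] with s hs
        have : 0 < s := hσ.trans hs.1
        positivity
    have hfin : ENNReal.ofReal (ε ^ 2 * Real.log (1 / σ))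
        ≤ ENNReal.ofReal (4 * ((2 * R + 2 * Real.pi / R) * E)) := by
      rw [← hleft]
      refine (lintegral_mono_ae hpt).trans ?_
      rw [lintegral_const_mul' _ _ (by norm_num), ENNReal.ofReal_mul (p := 4) (by norm_num)]
      gcongr
      simp
    rw [ENNReal.ofReal_le_ofReal_iff (by positivity)] at hfin
    linarith
  obtain ⟨s, hs, ⟨hb, ht, hv⟩, hle⟩ := hgood
  -- The reference point is the image of the lower corner: the lower side is joined to it directly,
  -- the upper side through the vertical side.
  refine ⟨s, hs, F ⟨R * s, -Real.pi * s + y₀⟩, fun z hz hbd => ?_⟩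
  have hs0 : 0 < s := hσ.trans hs.1
  have hRs : 0 < R * s := mul_pos hR hs0
  have hRs1 : R * s < R := by nlinarith [hs.2]
  have hps : 0 < Real.pi * s := by positivity
  have hps1 : Real.pi * s < Real.pi := by nlinarith [hs.2]
  rw [add_zero] at hv
  have hv := hv hRs hRs1
  have hAle : ∀ y x, 0 < x → ∫⁻ t in Icc x (R * s), ‖gx ⟨t, y⟩‖ₑ ≤ A y s := fun y x hx =>
    lintegral_mono_set fun t ht => ⟨hx.trans_le ht.1, ht.2⟩
  have hvert : ∀ y, -Real.pi * s + y₀ ≤ y → y ≤ Real.pi * s + y₀ →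
      ‖F ⟨R * s, y⟩ - F ⟨R * s, -Real.pi * s + y₀⟩‖ₑ ≤ V s := fun y h1 h2 =>
    (hv _ _ h1 (by linarith)).trans (lintegral_mono_set (Icc_subset_Icc (by linarith) (by linarith)))
  have hmain : ‖F z - F ⟨R * s, -Real.pi * s + y₀⟩‖ₑ
      ≤ A (-Real.pi * s + y₀) s + (A (Real.pi * s + y₀) s + V s) := by
    rcases hbd with ⟨hre, him⟩ | ⟨him, hre⟩
    · have hzeq : z = ⟨R * s, z.im⟩ := Complex.ext hre rfl
      rw [abs_le] at him
      rw [hzeq]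
      exact (hvert z.im (by linarith) (by linarith)).trans (le_add_left le_add_self)
    · rcases abs_eq hps.le |>.1 him with h1 | h1
      · have hzeq : z = ⟨z.re, Real.pi * s + y₀⟩ := Complex.ext rfl (by simp; linarith)
        have h2 := ht z.re (R * s) hz.1 hre hRs1
        rw [← hzeq] at h2
        have h3 := hvert (Real.pi * s + y₀) (by linarith) le_rfl
        calc _ = ‖-(F ⟨R * s, Real.pi * s + y₀⟩ - F z) + (F ⟨R * s, Real.pi * s + y₀⟩
              - F ⟨R * s, -Real.pi * s + y₀⟩)‖ₑ := by congr 1; ring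
          _ ≤ A (Real.pi * s + y₀) s + V s := by
              refine (enorm_add_le _ _).trans ?_
              rw [enorm_neg]
              exact add_le_add (h2.trans (hAle _ _ hz.1)) h3
          _ ≤ _ := le_add_self
      · have hzeq : z = ⟨z.re, -Real.pi * s + y₀⟩ := Complex.ext rfl (by simp; linarith)
        have h2 := hb z.re (R * s) hz.1 hre hRs1
        rw [← hzeq] at h2
        rw [← enorm_neg, neg_sub]
        exact (h2.trans (hAle _ _ hz.1)).trans le_self_add
  have := hmain.trans hle
  rw [← ofReal_norm, ENNReal.ofReal_le_ofReal_iff hε.le] at this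
  exact this

/-- `G '' H` is connected and misses the crosscut, so if it met the box it would stay inside, with
`Re ≤ R s < R`. But `H` reaches the right end, and `G` preserves that end. -/
theorem avoid_of_crosscut (h : IsFiniteEnergyStripMap R R' E F G gx gy) {s y₀ : ℝ}
    (hs1 : R * s < R) {H : Set ℂ} (hH : IsPreconnected H) (hHS : H ⊆ vertStrip 0 R')
    (hHend : ∀ β < R', ∃ w ∈ H, β < w.re)
    (hHbd : ∀ z ∈ vertStrip 0 R, ((z.re = R * s ∧ |z.im - y₀| ≤ Real.pi * s) ∨
      (|z.im - y₀| = Real.pi * s ∧ z.re ≤ R * s)) → F z ∉ H) {z : ℂ} (hz : z ∈ vertStrip 0 R)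
    (hzre : z.re < R * s) (hzim : |z.im - y₀| < Real.pi * s) : F z ∉ H := by
  intro hzH
  obtain ⟨m, hm⟩ := h.homeo
  set U : Set ℂ := {z | z.re < R * s ∧ |z.im - y₀| < Real.pi * s}
  set V : Set ℂ := {z | R * s < z.re} ∪ {z | Real.pi * s < |z.im - y₀|}
  have habs : Continuous fun z : ℂ => |z.im - y₀| :=
    (Complex.continuous_im.sub continuous_const).abs
  have hU : IsOpen U := (isOpen_lt Complex.continuous_re continuous_const).inter
    (isOpen_lt habs continuous_const)
  have hV : IsOpen V := (isOpen_lt continuous_const Complex.continuous_re).union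
    (isOpen_lt continuous_const habs)
  have hUV : Disjoint U V := by
    rw [Set.disjoint_left]
    rintro z ⟨h1, h2⟩ (h3 | h3)
    · exact lt_asymm h1 h3
    · exact lt_asymm h2 h3
  have hpre : IsPreconnected (G '' H) := hH.image G (hm.continuousOn_inv.mono hHS)
  have hcov : G '' H ⊆ U ∪ V := by
    rintro _ ⟨w, hw, rfl⟩
    have hGw := hm.mapsTo_inv (hHS hw)
    have hnot := mt (hHbd (G w) hGw) (not_not.2 (by rwa [hm.right_inv w (hHS hw)]))
    push Not at hnot
    rcases lt_trichotomy (G w).re (R * s) with h1 | h1 | h1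
    · rcases lt_trichotomy |(G w).im - y₀| (Real.pi * s) with h2 | h2 | h2
      · exact Or.inl ⟨h1, h2⟩
      · exact absurd (hnot.2 h2) (not_lt.2 h1.le)
      · exact Or.inr (Or.inr h2)
    · exact Or.inr (Or.inr (hnot.1 h1))
    · exact Or.inr (Or.inl h1)
  have hsub := hpre.subset_left_of_subset_union hU hV hUV hcov
    ⟨z, ⟨F z, hzH, hm.left_inv z hz⟩, hzre, hzim⟩
  obtain ⟨d, hd, hdG⟩ := h.ends_inv.right (R * s) hs1
  obtain ⟨w, hw, hwd⟩ := hHend d hd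
  exact lt_asymm (hdG w (hHS hw) hwd) (hsub ⟨w, hw, rfl⟩).1

/-- The image of a crosscut at some scale `s > σ` lies in `|Im w - p.im| ≤ ε`. The half-strips
strictly above and strictly below this band are convex and reach the right end, so the image of the
box avoids them. -/
theorem exists_small_im_oscillation (h : IsFiniteEnergyStripMap R R' E F G gx gy) (hR : 0 < R)
    (hR' : 0 < R') (hE : 0 ≤ E) {σ ε : ℝ} (hσ : 0 < σ) (hσ1 : σ < 1) (hε : 0 < ε)
    (hlog : 4 * ((2 * R + 2 * Real.pi / R) * E) < ε ^ 2 * Real.log (1 / σ)) (y₀ : ℝ) :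
    ∃ v : ℝ, ∀ z ∈ vertStrip 0 R, z.re ≤ R * σ → |z.im - y₀| ≤ Real.pi * σ →
      |(F z).im - v| ≤ ε := by
  obtain ⟨s, hs, p, hp⟩ := h.exists_small_crosscut hR hE hσ hσ1 hε hlog y₀
  obtain ⟨m, hm⟩ := h.homeo
  refine ⟨p.im, fun z hz hzre hzim => ?_⟩
  have hs0 : 0 < s := hσ.trans hs.1
  have hs1 : R * s < R := by nlinarith [hs.2]
  have hzre' : z.re < R * s := lt_of_le_of_lt hzre (by nlinarith [hs.1])
  have hzim' : |z.im - y₀| < Real.pi * s := lt_of_le_of_lt hzim (by nlinarith [hs.1, Real.pi_pos])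
  have hpim : ∀ z ∈ vertStrip 0 R, ((z.re = R * s ∧ |z.im - y₀| ≤ Real.pi * s) ∨
      (|z.im - y₀| = Real.pi * s ∧ z.re ≤ R * s)) → |(F z).im - p.im| ≤ ε := fun z hz hbd => by
    rw [← Complex.sub_im]
    exact (Complex.abs_im_le_norm _).trans (hp z hz hbd)
  have hend : ∀ t : ℝ, ∀ β < R', ∃ w : ℂ, w ∈ vertStrip 0 R' ∧ w.im = t ∧ β < w.re := by
    intro t β hβ
    have hmax : max β 0 < R' := max_lt hβ hR'
    have h1 := le_max_left β 0
    have h2 := le_max_right β 0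
    exact ⟨⟨(max β 0 + R') / 2, t⟩, ⟨by simp only; linarith, by simp only; linarith⟩, rfl,
      by simp only; linarith⟩
  rw [abs_le]
  constructor
  · by_contra! hcon
    refine h.avoid_of_crosscut hs1 (H := vertStrip 0 R' ∩ {w | w.im < p.im - ε})
      ((convex_vertStrip 0 R').inter ((convex_Iio (p.im - ε)).linear_preimage
        Complex.imLm)).isPreconnected inter_subset_left
      (fun β hβ => ?_) (fun z hz hbd hmem => ?_) hz hzre' hzim' ⟨hm.mapsTo hz, ?_⟩
    · obtain ⟨w, h1, h2, h3⟩ := hend (p.im - ε - 1) β hβ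
      exact ⟨w, ⟨h1, by change w.im < _; linarith⟩, h3⟩
    · have h1 := (abs_le.1 (hpim z hz hbd)).1
      have h2 : (F z).im < p.im - ε := hmem.2
      linarith
    · change (F z).im < _; linarith
  · by_contra! hcon
    refine h.avoid_of_crosscut hs1 (H := vertStrip 0 R' ∩ {w | p.im + ε < w.im})
      ((convex_vertStrip 0 R').inter ((convex_Ioi (p.im + ε)).linear_preimage
        Complex.imLm)).isPreconnected inter_subset_left
      (fun β hβ => ?_) (fun z hz hbd hmem => ?_) hz hzre' hzim' ⟨hm.mapsTo hz, ?_⟩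
    · obtain ⟨w, h1, h2, h3⟩ := hend (p.im + ε + 1) β hβ
      exact ⟨w, ⟨h1, by change _ < w.im; linarith⟩, h3⟩
    · have h1 := (abs_le.1 (hpim z hz hbd)).2
      have h2 : p.im + ε < (F z).im := hmem.2
      linarith
    · change _ < (F z).im; linarith

end IsFiniteEnergyStripMap

/-! ### Half-turns, boundary limits and the modulus inequality -/

theorem PreservesEnds.reflect {R R' : ℝ} {F : ℂ → ℂ} (h : PreservesEnds R R' F) :
    PreservesEnds R R' (fun z => R' - F (R - z)) := by
  constructor
  · intro α hα
    obtain ⟨d, hd, h1⟩ := h.right (R' - α) (by linarith)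
    refine ⟨R - d, by linarith, fun z hz hzd => ?_⟩
    have := h1 (R - z) (IsStripHomeo.sub_mem_vertStrip.2 hz)
      (by simp only [Complex.sub_re, Complex.ofReal_re]; linarith)
    simp only [Complex.sub_re, Complex.ofReal_re]; linarith
  · intro β hβ
    obtain ⟨d, hd, h1⟩ := h.left (R' - β) (by linarith)
    refine ⟨R - d, by linarith, fun z hz hzd => ?_⟩
    have := h1 (R - z) (IsStripHomeo.sub_mem_vertStrip.2 hz)
      (by simp only [Complex.sub_re, Complex.ofReal_re]; linarith)
    simp only [Complex.sub_re, Complex.ofReal_re]; linarith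

theorem setLIntegral_comp_sub_le {k : ℝ → ℝ≥0∞} {s t : Set ℝ} (hs : MeasurableSet s) (c : ℝ)
    (hst : ∀ x ∈ s, c - x ∈ t) : ∫⁻ x in s, k (c - x) ≤ ∫⁻ y in t, k y := by
  have := ofReal_mul_setLIntegral_comp_affine_le (k := k) hs (a := -1) (b := c) (t := t)
    (by norm_num) (fun x hx => by rw [neg_one_mul, neg_add_eq_sub]; exact hst x hx)
  simpa [neg_add_eq_sub] using this

theorem mem_closure_vertStrip {R : ℝ} {z₀ : ℂ} (hR : 0 < R) (h0 : 0 ≤ z₀.re) (h1 : z₀.re ≤ R) :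
    z₀ ∈ closure (vertStrip 0 R) := by
  have : vertStrip 0 R = Ioo 0 R ×ℂ univ := by
    ext z; simp [vertStrip, Complex.mem_reProdIm]
  rw [this, Complex.closure_reProdIm, closure_Ioo hR.ne]
  exact ⟨⟨h0, h1⟩, by simp⟩

namespace IsFiniteEnergyStripMap

variable {R R' E : ℝ} {F G gx gy : ℂ → ℂ}

theorem mono (h : IsFiniteEnergyStripMap R R' E F G gx gy) {E' : ℝ} (hE : E ≤ E') :
    IsFiniteEnergyStripMap R R' E' F G gx gy :=
  { h with
    energy_x := fun c => (h.energy_x c).trans (ENNReal.ofReal_le_ofReal hE)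
    energy_y := fun c => (h.energy_y c).trans (ENNReal.ofReal_le_ofReal hE) }

/-- The half-turns of the two strips turn statements about the left end into statements about the
right end; the two sign changes cancel in the derivatives. -/
theorem reflect (h : IsFiniteEnergyStripMap R R' E F G gx gy) :
    IsFiniteEnergyStripMap R R' E (fun z => R' - F (R - z)) (fun w => R - G (R' - w))
      (fun z => gx (R - z)) (fun z => gy (R - z)) := by
  have hmk : ∀ x y : ℝ, (R : ℂ) - ⟨x, y⟩ = ⟨R - x, 0 - y⟩ := fun x y => by
    apply Complex.ext <;> simp
  obtain ⟨m, hm⟩ := h.homeo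
  refine ⟨⟨_, hm.reflect_source.reflect_target⟩, h.ends.reflect, h.ends_inv.reflect,
    h.measurable_x.comp (by fun_prop), h.measurable_y.comp (by fun_prop), ?_, ?_, fun c => ?_,
    fun c => ?_⟩
  · filter_upwards [ae_comp_affine h.horizontal (by norm_num : (-1 : ℝ) ≠ 0) 0] with y hy x₁ x₂ h1 h2 h3
    rw [neg_one_mul, neg_add_eq_sub] at hy
    simp only [hmk]
    have := hy (R - x₂) (R - x₁) (by linarith) (by linarith) (by linarith)
    rw [_root_.sub_sub_sub_cancel_left]
    refine this.trans ?_
    have h4 := setLIntegral_comp_sub_le (k := fun x => ‖gx ⟨R - x, 0 - y⟩‖ₑ) (s := Icc (R - x₂) (R - x₁))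
      (t := Icc x₁ x₂) measurableSet_Icc R (fun x hx => ⟨by linarith [hx.2], by linarith [hx.1]⟩)
    simpa only [_root_.sub_sub_cancel] using h4
  · filter_upwards [ae_comp_affine h.vertical (by norm_num : (-1 : ℝ) ≠ 0) R] with x hx h0 hR y₁ y₂ h1 h2
    rw [neg_one_mul, neg_add_eq_sub] at hx
    simp only [hmk]
    have := hx (by linarith) (by linarith) (0 - y₂) (0 - y₁) (by linarith) (by linarith)
    rw [_root_.sub_sub_sub_cancel_left]
    refine this.trans ?_
    have h4 := setLIntegral_comp_sub_le (k := fun y => ‖gy ⟨R - x, 0 - y⟩‖ₑ) (s := Icc (0 - y₂) (0 - y₁))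
      (t := Icc y₁ y₂) measurableSet_Icc 0 (fun x hx => ⟨by linarith [hx.2], by linarith [hx.1]⟩)
    simpa only [_root_.sub_sub_cancel] using h4
  · simp only [hmk]
    calc ∫⁻ y in Icc c (c + 2 * Real.pi), ∫⁻ x in Ioo 0 R, ‖gx ⟨R - x, 0 - y⟩‖ₑ ^ 2
        ≤ ∫⁻ y in Icc c (c + 2 * Real.pi), ∫⁻ x in Ioo 0 R, ‖gx ⟨x, 0 - y⟩‖ₑ ^ 2 :=
          lintegral_mono fun y => setLIntegral_comp_sub_le (k := fun x => ‖gx ⟨x, 0 - y⟩‖ₑ ^ 2)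
            measurableSet_Ioo R fun x hx => ⟨by linarith [hx.2], by linarith [hx.1]⟩
      _ ≤ ∫⁻ y in Icc (-c - 2 * Real.pi) (-c - 2 * Real.pi + 2 * Real.pi),
            ∫⁻ x in Ioo 0 R, ‖gx ⟨x, y⟩‖ₑ ^ 2 :=
          setLIntegral_comp_sub_le (k := fun y => ∫⁻ x in Ioo 0 R, ‖gx ⟨x, y⟩‖ₑ ^ 2)
            measurableSet_Icc 0 fun y hy => ⟨by linarith [hy.2], by linarith [hy.1]⟩
      _ ≤ _ := h.energy_x _
  · simp only [hmk]
    calc ∫⁻ x in Ioo 0 R, ∫⁻ y in Icc c (c + 2 * Real.pi), ‖gy ⟨R - x, 0 - y⟩‖ₑ ^ 2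
        ≤ ∫⁻ x in Ioo 0 R, ∫⁻ y in Icc (-c - 2 * Real.pi) (-c - 2 * Real.pi + 2 * Real.pi),
            ‖gy ⟨R - x, y⟩‖ₑ ^ 2 :=
          lintegral_mono fun x => setLIntegral_comp_sub_le (k := fun y => ‖gy ⟨R - x, y⟩‖ₑ ^ 2)
            measurableSet_Icc 0 fun y hy => ⟨by linarith [hy.2], by linarith [hy.1]⟩
      _ ≤ ∫⁻ x in Ioo 0 R, ∫⁻ y in Icc (-c - 2 * Real.pi) (-c - 2 * Real.pi + 2 * Real.pi),
            ‖gy ⟨x, y⟩‖ₑ ^ 2 :=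
          setLIntegral_comp_sub_le (k := fun x => ∫⁻ y in Icc (-c - 2 * Real.pi)
            (-c - 2 * Real.pi + 2 * Real.pi), ‖gy ⟨x, y⟩‖ₑ ^ 2)
            measurableSet_Ioo R fun x hx => ⟨by linarith [hx.2], by linarith [hx.1]⟩
      _ ≤ _ := h.energy_y _

/-- Almost every horizontal line has an image joining the two ends of the target, of length at least
`R'`. Cauchy-Schwarz on the line and integration over a period give the inequality. -/
theorem two_pi_mul_sq_le (h : IsFiniteEnergyStripMap R R' E F G gx gy) (hR : 0 < R) (hR' : 0 < R')
    (hE : 0 ≤ E) : 2 * Real.pi * R' ^ 2 ≤ R * E := by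
  have hline : ∀ᵐ y : ℝ, ENNReal.ofReal R' ≤ ∫⁻ x in Ioo 0 R, ‖gx ⟨x, y⟩‖ₑ := by
    filter_upwards [h.horizontal] with y hy
    refine ENNReal.le_of_forall_pos_le_add fun ε hε _ => ?_
    have hε' : (0 : ℝ) < ε / 2 := by positivity
    obtain ⟨δ, hδ, h1⟩ := h.ends.left (ε / 2) hε'
    obtain ⟨d, hd, h2⟩ := h.ends.right (R' - ε / 2) (by linarith)
    set x₁ := min (δ / 2) (R / 2)
    set x₂ := max ((d + R) / 2) (R / 2)
    have hx₁ : 0 < x₁ := lt_min (by linarith) (by linarith)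
    have hx₂ : x₂ < R := max_lt (by linarith) (by linarith)
    have hx₁₂ : x₁ ≤ x₂ := (min_le_right _ _).trans (le_max_right _ _)
    have h3 := h1 ⟨x₁, y⟩ ⟨hx₁, hx₁₂.trans_lt hx₂⟩ ((min_le_left _ _).trans_lt (by linarith))
    have h4 := h2 ⟨x₂, y⟩ ⟨hx₁.trans_le hx₁₂, hx₂⟩ (lt_of_lt_of_le (by linarith) (le_max_left _ _))
    have h5 : R' - ε ≤ ‖F ⟨x₂, y⟩ - F ⟨x₁, y⟩‖ := by
      refine le_trans ?_ (Complex.re_le_norm _)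
      rw [Complex.sub_re]; linarith
    have h6 := hy x₁ x₂ hx₁ hx₁₂ hx₂
    calc ENNReal.ofReal R' ≤ ENNReal.ofReal (‖F ⟨x₂, y⟩ - F ⟨x₁, y⟩‖ + ε) :=
          ENNReal.ofReal_le_ofReal (by linarith)
      _ = ‖F ⟨x₂, y⟩ - F ⟨x₁, y⟩‖ₑ + ε := by
          rw [ENNReal.ofReal_add (norm_nonneg _) ε.coe_nonneg, ofReal_norm, ENNReal.ofReal_coe_nnreal]
      _ ≤ _ := by
          gcongr
          refine h6.trans (lintegral_mono_set fun x hx => ⟨hx₁.trans_le hx.1, hx.2.trans_lt hx₂⟩)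
  have hsq : ∀ᵐ y : ℝ, ENNReal.ofReal (R' ^ 2)
      ≤ ENNReal.ofReal R * ∫⁻ x in Ioo 0 R, ‖gx ⟨x, y⟩‖ₑ ^ 2 := by
    filter_upwards [hline] with y hy
    calc ENNReal.ofReal (R' ^ 2) = ENNReal.ofReal R' ^ 2 := ENNReal.ofReal_pow hR'.le 2
      _ ≤ (∫⁻ x in Ioo 0 R, ‖gx ⟨x, y⟩‖ₑ) ^ 2 := by gcongr
      _ ≤ _ := by
        have := sq_lintegral_le (volume.restrict (Ioo 0 R)) (h.measurable_slice_x y).aemeasurable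
        rwa [Measure.restrict_apply_univ, Real.volume_Ioo, sub_zero] at this
  have hp := Real.pi_pos
  have hint : ENNReal.ofReal (2 * Real.pi * R' ^ 2) ≤ ENNReal.ofReal (R * E) := by
    calc ENNReal.ofReal (2 * Real.pi * R' ^ 2)
        = ∫⁻ y in Icc 0 (0 + 2 * Real.pi), ENNReal.ofReal (R' ^ 2) := by
          rw [setLIntegral_const, Real.volume_Icc, mul_comm, ENNReal.ofReal_mul (by positivity)]
          congr 2; ring
      _ ≤ ∫⁻ y in Icc 0 (0 + 2 * Real.pi), ENNReal.ofReal R *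
            ∫⁻ x in Ioo 0 R, ‖gx ⟨x, y⟩‖ₑ ^ 2 := lintegral_mono_ae (ae_restrict_of_ae hsq)
      _ = ENNReal.ofReal R * ∫⁻ y in Icc 0 (0 + 2 * Real.pi),
            ∫⁻ x in Ioo 0 R, ‖gx ⟨x, y⟩‖ₑ ^ 2 := lintegral_const_mul' _ _ ENNReal.ofReal_ne_top
      _ ≤ ENNReal.ofReal R * ENNReal.ofReal E := by gcongr; exact h.energy_x 0
      _ = _ := (ENNReal.ofReal_mul hR.le).symm
  rwa [ENNReal.ofReal_le_ofReal_iff (by positivity)] at hint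

/-- Cauchy criterion near `z₀`: `Re F` is small because the left end is preserved, and `Im F`
oscillates little on a small box. -/
theorem exists_tendsto_left (h : IsFiniteEnergyStripMap R R' E F G gx gy) (hR : 0 < R)
    (hR' : 0 < R') (hE : 0 ≤ E) {z₀ : ℂ} (hz₀ : z₀.re = 0) :
    ∃ L, Tendsto F (𝓝[vertStrip 0 R] z₀) (𝓝 L) := by
  have hne : (𝓝[vertStrip 0 R] z₀).NeBot :=
    mem_closure_iff_nhdsWithin_neBot.1 (mem_closure_vertStrip hR hz₀.ge (hz₀.trans_le hR.le))
  refine cauchy_map_iff_exists_tendsto.1 (Metric.cauchy_iff.2 ⟨hne.map F, fun ε hε => ?_⟩)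
  set B := 4 * ((2 * R + 2 * Real.pi / R) * E)
  have hB : 0 ≤ B := by have := Real.pi_pos; positivity
  -- With `σ = exp (-T)` one has `log (1/σ) = T`, and this `T` gives `(ε/8)² T = B + (ε/8)² > B`.
  set T := B / (ε / 8) ^ 2 + 1
  have hT : 0 < T := by positivity
  obtain ⟨v, hv⟩ := h.exists_small_im_oscillation hR hR' hE (σ := Real.exp (-T)) (ε := ε / 8)
    (Real.exp_pos _) (by rw [Real.exp_lt_one_iff]; linarith) (by positivity) (by
      rw [one_div, ← Real.exp_neg, neg_neg, Real.log_exp]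
      have : (ε / 8) ^ 2 * T = B + (ε / 8) ^ 2 := by
        simp only [T]; field_simp
      rw [this]
      have : 0 < (ε / 8) ^ 2 := by positivity
      linarith) z₀.im
  obtain ⟨δ, hδ, hre⟩ := h.ends.left (ε / 4) (by positivity)
  obtain ⟨m, hm⟩ := h.homeo
  have hσ := Real.exp_pos (-T)
  have hnear : ∀ᶠ z in 𝓝[vertStrip 0 R] z₀, z ∈ vertStrip 0 R ∧ z.re < δ ∧
      z.re < R * Real.exp (-T) ∧ |z.im - z₀.im| < Real.pi * Real.exp (-T) := by
    refine (eventually_mem_nhdsWithin).and (eventually_nhdsWithin_of_eventually_nhds ?_)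
    have c1 : ContinuousAt (fun z : ℂ => z.re) z₀ := Complex.continuous_re.continuousAt
    have c2 : ContinuousAt (fun z : ℂ => |z.im - z₀.im|) z₀ :=
      ((Complex.continuous_im.sub continuous_const).abs).continuousAt
    refine (c1.eventually_lt_const (by change z₀.re < _; rw [hz₀]; exact hδ)).and
      ((c1.eventually_lt_const (by change z₀.re < _; rw [hz₀]; positivity)).and
        (c2.eventually_lt_const ?_))
    change |z₀.im - z₀.im| < _
    rw [sub_self, abs_zero]
    have := Real.pi_pos; positivity
  refine ⟨F '' {z | z ∈ vertStrip 0 R ∧ z.re < δ ∧ z.re < R * Real.exp (-T) ∧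
    |z.im - z₀.im| < Real.pi * Real.exp (-T)}, image_mem_map hnear, ?_⟩
  rintro _ ⟨z, ⟨hz, hz1, hz2, hz3⟩, rfl⟩ _ ⟨w, ⟨hw, hw1, hw2, hw3⟩, rfl⟩
  have a1 := abs_le.1 (hv z hz hz2.le hz3.le)
  have a2 := abs_le.1 (hv w hw hw2.le hw3.le)
  have b1 := hre z hz hz1
  have b2 := hre w hw hw1
  have b3 : 0 < (F z).re := (hm.mapsTo hz).1
  have b4 : 0 < (F w).re := (hm.mapsTo hw).1
  rw [dist_eq_norm]
  refine (Complex.norm_le_abs_re_add_abs_im _).trans_lt ?_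
  have c1 : |(F z - F w).re| ≤ ε / 4 := by
    rw [Complex.sub_re, abs_le]; constructor <;> linarith
  have c2 : |(F z - F w).im| ≤ ε / 4 := by
    rw [Complex.sub_im, abs_le]; constructor <;> linarith [a1.1, a1.2, a2.1, a2.2]
  linarith

theorem exists_tendsto (h : IsFiniteEnergyStripMap R R' E F G gx gy) (hR : 0 < R)
    (hR' : 0 < R') (hE : 0 ≤ E) {z₀ : ℂ} (h0 : 0 ≤ z₀.re) (h1 : z₀.re ≤ R) :
    ∃ L, Tendsto F (𝓝[vertStrip 0 R] z₀) (𝓝 L) := by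
  rcases h0.eq_or_lt with h0 | h0
  · exact h.exists_tendsto_left hR hR' hE h0.symm
  rcases h1.eq_or_lt with h1 | h1
  · obtain ⟨L, hL⟩ := h.reflect.exists_tendsto_left hR hR' hE (z₀ := R - z₀) (by simp [h1])
    have ht : Tendsto (fun z : ℂ => (R : ℂ) - z) (𝓝[vertStrip 0 R] z₀)
        (𝓝[vertStrip 0 R] ((R : ℂ) - z₀)) :=
      tendsto_nhdsWithin_iff.2 ⟨((continuous_const.sub continuous_id).tendsto z₀).mono_left
        nhdsWithin_le_nhds, by
        filter_upwards [self_mem_nhdsWithin] with z hz using IsStripHomeo.sub_mem_vertStrip.2 hz⟩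
    refine ⟨R' - L, ((tendsto_const_nhds (x := (R' : ℂ))).sub (hL.comp ht)).congr fun z => ?_⟩
    simp only [Function.comp_apply, sub_sub_self]
  · obtain ⟨m, hm⟩ := h.homeo
    exact ⟨F z₀, hm.continuousOn z₀ ⟨h0, h1⟩⟩

/-- For `σ = 1/2` the box at the origin contains the midpoint `R/2`, and it contains all points of
the strip near `0`. -/
theorem abs_im_limit_sub_le (h : IsFiniteEnergyStripMap R R' E F G gx gy) (hR : 0 < R)
    (hR' : 0 < R') (hE : 0 ≤ E) {ε : ℝ} (hε : 0 < ε)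
    (hlog : 4 * ((2 * R + 2 * Real.pi / R) * E) < ε ^ 2 * Real.log 2) {L : ℂ}
    (hL : Tendsto F (𝓝[vertStrip 0 R] 0) (𝓝 L)) : |L.im - (F (R / 2 : ℝ)).im| ≤ 2 * ε := by
  have hp := Real.pi_pos
  obtain ⟨v, hv⟩ := h.exists_small_im_oscillation hR hR' hE (σ := 1 / 2) (ε := ε) (by norm_num)
    (by norm_num) hε (by norm_num; exact hlog) 0
  have hne : (𝓝[vertStrip 0 R] (0 : ℂ)).NeBot :=
    mem_closure_iff_nhdsWithin_neBot.1 (mem_closure_vertStrip hR le_rfl hR.le)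
  have hmid := hv (R / 2 : ℝ) ⟨by rw [Complex.ofReal_re]; linarith, by rw [Complex.ofReal_re]; linarith⟩
    (by rw [Complex.ofReal_re]; linarith) (by simp; positivity)
  have hlim : |L.im - v| ≤ ε := by
    have ht : Tendsto (fun z => |(F z).im - v|) (𝓝[vertStrip 0 R] 0) (𝓝 |L.im - v|) :=
      (((Complex.continuous_im.tendsto L).comp hL).sub_const v).abs
    refine le_of_tendsto ht ?_
    have c1 : ContinuousAt (fun z : ℂ => z.re) 0 := Complex.continuous_re.continuousAt
    have c2 : ContinuousAt (fun z : ℂ => |z.im - 0|) 0 :=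
      ((Complex.continuous_im.sub continuous_const).abs).continuousAt
    filter_upwards [self_mem_nhdsWithin, nhdsWithin_le_nhds (c1.eventually_lt_const
      (show (0 : ℂ).re < R * (1 / 2) by rw [Complex.zero_re]; positivity)),
      nhdsWithin_le_nhds (c2.eventually_lt_const (show |(0 : ℂ).im - 0| < Real.pi * (1 / 2) by
        simp; positivity))] with z hz h1 h2
    exact hv z hz h1.le h2.le
  have a1 := abs_le.1 hmid
  have a2 := abs_le.1 hlim
  rw [abs_le]; constructor <;> linarith [a1.1, a1.2, a2.1, a2.2]

/-- The half-turn `z ↦ R - z` fixes the midpoint `R/2`, so both endpoints are compared with the same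
value. -/
theorem abs_im_limit_sub_limit_le (h : IsFiniteEnergyStripMap R R' E F G gx gy) (hR : 0 < R)
    (hR' : 0 < R') (hE : 0 ≤ E) {ε : ℝ} (hε : 0 < ε)
    (hlog : 4 * ((2 * R + 2 * Real.pi / R) * E) < ε ^ 2 * Real.log 2) {L₀ L₁ : ℂ}
    (h0 : Tendsto F (𝓝[vertStrip 0 R] 0) (𝓝 L₀))
    (h1 : Tendsto F (𝓝[vertStrip 0 R] (R : ℂ)) (𝓝 L₁)) : |L₁.im - L₀.im| ≤ 4 * ε := by
  have a0 := h.abs_im_limit_sub_le hR hR' hE hε hlog h0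
  have ht : Tendsto (fun z : ℂ => (R : ℂ) - z) (𝓝[vertStrip 0 R] 0) (𝓝[vertStrip 0 R] (R : ℂ)) :=
    tendsto_nhdsWithin_iff.2 ⟨by
      have : Tendsto (fun z : ℂ => (R : ℂ) - z) (𝓝 0) (𝓝 ((R : ℂ) - 0)) :=
        tendsto_const_nhds.sub tendsto_id
      rw [sub_zero] at this
      exact this.mono_left nhdsWithin_le_nhds, by
      filter_upwards [self_mem_nhdsWithin] with z hz using IsStripHomeo.sub_mem_vertStrip.2 hz⟩
  have a1 := h.reflect.abs_im_limit_sub_le hR hR' hE hε hlog (L := R' - L₁)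
    (tendsto_const_nhds.sub (h1.comp ht))
  have e : (R : ℂ) - ((R / 2 : ℝ) : ℂ) = ((R / 2 : ℝ) : ℂ) := by push_cast; ring
  rw [e] at a1
  simp only [Complex.sub_im, Complex.ofReal_im, zero_sub] at a1
  rw [abs_le] at *
  constructor <;> linarith [a0.1, a0.2, a1.1, a1.2]

end IsFiniteEnergyStripMap

/-! ### The logarithm of a quasiconformal map of annuli -/

theorem isOpen_roundAnnulus (r : ℝ) : IsOpen (roundAnnulus r) :=
  (isOpen_lt continuous_const continuous_norm).inter (isOpen_lt continuous_norm continuous_const)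

theorem IsL2Loc.exists_measurable {U : Set ℂ} (hU : IsOpen U) {g : ℂ → ℂ} (h : IsL2Loc U g) :
    ∃ g', Measurable g' ∧ g =ᵐ[volume.restrict U] g' := by
  have h1 : LocallyIntegrableOn g U := by
    rw [locallyIntegrableOn_iff hU.isLocallyClosed]
    intro C hCU hC
    have : IsFiniteMeasure (volume.restrict C) := ⟨by simpa using hC.measure_lt_top⟩
    exact (h C hC hCU).integrable one_le_two
  have h2 := h1.aestronglyMeasurable
  exact ⟨h2.mk, h2.stronglyMeasurable_mk.measurable, h2.ae_eq_mk⟩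

theorem IsL2Loc.congr {U : Set ℂ} {g g' : ℂ → ℂ} (h : IsL2Loc U g)
    (hg : g =ᵐ[volume.restrict U] g') : IsL2Loc U g' := fun C hC hCU =>
  (memLp_congr_ae (ae_restrict_of_ae_restrict_of_subset hCU hg)).1 (h C hC hCU)

theorem IsWeakDerivOn.congr {U : Set ℂ} (hU : MeasurableSet U) {f f' g g' : ℂ → ℂ} {v : ℂ}
    (h : IsWeakDerivOn U f g v) (hf : EqOn f f' U) (hg : g =ᵐ[volume.restrict U] g') :
    IsWeakDerivOn U f' g' v := by
  intro φ hφ hφc hφU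
  have e1 : ∫ z, (fderiv ℝ φ z v) • f' z = ∫ z, (fderiv ℝ φ z v) • f z := by
    refine integral_congr_ae (.of_forall fun z => ?_)
    by_cases hz : z ∈ U
    · simp only [hf hz]
    · have : fderiv ℝ φ z = 0 := by
        by_contra hne
        exact hz (hφU (support_fderiv_subset ℝ hne))
      simp [this]
  have e2 : ∫ z, φ z • g' z = ∫ z, φ z • g z := by
    refine integral_congr_ae ?_
    filter_upwards [(ae_restrict_iff' hU).1 hg] with z hz
    by_cases hzU : z ∈ U
    · simp only [hz hzU]
    · have : φ z = 0 := by
        by_contra hne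
        exact hzU (hφU (subset_tsupport φ hne))
      simp [this]
  rw [e1, e2]
  exact h φ hφ hφc hφU

theorem IsStripSobolev.reflect_target {R : ℝ} {F gx gy : ℂ → ℂ} {m : ℤ}
    (h : IsStripSobolev R F gx gy m) (R' : ℝ) :
    IsStripSobolev R (fun z => R' - F z) (fun z => -gx z) (fun z => -gy z) (-m) := by
  intro a b ha hab hb
  obtain ⟨f, h1, h2, h3, h4, h5⟩ := h a b ha hab hb
  have e : ∀ (n : ℕ) (z v w : ℂ), ‖fderiv ℝ (fun z => (R' : ℂ) - f n z) z v - -w‖ₑ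
      = ‖fderiv ℝ (f n) z v - w‖ₑ := fun n z v w => by
    rw [fderiv_const_sub, ← enorm_neg]
    congr 1
    simp only [neg_apply]
    ring
  refine ⟨fun n z => R' - f n z, fun n => contDiffOn_const.sub (h1 n), fun n z hz => ?_, ?_, ?_, ?_⟩
  · simp only [h2 n z hz]; push_cast; ring
  · rw [Metric.tendstoUniformlyOn_iff] at h3 ⊢
    intro ε hε
    filter_upwards [h3 ε hε] with n hn z hz
    rw [dist_sub_left]
    exact hn z hz
  · simpa only [e] using h4
  · simpa only [e] using h5

/-- The energy bound `4πKR'` still involves the target. Fed into `two_pi_mul_sq_le` it bounds `R'`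
itself, which removes `R'` from the estimate. -/
theorem IsStripSobolev.isFiniteEnergyStripMap {R R' K : ℝ} {F G gx gy : ℂ → ℂ} {m : ℤ} (hR : 0 < R)
    (hR' : 0 < R') (hK : 1 ≤ K) (hsob : IsStripSobolev R F gx gy m) (h : IsStripHomeo R R' F G m)
    (hends : PreservesEnds R R' F) (hgx : Measurable gx) (hgy : Measurable gy)
    (hJ : ∀ᵐ z ∂(volume.restrict (vertStrip 0 R)),
      ‖gx z‖ ^ 2 + ‖gy z‖ ^ 2 ≤ 2 * K * jac (gx z) (gy z)) :
    IsFiniteEnergyStripMap R R' (8 * Real.pi * K ^ 2 * R) F G gx gy := by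
  have hp := Real.pi_pos
  have hE := energy_le hR hK h hends hsob hgx hgy hJ
  have key : IsFiniteEnergyStripMap R R' (4 * Real.pi * K * R') F G gx gy :=
    { homeo := ⟨m, h⟩
      ends := hends
      ends_inv := h.preservesEnds_symm hR hR' hends
      measurable_x := hgx
      measurable_y := hgy
      horizontal := hsob.ae_horizontal hgx
      vertical := hsob.ae_vertical hgy
      energy_x := fun c => by
        rw [← setLIntegral_swap (k := fun z => ‖gx z‖ₑ ^ 2) (hgx.enorm.pow_const 2),
          ← setLIntegral_reProdIm (k := fun z => ‖gx z‖ₑ ^ 2) (hgx.enorm.pow_const 2)]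
        exact (lintegral_mono fun z => le_self_add).trans (hE c)
      energy_y := fun c => by
        rw [← setLIntegral_reProdIm (k := fun z => ‖gy z‖ₑ ^ 2) (hgy.enorm.pow_const 2)]
        exact (lintegral_mono fun z => le_add_self).trans (hE c) }
  refine key.mono ?_
  have h1 := key.two_pi_mul_sq_le hR hR' (by positivity)
  -- This is `2πR'² ≤ R · 4πKR'` divided by `2πR'`.
  have h2 : R' ≤ 2 * K * R := by
    by_contra! hcon
    have : 2 * Real.pi * R' * (2 * K * R) < 2 * Real.pi * R' * R' :=
      mul_lt_mul_of_pos_left hcon (by positivity)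
    linarith
  calc 4 * Real.pi * K * R' ≤ 4 * Real.pi * K * (2 * K * R) :=
        mul_le_mul_of_nonneg_left h2 (by positivity)
    _ = _ := by ring

/-- The logarithm `A` of a quasiconformal homeomorphism of round annuli is a strip map of finite
energy, up to a reflection of the target strip, with a bound on the energy which does not depend on
the target. -/
theorem IsQuasiconformal.exists_finiteEnergyStripMap {K r r' : ℝ} (hr : 1 < r) (hr' : 1 < r')
    {ψ : OpenPartialHomeomorph ℂ ℂ} (hs : ψ.source = roundAnnulus r)
    (ht : ψ.target = roundAnnulus r') (hq : IsQuasiconformal K ψ) :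
    ∃ A F G gx gy : ℂ → ℂ, (∀ z ∈ vertStrip 0 (Real.log r), Complex.exp (A z) = ψ (Complex.exp z)) ∧
      (A = F ∨ A = fun z => Real.log r' - F z) ∧
      IsFiniteEnergyStripMap (Real.log r) (Real.log r') (8 * Real.pi * K ^ 2 * Real.log r) F G gx gy := by
  classical
  obtain ⟨hK, fx, fy, hfx, hfy, wx, wy, hB⟩ := hq
  have hR := Real.log_pos hr
  have hR' := Real.log_pos hr'
  have hm : MeasurableSet (roundAnnulus r) := (isOpen_roundAnnulus r).measurableSet
  rw [hs] at hfx hfy wx wy hB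
  obtain ⟨px, hpx, ex⟩ := hfx.exists_measurable (isOpen_roundAnnulus r)
  obtain ⟨py, hpy, ey⟩ := hfy.exists_measurable (isOpen_roundAnnulus r)
  -- Off the annulus `ψ` is arbitrary; this version is Borel and agrees with `ψ` where it matters.
  set χ : ℂ → ℂ := (roundAnnulus r).piecewise ψ 0
  have hχ : EqOn ψ χ (roundAnnulus r) := fun z hz => (piecewise_eq_of_mem _ _ _ hz).symm
  have hψc : ContinuousOn ψ (roundAnnulus r) := hs ▸ ψ.continuousOn
  have hχm : Measurable χ := hψc.measurable_piecewise continuousOn_const hm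
  obtain ⟨F, G, m, hF, hFe⟩ := exists_strip_lift hr hr' ψ hs ht
  have hexp : ∀ z ∈ vertStrip 0 (Real.log r), Complex.exp z ∈ roundAnnulus r := fun z hz =>
    (exp_mem_roundAnnulus hr).2 hz
  have hsob := isStripSobolev_of_lift hr (hψc.congr hχ.symm) (fun w hw => by
      rw [← hχ hw]
      have : ψ w ∈ roundAnnulus r' := ht ▸ ψ.map_source (hs ▸ hw)
      exact this.1.le) (hfx.congr ex) (hfy.congr ey) (wx.congr hm hχ ex) (wy.congr hm hχ ey)
    hF.continuousOn (fun z hz => (hFe z hz).trans (hχ (hexp z hz))) hF.period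
  have hgx := measurable_logDerivExp hχm hpx hpy 1
  have hgy := measurable_logDerivExp hχm hpx hpy Complex.I
  have hJ : ∀ᵐ z ∂(volume.restrict (vertStrip 0 (Real.log r))),
      ‖logDerivExp χ px py 1 z‖ ^ 2 + ‖logDerivExp χ px py Complex.I z‖ ^ 2
        ≤ 2 * K * jac (logDerivExp χ px py 1 z) (logDerivExp χ px py Complex.I z) := by
    have hB' : ∀ᵐ w ∂(volume.restrict (roundAnnulus r)), ‖(px w + Complex.I * py w) / 2‖
        ≤ (K - 1) / (K + 1) * ‖(px w - Complex.I * py w) / 2‖ := by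
      filter_upwards [hB, ex, ey] with w h1 h2 h3
      rwa [← h2, ← h3]
    filter_upwards [ae_comp_exp hexp hB'] with z hz using norm_sq_logDerivExp_le hK hz
  rcases hF.preservesEnds_or hR hR' with hends | hends
  · exact ⟨F, F, G, _, _, hFe, Or.inl rfl,
      hsob.isFiniteEnergyStripMap hR hR' hK hF hends hgx hgy hJ⟩
  -- When the ends are exchanged, `R' - F` preserves them. This is a half-turn, not a reflection, so
  -- the Jacobian keeps its sign and the energy inequality survives.
  · refine ⟨F, _, _, _, _, hFe, Or.inr ?_, (hsob.reflect_target (Real.log r')).isFiniteEnergyStripMap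
      hR hR' hK hF.reflect_target hends hgx.neg hgy.neg ?_⟩
    · funext z; ring
    · filter_upwards [hJ] with z hz
      simpa [jac] using hz

/-- The logarithm of a quasiconformal homeomorphism of round annuli extends continuously to the
closed strip, and the imaginary parts at the ends of the real segment differ by a bounded amount. -/
theorem exists_log_extension {K r : ℝ} (hr : 1 < r) :
    ∃ N : ℝ, ∀ r', 1 < r' → ∀ ψ : OpenPartialHomeomorph ℂ ℂ, ψ.source = roundAnnulus r →
      ψ.target = roundAnnulus r' → IsQuasiconformal K ψ → ∃ A : ℂ → ℂ,
        (∀ z ∈ vertStrip 0 (Real.log r), Complex.exp (A z) = ψ (Complex.exp z)) ∧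
        ContinuousOn A (vertStrip 0 (Real.log r)) ∧
        (∀ z : ℂ, 0 ≤ z.re → z.re ≤ Real.log r →
          ∃ L, Tendsto A (𝓝[vertStrip 0 (Real.log r)] z) (𝓝 L)) ∧
        ∀ L₀ L₁, Tendsto A (𝓝[vertStrip 0 (Real.log r)] 0) (𝓝 L₀) →
          Tendsto A (𝓝[vertStrip 0 (Real.log r)] (Real.log r : ℂ)) (𝓝 L₁) →
          |L₁.im - L₀.im| ≤ N := by
  have hR := Real.log_pos hr
  set R := Real.log r
  have hp := Real.pi_pos
  set E := 8 * Real.pi * K ^ 2 * R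
  have hE : 0 ≤ E := by positivity
  have hl : 0 < Real.log 2 := Real.log_pos one_lt_two
  set X := 4 * ((2 * R + 2 * Real.pi / R) * E)
  have hX : 0 ≤ X := by positivity
  -- This choice gives `ε² log 2 ≥ ε log 2 > X`, which is the condition of the crosscut estimate for
  -- `σ = 1/2`. It depends on `K` and `r` only.
  set ε := X / Real.log 2 + 1
  have hε : 1 ≤ ε := by have : 0 ≤ X / Real.log 2 := by positivity
                        linarith
  have hlog : X < ε ^ 2 * Real.log 2 := by
    have h1 : ε * Real.log 2 = X + Real.log 2 := by simp only [ε]; field_simp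
    have h2 : ε * Real.log 2 ≤ ε ^ 2 * Real.log 2 := by
      gcongr; exact le_self_pow₀ hε two_ne_zero
    linarith
  refine ⟨4 * ε, fun r' hr' ψ hs ht hq => ?_⟩
  have hR' := Real.log_pos hr'
  obtain ⟨A, F, G, gx, gy, hA, hAF, h⟩ := hq.exists_finiteEnergyStripMap hr hr' hs ht
  obtain ⟨m, hm⟩ := h.homeo
  have hε0 : 0 < ε := by linarith
  refine ⟨A, hA, ?_, fun z h0 h1 => ?_, fun L₀ L₁ h0 h1 => ?_⟩
  · rcases hAF with rfl | rfl
    · exact hm.continuousOn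
    · exact continuousOn_const.sub hm.continuousOn
  · obtain ⟨L, hL⟩ := h.exists_tendsto hR hR' hE h0 h1
    rcases hAF with rfl | rfl
    · exact ⟨L, hL⟩
    · exact ⟨_, tendsto_const_nhds.sub hL⟩
  · rcases hAF with rfl | rfl
    · exact h.abs_im_limit_sub_limit_le hR hR' hE hε0 hlog h0 h1
    · have c0 := (tendsto_const_nhds (x := (Real.log r' : ℂ))).sub h0
      have c1 := (tendsto_const_nhds (x := (Real.log r' : ℂ))).sub h1
      simp only [_root_.sub_sub_self] at c0 c1
      have := h.abs_im_limit_sub_limit_le hR hR' hE hε0 hlog c0 c1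
      rw [abs_sub_comm]
      simp only [Complex.sub_im, Complex.ofReal_im, zero_sub] at this
      rwa [neg_sub_neg] at this

/-! ### Return to the annulus and the wrapping number -/

theorem log_re_mem_Icc {r : ℝ} {w : ℂ} (hw : w ∈ closedRoundAnnulus r) :
    0 ≤ (Complex.log w).re ∧ (Complex.log w).re ≤ Real.log r := by
  rw [Complex.log_re]
  exact ⟨Real.log_nonneg hw.1, Real.log_le_log (by linarith [hw.1]) hw.2⟩

theorem closedRoundAnnulus_subset_closure {r : ℝ} (hr : 1 < r) :
    closedRoundAnnulus r ⊆ closure (roundAnnulus r) := by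
  intro w hw
  have hw0 : w ≠ 0 := norm_pos_iff.1 (by linarith [hw.1])
  rw [← Complex.exp_log hw0]
  obtain ⟨h0, h1⟩ := log_re_mem_Icc hw
  exact map_mem_closure Complex.continuous_exp (mem_closure_vertStrip (Real.log_pos hr) h0 h1)
    fun z hz => (exp_mem_roundAnnulus hr).2 hz

/-- Near `w` the branch `log w + log (u / w)` of the logarithm is continuous, even when `w` lies on
the negative axis. Through it the limit of `A` at `log w` becomes a limit of `ψ` at `w`. -/
theorem exists_tendsto_of_log {r : ℝ} (hr : 1 < r) {ψ A : ℂ → ℂ}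
    (hA : ∀ z ∈ vertStrip 0 (Real.log r), Complex.exp (A z) = ψ (Complex.exp z))
    (hlim : ∀ z : ℂ, 0 ≤ z.re → z.re ≤ Real.log r →
      ∃ L, Tendsto A (𝓝[vertStrip 0 (Real.log r)] z) (𝓝 L)) {w : ℂ}
    (hw : w ∈ closedRoundAnnulus r) : ∃ L, Tendsto ψ (𝓝[roundAnnulus r] w) (𝓝 L) := by
  have hw0 : w ≠ 0 := norm_pos_iff.1 (by linarith [hw.1])
  obtain ⟨h0, h1⟩ := log_re_mem_Icc hw
  obtain ⟨L, hL⟩ := hlim _ h0 h1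
  set ℓ : ℂ → ℂ := fun u => Complex.log w + Complex.log (u / w)
  have hℓ : ∀ u ∈ roundAnnulus r, Complex.exp (ℓ u) = u := fun u hu => by
    have hu0 : u ≠ 0 := norm_pos_iff.1 (by linarith [hu.1])
    rw [Complex.exp_add, Complex.exp_log hw0, Complex.exp_log (div_ne_zero hu0 hw0),
      mul_div_cancel₀ _ hw0]
  have hℓs : ∀ u ∈ roundAnnulus r, ℓ u ∈ vertStrip 0 (Real.log r) := fun u hu => by
    rw [← exp_mem_roundAnnulus hr, hℓ u hu]; exact hu
  have hcont : ContinuousAt ℓ w := by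
    refine continuousAt_const.add (ContinuousAt.clog (by fun_prop) ?_)
    rw [div_self hw0]; exact Complex.one_mem_slitPlane
  have ht : Tendsto ℓ (𝓝[roundAnnulus r] w) (𝓝[vertStrip 0 (Real.log r)] Complex.log w) := by
    refine tendsto_nhdsWithin_iff.2 ⟨?_, eventually_mem_nhdsWithin.mono hℓs⟩
    have := hcont.tendsto
    simp only [ℓ, div_self hw0, Complex.log_one, add_zero] at this
    exact this.mono_left nhdsWithin_le_nhds
  refine ⟨Complex.exp L, ((Complex.continuous_exp.tendsto L).comp (hL.comp ht)).congr' ?_⟩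
  filter_upwards [self_mem_nhdsWithin] with u hu
  rw [Function.comp_apply, Function.comp_apply, hA _ (hℓs u hu), hℓ u hu]

theorem mainTheorem9 (K r : ℝ) (hK : 1 ≤ K) (hr : 1 < r) :
    ∃ N : ℝ, ∀ r' : ℝ, 1 < r' → ∀ ψ : OpenPartialHomeomorph ℂ ℂ,
      ψ.source = roundAnnulus r → ψ.target = roundAnnulus r' → IsQuasiconformal K ψ →
        ∃ Ψ : ℂ → ℂ, ContinuousOn Ψ (closedRoundAnnulus r) ∧ EqOn Ψ ψ (roundAnnulus r) ∧
          ∃ w ∈ Icc (-N) N, HasWrappingNumber (fun t : ℝ => Ψ (t : ℂ)) 1 r w := by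
  obtain ⟨N, hN⟩ := exists_log_extension (K := K) hr
  refine ⟨N, fun r' hr' ψ hs ht hq => ?_⟩
  obtain ⟨A, hA, hAc, hlim, hbound⟩ := hN r' hr' ψ hs ht hq
  have hR := Real.log_pos hr
  set S := vertStrip 0 (Real.log r) with hS
  set T : Set ℂ := {z | 0 ≤ z.re ∧ z.re ≤ Real.log r}
  have hψc : ContinuousOn ψ (roundAnnulus r) := hs ▸ ψ.continuousOn
  have hΨ : ContinuousOn (extendFrom (roundAnnulus r) ψ) (closedRoundAnnulus r) :=
    continuousOn_extendFrom (closedRoundAnnulus_subset_closure hr)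
      fun w hw => exists_tendsto_of_log hr hA hlim hw
  have hΨψ : EqOn (extendFrom (roundAnnulus r) ψ) ψ (roundAnnulus r) := fun w hw =>
    extendFrom_extends hψc w hw
  have hB : ContinuousOn (extendFrom S A) T :=
    continuousOn_extendFrom (fun z hz => mem_closure_vertStrip hR hz.1 hz.2)
      fun z hz => hlim z hz.1 hz.2
  have hBA : EqOn (extendFrom S A) A S := fun z hz => extendFrom_extends hAc z hz
  have hval : ∀ z ∈ T, Tendsto A (𝓝[S] z) (𝓝 (extendFrom S A z)) := fun z hz =>
    tendsto_extendFrom (hlim z hz.1 hz.2)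
  -- `γ` is a continuous logarithm of the extended curve, so its imaginary part serves as the angle.
  set γ : ℝ → ℂ := fun t => extendFrom S A (Real.log t : ℂ) with hγdef
  have hγ : ContinuousOn γ (Icc 1 r) := by
    refine hB.comp (Complex.continuous_ofReal.comp_continuousOn (Real.continuousOn_log.mono ?_)) ?_
    · intro t ht1 h0
      rw [mem_singleton_iff] at h0; linarith [ht1.1]
    · intro t ht1
      simp only [T, mem_ofPred_eq, Complex.ofReal_re]
      exact ⟨Real.log_nonneg ht1.1, Real.log_le_log (by linarith [ht1.1]) ht1.2⟩
  have hnorm : ∀ t : ℝ, 1 ≤ t → ‖(t : ℂ)‖ = t := fun t h => by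
    rw [Complex.norm_real, Real.norm_of_nonneg (by linarith)]
  have hpolar : EqOn (fun t : ℝ => extendFrom (roundAnnulus r) ψ (t : ℂ))
      (fun t => Complex.exp (γ t)) (Icc 1 r) := by
    -- The identity holds on `(1, r)` through `A`, and both sides are continuous on `[1, r]`.
    refine EqOn.of_subset_closure (s := Ioo 1 r) (fun t ht1 => ?_)
      (hΨ.comp Complex.continuous_ofReal.continuousOn fun t ht1 => ?_)
      (Complex.continuous_exp.comp_continuousOn hγ) Ioo_subset_Icc_self (closure_Ioo hr.ne).ge
    · have ht2 : (t : ℂ) ∈ roundAnnulus r := by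
        simp only [roundAnnulus, mem_ofPred_eq, hnorm t ht1.1.le]; exact ht1
      have he : Complex.exp (Real.log t : ℂ) = t := by
        rw [← Complex.ofReal_exp, Real.exp_log (by linarith [ht1.1])]
      have ht3 : (Real.log t : ℂ) ∈ S := by
        rw [hS, ← exp_mem_roundAnnulus hr, he]; exact ht2
      simp only [hγdef]
      rw [hΨψ ht2, hBA ht3, hA _ ht3, he]
    · simp only [closedRoundAnnulus, mem_ofPred_eq, hnorm t ht1.1]; exact ht1
  have hb := hbound _ _ (hval 0 ⟨le_rfl, hR.le⟩)
    (hval (Real.log r : ℂ) ⟨by simpa using hR.le, by simp⟩)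
  refine ⟨_, hΨ, hΨψ, (γ r).im - (γ 1).im, ?_, fun t => Real.exp (γ t).re, fun t => (γ t).im,
    Real.continuous_exp.comp_continuousOn (Complex.continuous_re.comp_continuousOn hγ),
    Complex.continuous_im.comp_continuousOn hγ, fun t ht1 => ⟨Real.exp_pos _, ?_⟩, rfl⟩
  · simp only [hγdef, Real.log_one, Complex.ofReal_zero]
    exact abs_le.1 hb
  · rw [hpolar ht1]
    simp only
    rw [Complex.ofReal_exp, ← Complex.exp_add, Complex.re_add_im]
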